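/- A Parikh automaton $P=(A,\lambda,\psi)$ of dimension $d\in\mathbb N$ over a finite alphabet $\Sigma$ consists of a finite automaton $A$ with non-empty state set $Q$ reading words delimited as $\vdash u\dashv$, a map $\lambda$ from its transitions to weight vectors in $\mathbb Z^d$, and an existential Presburger formula $\psi$ with $d$ free variables; $L(P)$ is the set of words $u$ that have an accepting run whose sum of weight vectors satisfies $\psi$. The automaton is one-way if its head only moves to the right. Presburger formulas are first-order formulas over $(\mathbb Z;0,1,+,\times_2,\le)$, where $\times_2$ is doubling; the size $|\varphi|$ of a formula is its number of symbols, and $\varphi$ is existential if it has the form $\exists x_1\cdots\exists x_r\,\chi$ with $\chi$ quantifier-free. The size of $P$ is $|P|=|Q|+|\psi|+\gamma\,(d\log_2(\mu+1)+|Q|^2)$, where $\gamma$ is the number of distinct weight vectors that occur on transitions and $\mu$ is the maximal absolute value of their entries. **Lemma.** There are an algorithm and a constant $C$ such that for every one-way Parikh automaton $P$ of dimension $d$ over $\Sigma$, with $n$ states and $\gamma$ distinct weight vectors, the algorithm computes from $P$ a list of $m\ge 1$ existential Presburger formulas $\varphi_1(x),\dots,\varphi_m(x)$ such that, for $\varphi(x)=\bigvee_{i=1}^m\varphi_i(x)$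 and all $\ell\in\mathbb N$, $$\varphi(\ell)\text{ holds}\iff\text{there is a word } w\in L(P)\text{ of length }\ell .$$ Moreover $\log_2 m\le C\,(|P|+\log_2 n)^C$ and $|\varphi_i|\le C\,(|P|+\log_2 n)^C$ for all $i$, and the algorithm takes time at most $$2^{C\gamma^2\log_2(\gamma n)}\cdot C\,(|P|+|\Sigma|+d)^C$$ (where $\gamma^2\log_2(\gamma n)$ is read as $0$ if $\gamma=0$). -/

import Mathlib

namespace Parikh

/-! ### Presburger formulas

Formulas are well scoped: `Formula n` is the type of Presburger formulas whose free variables are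
among `x_0, …, x_{n-1}`. A quantifier binds the variable with the next free number, so the body of
`∃ x_n Φ` is an element of `Formula (n + 1)`. Variables range over `ℤ`. -/

/-- Terms over the signature `{0, 1, +, ×₂}`. -/
inductive Term (n : ℕ) : Type
  | var (i : Fin n) : Term n
  | zero : Term n
  | one : Term n
  | add (s t : Term n) : Term n
  | dbl (t : Term n) : Term n

/-- Presburger formulas `t ≤ t | ∃ x Φ | Φ ∧ Φ | Φ ∨ Φ | ¬ Φ`. -/
inductive Formula : ℕ → Type
  | le {n : ℕ} (s t : Term n) : Formula n
  | ex {n : ℕ} (φ : Formula (n + 1)) : Formula n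
  | and {n : ℕ} (φ χ : Formula n) : Formula n
  | or {n : ℕ} (φ χ : Formula n) : Formula n
  | not {n : ℕ} (φ : Formula n) : Formula n

def Term.eval {n : ℕ} (v : Fin n → ℤ) : Term n → ℤ
  | .var i => v i
  | .zero => 0
  | .one => 1
  | .add s t => s.eval v + t.eval v
  | .dbl t => 2 * t.eval v

/-- `φ.Holds v` is `v ⊨ φ`. -/
def Formula.Holds : {n : ℕ} → Formula n → (Fin n → ℤ) → Prop
  | _, .le s t, v => s.eval v ≤ t.eval v
  | n, .ex φ, v => ∃ x : ℤ, φ.Holds (Fin.snoc (α := fun _ : Fin (n + 1) => ℤ) v x)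
  | _, .and φ χ, v => φ.Holds v ∧ χ.Holds v
  | _, .or φ χ, v => φ.Holds v ∨ χ.Holds v
  | _, .not φ, v => ¬ φ.Holds v

/-- The number of symbols of a term. -/
def Term.size {n : ℕ} : Term n → ℕ
  | .var _ => 1
  | .zero => 1
  | .one => 1
  | .add s t => s.size + t.size + 1
  | .dbl t => t.size + 1

/-- The number of symbols of a formula; a quantifier `∃ x` counts for two. -/
def Formula.size : {n : ℕ} → Formula n → ℕ
  | _, .le s t => s.size + t.size + 1
  | _, .ex φ => φ.size + 2
  | _, .and φ χ => φ.size + χ.size + 1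
  | _, .or φ χ => φ.size + χ.size + 1
  | _, .not φ => φ.size + 1

def Formula.QuantifierFree : {n : ℕ} → Formula n → Prop
  | _, .le _ _ => True
  | _, .ex _ => False
  | _, .and φ χ => φ.QuantifierFree ∧ χ.QuantifierFree
  | _, .or φ χ => φ.QuantifierFree ∧ χ.QuantifierFree
  | _, .not φ => φ.QuantifierFree

/-- Existential Presburger formulas `∃ x₁ … ∃ x_r [χ]` with `χ` quantifier free. -/
inductive Formula.IsExistential : {n : ℕ} → Formula n → Prop
  | qf {n : ℕ} {φ : Formula n} : φ.QuantifierFree → Formula.IsExistential φ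
  | ex {n : ℕ} {φ : Formula (n + 1)} : Formula.IsExistential φ → Formula.IsExistential (.ex φ)

/-- The disjunction of the formulas in a list; the empty disjunction is the formula `1 ≤ 0`. -/
def Formula.disj {n : ℕ} : List (Formula n) → Formula n
  | [] => .le .one .zero
  | [φ] => φ
  | φ :: χ :: l => .or φ (Formula.disj (χ :: l))

/-! ### Two-way automata -/

/-- The input letters together with the delimiters `⊢` (`lend`) and `⊣` (`rend`). -/
inductive Letter (σ : Type) : Type
  | lend : Letter σ
  | rend : Letter σ
  | sym (a : σ) : Letter σ
  deriving DecidableEq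

/-- The word `⊢ u ⊣`. -/
def delimited {σ : Type} (u : List σ) : List (Letter σ) :=
  .lend :: (u.map .sym ++ [.rend])

/-- Two-way finite automata with state set `Q` over the alphabet `σ`. The state set is partitioned
into the left-reading states `QL` and the remaining, right-reading ones. -/
structure TwoFA (Q σ : Type) where
  nonempty : Nonempty Q
  QL : Finset Q
  QI : Finset Q
  QH : Finset Q
  QF : Finset Q
  Δ : Finset (Q × Letter σ × Q)
  QI_right : ∀ q ∈ QI, q ∉ QL
  QF_subset : QF ⊆ QH
  halting_stop : ∀ q ∈ QH, ∀ (a : Letter σ) (q' : Q), (q, a, q') ∉ Δ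
  lend_bound : ∀ q ∈ QL, ∀ q' ∈ QL, (q, Letter.lend, q') ∉ Δ
  rend_bound : ∀ q q' : Q, q ∉ QL → q' ∉ QL → q' ∉ QF → (q, Letter.rend, q') ∉ Δ
  halting_rend : ∀ (q : Q) (a : Letter σ) (q' : Q),
    (q, a, q') ∈ Δ → q' ∈ QH → q ∉ QL ∧ a = Letter.rend

/-- A configuration `(uL, p, uR)`: the head is between `uL` and `uR`. -/
structure Config (Q σ : Type) where
  left : List (Letter σ)
  state : Q
  right : List (Letter σ)

/-- One move, reading the letter `a`: a right-reading state reads the letter to the right of the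
head and moves right, a left-reading state reads the letter to the left and moves left. -/
def TwoFA.Step {Q σ : Type} (A : TwoFA Q σ) (c : Config Q σ) (a : Letter σ) (c' : Config Q σ) :
    Prop :=
  (c.state, a, c'.state) ∈ A.Δ ∧
    ((c.state ∉ A.QL ∧ c.right = a :: c'.right ∧ c'.left = c.left ++ [a]) ∨
      (c.state ∈ A.QL ∧ c.left = c'.left ++ [a] ∧ c'.right = a :: c.right))

/-- `A.Run c ts c'`: there is a run from `c` to `c'` with the sequence `ts` of transitions. -/
inductive TwoFA.Run {Q σ : Type} (A : TwoFA Q σ) :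
    Config Q σ → List (Q × Letter σ × Q) → Config Q σ → Prop
  | nil (c : Config Q σ) : TwoFA.Run A c [] c
  | cons {c c' c'' : Config Q σ} {a : Letter σ} {ts : List (Q × Letter σ × Q)} :
      A.Step c a c' → TwoFA.Run A c' ts c'' → TwoFA.Run A c ((c.state, a, c'.state) :: ts) c''

/-- `ts` is the sequence of transitions of an accepting run on `u`. -/
def TwoFA.AcceptingRun {Q σ : Type} (A : TwoFA Q σ) (u : List σ) (ts : List (Q × Letter σ × Q)) :
    Prop :=
  ∃ q₀ ∈ A.QI, ∃ c : Config Q σ,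
    A.Run ⟨[], q₀, delimited u⟩ ts c ∧ c.state ∈ A.QF ∧ c.right = []

/-! ### Two-way Parikh automata -/

/-- Two-way Parikh automata of dimension `d`. Only the values of the weight function `wt` on
transitions of the automaton matter. -/
structure TwoPA (Q σ : Type) (d : ℕ) extends TwoFA Q σ where
  wt : Q × Letter σ × Q → Fin d → ℤ
  ψ : Formula d
  ψ_existential : ψ.IsExistential

namespace TwoPA

variable {Q σ : Type} {d : ℕ}

/-- The words `u` with an accepting run whose value satisfies the acceptance constraint. -/
def language (P : TwoPA Q σ d) : Language σ :=
  {u | ∃ ts, P.AcceptingRun u ts ∧ P.ψ.Holds (ts.map P.wt).sum}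

/-- An automaton is one-way if it has no left-reading state. -/
def IsOneWay (P : TwoPA Q σ d) : Prop := P.QL = ∅

/-- The set of weight vectors that occur on transitions. -/
def weights (P : TwoPA Q σ d) : Finset (Fin d → ℤ) := P.Δ.image P.wt

/-- The number `γ` of distinct weight vectors. -/
def numWeights (P : TwoPA Q σ d) : ℕ := P.weights.card

/-- The maximal absolute value of an entry of a weight vector. -/
def maxEntry (P : TwoPA Q σ d) : ℕ :=
  P.weights.sup fun v => Finset.univ.sup fun i => (v i).natAbs

/-- The representation size `|P| = |Q| + |ψ| + γ (d log₂ (μ + 1) + |Q|²)`. -/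
noncomputable def size [Fintype Q] (P : TwoPA Q σ d) : ℝ :=
  Fintype.card Q + P.ψ.size +
    P.numWeights * (d * Real.logb 2 (P.maxEntry + 1) + (Fintype.card Q : ℝ) ^ 2)

end TwoPA

/-! ### A model of computation

Programs of a WHILE language over binary trees with one register. Every operation is a constant
number of pointer operations, so that the running times are those of a multi-tape Turing machine up
to a polynomial. -/

/-- Binary trees, the data of programs. -/
inductive Dat : Type
  | nil : Dat
  | cons (a b : Dat) : Dat

/-- The number of nodes of a tree. -/
def Dat.size : Dat → ℕ
  | .nil => 1
  | .cons a b => a.size + b.size + 1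

def Dat.head : Dat → Dat
  | .nil => .nil
  | .cons a _ => a

def Dat.tail : Dat → Dat
  | .nil => .nil
  | .cons _ b => b

/-- Programs. Each one transforms the content of the register: `id` keeps it, `cons p q` builds a
tree from the results of `p` and `q`, `comp p q` is `q` after `p`, `ite c p q` is `p` if the result
of `c` is not `nil` and `q` otherwise, `loop c p` repeats `p` while the result of `c` is not
`nil`. -/
inductive Prog : Type
  | id : Prog
  | nil : Prog
  | head : Prog
  | tail : Prog
  | cons (p q : Prog) : Prog
  | comp (p q : Prog) : Prog
  | ite (c p q : Prog) : Prog
  | loop (c p : Prog) : Prog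

/-- `p.Eval x y t`: on the input `x` the program `p` halts with the result `y` after `t` steps. -/
inductive Prog.Eval : Prog → Dat → Dat → ℕ → Prop
  | id (x : Dat) : Prog.Eval .id x x 1
  | nil (x : Dat) : Prog.Eval .nil x .nil 1
  | head (x : Dat) : Prog.Eval .head x x.head 1
  | tail (x : Dat) : Prog.Eval .tail x x.tail 1
  | cons {p q : Prog} {x y z : Dat} {s t : ℕ} :
      Prog.Eval p x y s → Prog.Eval q x z t → Prog.Eval (.cons p q) x (.cons y z) (s + t + 1)
  | comp {p q : Prog} {x y z : Dat} {s t : ℕ} :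
      Prog.Eval p x y s → Prog.Eval q y z t → Prog.Eval (.comp p q) x z (s + t + 1)
  | ite_true {c p q : Prog} {x y a b : Dat} {s t : ℕ} :
      Prog.Eval c x (.cons a b) s → Prog.Eval p x y t → Prog.Eval (.ite c p q) x y (s + t + 1)
  | ite_false {c p q : Prog} {x y : Dat} {s t : ℕ} :
      Prog.Eval c x .nil s → Prog.Eval q x y t → Prog.Eval (.ite c p q) x y (s + t + 1)
  | loop_stop {c p : Prog} {x : Dat} {s : ℕ} :
      Prog.Eval c x .nil s → Prog.Eval (.loop c p) x x (s + 1)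
  | loop_step {c p : Prog} {x y z a b : Dat} {r s t : ℕ} :
      Prog.Eval c x (.cons a b) r → Prog.Eval p x y s → Prog.Eval (.loop c p) y z t →
        Prog.Eval (.loop c p) x z (r + s + t + 1)

/-- `p` computes `y` from `x` in time at most `T`; besides the steps, the number of nodes of the
output is charged, as no part of it may be shared when it is written out. -/
def Prog.ComputesIn (p : Prog) (x y : Dat) (T : ℝ) : Prop :=
  ∃ t : ℕ, p.Eval x y t ∧ ((t + y.size : ℕ) : ℝ) ≤ T

/-! ### Encodings of inputs and outputs as trees -/

def encList : List Dat → Dat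
  | [] => .nil
  | a :: l => .cons a (encList l)

def encBool : Bool → Dat
  | false => .nil
  | true => .cons .nil .nil

/-- Natural numbers are written in binary. -/
def encNat (n : ℕ) : Dat := encList (n.bits.map encBool)

/-- Integers are written as a sign and a binary absolute value. -/
def encInt (z : ℤ) : Dat := .cons (encBool (decide (z < 0))) (encNat z.natAbs)

def Term.encode {n : ℕ} : Term n → Dat
  | .var i => .cons (encNat 0) (encNat i)
  | .zero => .cons (encNat 1) .nil
  | .one => .cons (encNat 2) .nil
  | .add s t => .cons (encNat 3) (.cons s.encode t.encode)
  | .dbl t => .cons (encNat 4) t.encode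

def Formula.encode : {n : ℕ} → Formula n → Dat
  | _, .le s t => .cons (encNat 0) (.cons s.encode t.encode)
  | _, .ex φ => .cons (encNat 1) φ.encode
  | _, .and φ χ => .cons (encNat 2) (.cons φ.encode χ.encode)
  | _, .or φ χ => .cons (encNat 3) (.cons φ.encode χ.encode)
  | _, .not φ => .cons (encNat 4) φ.encode

namespace TwoPA

variable {n k d : ℕ}

/-- The transitions from `p` on the letter `a`: for each state `q`, the singleton list of the weight
vector if `(p, a, q)` is a transition, and the empty list otherwise. -/
def encRow (P : TwoPA (Fin n) (Fin k) d) (p : Fin n) (a : Letter (Fin k)) : Dat :=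
  encList (List.ofFn fun q : Fin n =>
    if (p, a, q) ∈ P.Δ then
      encList [encList (List.ofFn fun i : Fin d => encInt (P.wt (p, a, q) i))]
    else encList [])

/-- A state: the four subsets of the state set to which it belongs and its outgoing transitions. -/
def encState (P : TwoPA (Fin n) (Fin k) d) (p : Fin n) : Dat :=
  encList [encBool (decide (p ∈ P.QL)), encBool (decide (p ∈ P.QI)),
    encBool (decide (p ∈ P.QH)), encBool (decide (p ∈ P.QF)),
    P.encRow p .lend, P.encRow p .rend,
    encList (List.ofFn fun a : Fin k => P.encRow p (.sym a))]

/-- The input that represents `P`: its dimension, its states with their outgoing transitions, and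
its acceptance constraint. -/
def encode (P : TwoPA (Fin n) (Fin k) d) : Dat :=
  encList [encNat d, encList (List.ofFn fun p : Fin n => P.encState p), P.ψ.encode]

end TwoPA

end Parikh

/-!
One existential formula for the lengths of the words in the language is enough, and it can be
computed in polynomial time, so that the exponential factor in the time bound, which is at least
`1`, is not needed.

A one-way automaton is a graph: its vertices are a start `0`, an end `1` and the states, and its
edges are the transitions, labelled with weight vectors. Words of length `ℓ` with an accepting run
are walks from `0` to `1` with `ℓ + 2` edges (`TwoPA.exists_mem_language_iff`). The letters are
irrelevant for the lengths of words. So transitions that agree in their states and weights are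
identified, which leaves at most `γ (n + 2) ^ 2` edges, whatever the alphabet is
(`TwoPA.length_edges_le`).

By Euler's theorem on trails, a multiset of edges can be arranged to a walk from `0` to `1` iff
the edges are balanced at all vertices, up to a unit that flows from `0` to `1`, and all vertices at
which they start can be reached from `0` (`Balanced.exists_trail_eq`). Reachability has
a certificate: a labelling of the vertices with integers such that each vertex that is left by some
edge, apart from `0`, is entered by an edge from a vertex with a smaller label
(`src_mem_of_labelling`, `IsTrail.exists_labelling`). These are linear conditions on the
multiplicities of the edges and the labels, and the length and the value of a walk are linear in
the multiplicities as well. Hence a Presburger formula whose existential quantifiers range over the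
labels, the multiplicities and the bound variables of the acceptance constraint expresses that there
is a word of a given length (`exists_holds_trailForm_iff`). In the constraint, a free variable
is replaced by a component of the value, which is a difference of two sums of terms, as the
signature has no subtraction; multiplication by a weight is done by doubling, with a term whose
length is linear in the number of its bits. Each occurrence of a variable is replaced separately, so
that the size of the formula does not depend on the dimension
(`TwoPA.exists_size_lengthFormula_le`).

The programs of the model of computation are handled by closure properties of the class `PolyTime`
of polynomial-time functions between encoded types. It is closed under composition, case
distinction, loops with a polynomial number of iterations (`PolyTime.whileLoop`), folds over lists
whose intermediate results have polynomial size (`PolyTime.foldl`) and recursion on trees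
(`PolyTime.datFold`). The class contains equality of trees, binary counters and the substitution of
terms in encoded formulas, and therefore the construction of the formula
(`polyTime_lengthFormulas`).
-/

namespace Parikh

/-! ### Polynomial time for encoded types -/

theorem Dat.one_le_size (x : Dat) : 1 ≤ x.size := by
  cases x <;> simp [Dat.size]

theorem Prog.Eval.loop_of_nil {c : Prog} (p : Prog) {x : Dat} {s : ℕ} (h : c.Eval x .nil s) :
    (Prog.loop c p).Eval x x (s + 1) := by
  constructor
  exact h

/-- Types whose elements are written as trees. The instances below agree with the encodings of the
inputs and outputs of programs; in particular a list of encodings is its own encoding. -/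
class Enc (α : Type) where
  enc : α → Dat

open Enc

/-- The size of the tree that encodes an element. -/
def esize {α : Type} [Enc α] (a : α) : ℕ := (enc a).size

section

variable {α β γ δ σ : Type} [Enc α] [Enc β] [Enc γ] [Enc δ] [Enc σ]

theorem one_le_esize (a : α) : 1 ≤ esize a := Dat.one_le_size _

theorem mul_pow_le_mul_pow {k m c s : ℕ} (hs : 1 ≤ s) (hk : k ≤ c) (hm : m ≤ c) :
    k * s ^ m ≤ c * s ^ c :=
  Nat.mul_le_mul hk (Nat.pow_le_pow_right hs hm)

/-- A quantity is polynomially bounded in the size of the encoding of its argument. The constant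
serves both as factor and as exponent. -/
def PolyBounded (b : α → ℕ) : Prop := ∃ c, ∀ a, b a ≤ c * esize a ^ c

namespace PolyBounded

theorem of_le {b b' : α → ℕ} (h : PolyBounded b') (hb : ∀ a, b a ≤ b' a) : PolyBounded b :=
  let ⟨c, hc⟩ := h
  ⟨c, fun a => (hb a).trans (hc a)⟩

theorem of_le_mul_pow {b : α → ℕ} (k m : ℕ) (h : ∀ a, b a ≤ k * esize a ^ m) : PolyBounded b :=
  ⟨k + m, fun a => (h a).trans (mul_pow_le_mul_pow (one_le_esize a) (by omega) (by omega))⟩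

theorem const (k : ℕ) : PolyBounded (fun _ : α => k) := of_le_mul_pow k 0 (by simp)

theorem esize_self : PolyBounded (fun a : α => esize a) := of_le_mul_pow 1 1 (by simp)

theorem add {b b' : α → ℕ} (h : PolyBounded b) (h' : PolyBounded b') :
    PolyBounded (fun a => b a + b' a) := by
  obtain ⟨c, hc⟩ := h
  obtain ⟨c', hc'⟩ := h'
  refine ⟨c + c', fun a => ?_⟩
  have h2 : c * esize a ^ c ≤ c * esize a ^ (c + c') :=
    Nat.mul_le_mul_left _ (Nat.pow_le_pow_right (one_le_esize a) (by omega))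
  have h3 : c' * esize a ^ c' ≤ c' * esize a ^ (c + c') :=
    Nat.mul_le_mul_left _ (Nat.pow_le_pow_right (one_le_esize a) (by omega))
  have := hc a
  have := hc' a
  show b a + b' a ≤ _
  rw [add_mul]
  omega

theorem mul {b b' : α → ℕ} (h : PolyBounded b) (h' : PolyBounded b') :
    PolyBounded (fun a => b a * b' a) := by
  obtain ⟨c, hc⟩ := h
  obtain ⟨c', hc'⟩ := h'
  refine of_le_mul_pow (c * c') (c + c') fun a => (Nat.mul_le_mul (hc a) (hc' a)).trans ?_
  rw [pow_add]
  exact le_of_eq (by ring)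

theorem pow {b : α → ℕ} (h : PolyBounded b) (k : ℕ) : PolyBounded (fun a => b a ^ k) := by
  induction k with
  | zero => simpa using const 1
  | succ k ih => simpa only [pow_succ] using ih.mul h

theorem comp {b : β → ℕ} {f : α → β} (hb : PolyBounded b)
    (hf : PolyBounded (fun a => esize (f a))) : PolyBounded (fun a => b (f a)) := by
  obtain ⟨c, hc⟩ := hb
  exact ((const c).mul (hf.pow c)).of_le fun a => hc (f a)

end PolyBounded

/-- A function is computed by a program in polynomial time, and its values have polynomial size.
The second condition does not follow from the first one, since a program may double the size of
its register in one step. -/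
@[fun_prop]
def PolyTime (f : α → β) : Prop :=
  ∃ (p : Prog) (T : α → ℕ), PolyBounded T ∧ PolyBounded (fun a => esize (f a)) ∧
    ∀ a, ∃ t ≤ T a, p.Eval (enc a) (enc (f a)) t

theorem PolyTime.bounded {f : α → β} (hf : PolyTime f) : PolyBounded (fun a => esize (f a)) :=
  let ⟨_, _, _, h, _⟩ := hf
  h

instance : Enc Dat := ⟨fun x => x⟩
instance : Enc Unit := ⟨fun _ => .nil⟩
instance : Enc Bool := ⟨encBool⟩
instance : Enc ℕ := ⟨encNat⟩
instance : Enc ℤ := ⟨encInt⟩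
instance : Enc (α × β) := ⟨fun x => .cons (enc x.1) (enc x.2)⟩
instance : Enc (List α) := ⟨fun l => encList (l.map enc)⟩

theorem enc_cons (a : α) (l : List α) : enc (a :: l) = .cons (enc a) (enc l) := rfl

theorem esize_pair (a : α) (b : β) : esize (a, b) = esize a + esize b + 1 := rfl
theorem esize_nil : esize ([] : List α) = 1 := rfl
theorem esize_cons (a : α) (l : List α) : esize (a :: l) = esize a + esize l + 1 := rfl

theorem esize_bool (b : Bool) : esize b ≤ 3 := by cases b <;> decide

namespace PolyTime

/-- Functions that do not change the encoding are computed by the identity program. -/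
theorem of_enc_eq_self {f : α → β} (h : ∀ a, enc (f a) = enc a) : PolyTime f :=
  ⟨.id, fun _ => 1, .const 1, .of_le .esize_self fun a => by simp [esize, h],
    fun a => ⟨1, le_rfl, by rw [h]; exact .id _⟩⟩

theorem of_enc_eq {f : α → β} {g : α → γ} (hg : PolyTime g) (h : ∀ a, enc (f a) = enc (g a)) :
    PolyTime f := by
  obtain ⟨p, T, hT, hS, hp⟩ := hg
  exact ⟨p, T, hT, by simpa only [esize, h] using hS, fun a => by rw [h]; exact hp a⟩

@[fun_prop]
theorem id' : PolyTime (fun a : α => a) := of_enc_eq_self fun _ => rfl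

@[fun_prop]
theorem comp {f : β → γ} {g : α → β} (hf : PolyTime f) (hg : PolyTime g) :
    PolyTime (fun a => f (g a)) := by
  obtain ⟨p, T, hT, hS, hp⟩ := hf
  obtain ⟨q, U, hU, hR, hq⟩ := hg
  refine ⟨.comp q p, fun a => U a + T (g a) + 1, (hU.add (hT.comp hR)).add (.const 1),
    hS.comp hR, fun a => ?_⟩
  obtain ⟨t, ht, h1⟩ := hp (g a)
  obtain ⟨u, hu, h2⟩ := hq a
  exact ⟨u + t + 1, by dsimp only; omega, .comp h2 h1⟩

@[fun_prop]
theorem pair {f : α → β} {g : α → γ} (hf : PolyTime f) (hg : PolyTime g) :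
    PolyTime (fun a => (f a, g a)) := by
  obtain ⟨p, T, hT, hS, hp⟩ := hf
  obtain ⟨q, U, hU, hR, hq⟩ := hg
  refine ⟨.cons p q, fun a => T a + U a + 1, (hT.add hU).add (.const 1),
    (hS.add hR).add (.const 1), fun a => ?_⟩
  obtain ⟨t, ht, h1⟩ := hp a
  obtain ⟨u, hu, h2⟩ := hq a
  exact ⟨t + u + 1, by dsimp only; omega, .cons h1 h2⟩

@[fun_prop]
theorem fst : PolyTime (fun x : α × β => x.1) :=
  ⟨.head, fun _ => 1, .const 1, .of_le .esize_self fun a => by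
    have := esize_pair a.1 a.2
    simp only [Prod.mk.eta] at this
    dsimp only
    omega, fun a => ⟨1, le_rfl, .head (enc a)⟩⟩

@[fun_prop]
theorem snd : PolyTime (fun x : α × β => x.2) :=
  ⟨.tail, fun _ => 1, .const 1, .of_le .esize_self fun a => by
    have := esize_pair a.1 a.2
    simp only [Prod.mk.eta] at this
    dsimp only
    omega, fun a => ⟨1, le_rfl, .tail (enc a)⟩⟩

@[fun_prop]
theorem const (b : β) : PolyTime (fun _ : α => b) := by
  suffices h : ∀ y : Dat, PolyTime (fun _ : α => y) from (h (enc b)).of_enc_eq fun _ => rfl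
  intro y
  induction y with
  | nil => exact ⟨.nil, fun _ => 1, .const 1, .const 1, fun a => ⟨1, le_rfl, .nil _⟩⟩
  | cons x y hx hy => exact (hx.pair hy).of_enc_eq fun _ => rfl

@[fun_prop]
theorem ite {c : α → Bool} {f g : α → β} (hc : PolyTime c) (hf : PolyTime f) (hg : PolyTime g) :
    PolyTime (fun a => if c a then f a else g a) := by
  obtain ⟨r, V, hV, -, hr⟩ := hc
  obtain ⟨p, T, hT, hS, hp⟩ := hf
  obtain ⟨q, U, hU, hR, hq⟩ := hg
  refine ⟨.ite r p q, fun a => V a + (T a + U a) + 1, (hV.add (hT.add hU)).add (.const 1),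
    (hS.add hR).of_le fun a => by dsimp only; split <;> omega, fun a => ?_⟩
  obtain ⟨t, ht, h1⟩ := hp a
  obtain ⟨u, hu, h2⟩ := hq a
  obtain ⟨v, hv, h3⟩ := hr a
  dsimp only
  cases h : c a
  · rw [h] at h3
    exact ⟨v + u + 1, by omega, .ite_false h3 h2⟩
  · rw [h] at h3
    exact ⟨v + t + 1, by omega, .ite_true h3 h1⟩

@[fun_prop]
theorem listCons {f : α → β} {g : α → List β} (hf : PolyTime f) (hg : PolyTime g) :
    PolyTime (fun a => f a :: g a) := (hf.pair hg).of_enc_eq fun _ => rfl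

/-- Case distinction on a list. The program can branch on the list itself, as only the empty list
is encoded by `nil`. -/
theorem listCases {L : α → List γ} {f : α → β} {h : α → γ → List γ → β} (hL : PolyTime L)
    (hf : PolyTime f) (hh : PolyTime (fun x : α × γ × List γ => h x.1 x.2.1 x.2.2)) :
    PolyTime (fun a => match L a with
      | [] => f a
      | g :: l => h a g l) := by
  obtain ⟨r, V, hV, hQ, hr⟩ := hL
  obtain ⟨p, T, hT, hS, hp⟩ := hf
  obtain ⟨q, U, ⟨u, hU⟩, ⟨w, hR⟩, hq⟩ := hh
  have key : ∀ (a : α) (g : γ) (l : List γ), L a = g :: l →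
      esize (a, g, l) = esize a + esize (L a) + 1 := fun a g l e => by rw [e]; rfl
  have hpoly : ∀ k, PolyBounded (fun a => k * (esize a + esize (L a) + 1) ^ k) := fun k =>
    (PolyBounded.const k).mul (((PolyBounded.esize_self.add hQ).add (.const 1)).pow k)
  refine ⟨.ite r (.comp (.cons .id r) q) p,
    fun a => V a + (T a + (V a + u * (esize a + esize (L a) + 1) ^ u)) + 10,
    (hV.add (hT.add (hV.add (hpoly u)))).add (.const 10),
    (hS.add (hpoly w)).of_le fun a => ?_, fun a => ?_⟩
  · dsimp only
    split
    · omega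
    · rename_i g l e
      have := hR (a, g, l)
      rw [key a g l e] at this
      exact this.trans (Nat.le_add_left _ _)
  · obtain ⟨v, hv, h3⟩ := hr a
    dsimp only
    cases e : L a with
    | nil =>
      obtain ⟨t, ht, h1⟩ := hp a
      rw [e] at h3
      exact ⟨v + t + 1, by omega, .ite_false h3 h1⟩
    | cons g l =>
      obtain ⟨t, ht, h1⟩ := hq (a, g, l)
      rw [e] at h3
      have := hU (a, g, l)
      rw [key a g l e, e] at this
      refine ⟨v + ((1 + v + 1) + t + 1) + 1, ?_, .ite_true h3 (.comp (.cons (.id _) h3) h1)⟩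
      omega

/-- While loops: an invariant `Inv` bounds the size of the state and determines the final result,
and a measure `m` bounds the number of iterations. -/
theorem whileLoop {c : σ → Bool} {step : σ → σ} {init : α → σ} {out : σ → β} {f : α → β}
    (hc : PolyTime c) (hstep : PolyTime step) (hinit : PolyTime init) (hout : PolyTime out)
    (Inv : α → σ → Prop) (m : σ → ℕ) {B N : α → ℕ} (hB : PolyBounded B) (hN : PolyBounded N)
    (h0 : ∀ a, Inv a (init a)) (hm0 : ∀ a, m (init a) ≤ N a)
    (hInv : ∀ a s, Inv a s → c s = true → Inv a (step s) ∧ m (step s) < m s)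
    (hsize : ∀ a s, Inv a s → esize s ≤ B a)
    (hres : ∀ a s, Inv a s → c s = false → out s = f a) : PolyTime f := by
  obtain ⟨r, V, ⟨v, hV⟩, -, hr⟩ := hc
  obtain ⟨p, T, ⟨t, hT⟩, -, hp⟩ := hstep
  obtain ⟨i, I, hI, -, hi⟩ := hinit
  obtain ⟨o, O, ⟨w, hO⟩, ⟨y, hY⟩, ho⟩ := hout
  have le : ∀ (k : ℕ) a s, Inv a s → k * esize s ^ k ≤ k * B a ^ k := fun k a s hs =>
    Nat.mul_le_mul_left _ (Nat.pow_le_pow_left (hsize a s hs) k)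
  have hpoly : ∀ k, PolyBounded (fun a => k * B a ^ k) := fun k =>
    (PolyBounded.const k).mul (hB.pow k)
  have main : ∀ (a : α) (k : ℕ) (s : σ), Inv a s → m s ≤ k →
      ∃ s', Inv a s' ∧ c s' = false ∧ ∃ u ≤ (k + 1) * (v * B a ^ v + t * B a ^ t + 1),
        (Prog.loop r p).Eval (enc s) (enc s') u := by
    intro a k
    induction k with
    | zero =>
      intro s hs hk
      cases e : c s with
      | true => have := (hInv a s hs e).2; omega
      | false =>
        obtain ⟨x, hx, h1⟩ := hr s
        rw [e] at h1
        refine ⟨s, hs, e, x + 1, ?_, .loop_of_nil p h1⟩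
        have := hV s
        have := le v a s hs
        omega
    | succ k ih =>
      intro s hs hk
      obtain ⟨x, hx, h1⟩ := hr s
      have h2 := hV s
      have h3 := le v a s hs
      cases e : c s with
      | true =>
        obtain ⟨hs', hm'⟩ := hInv a s hs e
        obtain ⟨s', h4, h5, u, hu, h6⟩ := ih (step s) hs' (by omega)
        obtain ⟨z, hz, h7⟩ := hp s
        rw [e] at h1
        refine ⟨s', h4, h5, x + z + u + 1, ?_, .loop_step h1 h7 h6⟩
        have := hT s
        have := le t a s hs
        rw [add_mul (k + 1), one_mul]
        omega
      | false =>
        rw [e] at h1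
        refine ⟨s, hs, e, x + 1, ?_, .loop_of_nil p h1⟩
        have : 1 * (v * B a ^ v + t * B a ^ t + 1) ≤
            (k + 1 + 1) * (v * B a ^ v + t * B a ^ t + 1) := Nat.mul_le_mul_right _ (by omega)
        omega
  refine ⟨.comp i (.comp (.loop r p) o),
    fun a => I a + ((N a + 1) * (v * B a ^ v + t * B a ^ t + 1) + w * B a ^ w + 1) + 1,
    (hI.add ((((hN.add (.const 1)).mul (((hpoly v).add (hpoly t)).add (.const 1))).add
      (hpoly w)).add (.const 1))).add (.const 1), (hpoly y).of_le fun a => ?_, fun a => ?_⟩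
  · obtain ⟨s', h1, h2, -⟩ := main a (N a) (init a) (h0 a) (hm0 a)
    rw [← hres a s' h1 h2]
    exact (hY s').trans (le y a s' h1)
  · obtain ⟨s', h1, h2, u, hu, h3⟩ := main a (N a) (init a) (h0 a) (hm0 a)
    obtain ⟨x, hx, h4⟩ := hi a
    obtain ⟨z, hz, h5⟩ := ho s'
    rw [hres a s' h1 h2] at h5
    refine ⟨x + (u + z + 1) + 1, ?_, .comp h4 (.comp h3 h5)⟩
    have := hO s'
    have := le w a s' h1
    dsimp only
    omega

end PolyTime

end

section

variable {α β γ δ σ : Type} [Enc α] [Enc β] [Enc γ] [Enc δ] [Enc σ]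

/-! ### Lists in polynomial time -/

theorem esize_append (l l' : List α) : esize (l ++ l') + 1 = esize l + esize l' := by
  induction l with
  | nil => rw [List.nil_append, esize_nil]; omega
  | cons a l ih => rw [List.cons_append, esize_cons, esize_cons]; omega

theorem esize_reverse (l : List α) : esize l.reverse = esize l := by
  induction l with
  | nil => rfl
  | cons a l ih =>
    have := esize_append l.reverse [a]
    rw [List.reverse_cons]
    rw [esize_cons, esize_nil] at this
    rw [esize_cons]
    omega

theorem length_lt_esize (l : List α) : l.length < esize l := by
  induction l with
  | nil => simp [esize_nil]
  | cons a l ih => rw [List.length_cons, esize_cons]; have := one_le_esize a; omega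

theorem esize_lt_of_mem {a : α} {l : List α} (h : a ∈ l) : esize a < esize l := by
  induction l with
  | nil => simp at h
  | cons b l ih =>
    rw [esize_cons]
    rcases List.mem_cons.1 h with rfl | h
    · omega
    · have := ih h; omega

theorem esize_le_of_forall {l : List α} {K : ℕ} (h : ∀ a ∈ l, esize a ≤ K) :
    esize l ≤ l.length * (K + 1) + 1 := by
  induction l with
  | nil => simp [esize_nil]
  | cons a l ih =>
    rw [esize_cons, List.length_cons, add_mul]
    have := ih fun b hb => h b (List.mem_cons_of_mem _ hb)
    have := h a List.mem_cons_self
    omega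

/-- A polynomial bound that holds for all elements of a list computed from the input. -/
theorem PolyBounded.exists_forall_mem {b : α × γ → ℕ} {L : α → List γ}
    (hb : PolyBounded b) (hL : PolyTime L) :
    ∃ K : α → ℕ, PolyBounded K ∧ ∀ a, ∀ g ∈ L a, b (a, g) ≤ K a := by
  obtain ⟨c, hc⟩ := hb
  refine ⟨fun a => c * (esize a + esize (L a)) ^ c,
    (const c).mul ((esize_self.add hL.bounded).pow c), fun a g hg => (hc _).trans ?_⟩
  refine Nat.mul_le_mul_left _ (Nat.pow_le_pow_left ?_ c)
  have := esize_lt_of_mem hg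
  rw [esize_pair]
  omega

namespace PolyTime

theorem of_eq {f g : α → β} (hf : PolyTime f) (h : ∀ a, f a = g a) : PolyTime g :=
  (funext h : f = g) ▸ hf

/-- Folds over a list, if all intermediate results have polynomial size. -/
theorem foldl {L : α → List γ} {I : α → β} {F : α → β → γ → β} (hL : PolyTime L)
    (hI : PolyTime I) (hF : PolyTime (fun x : α × β × γ => F x.1 x.2.1 x.2.2)) {B : α → ℕ}
    (hB : PolyBounded B)
    (hsize : ∀ a l₁ l₂, L a = l₁ ++ l₂ → esize (l₁.foldl (F a) (I a)) ≤ B a) :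
    PolyTime (fun a => (L a).foldl (F a) (I a)) := by
  have hstep : PolyTime (fun s : α × List γ × β => match s.2.1 with
      | [] => s
      | g :: l => (s.1, l, F s.1 s.2.2 g)) := by
    refine listCases (L := fun s : α × List γ × β => s.2.1)
      (h := fun s g l => (s.1, l, F s.1 s.2.2 g)) (by fun_prop) (by fun_prop) ?_
    have := hF.comp (g := fun x : (α × List γ × β) × γ × List γ => (x.1.1, x.1.2.2, x.2.1))
      (by fun_prop)
    dsimp only at this
    fun_prop
  have hcond : PolyTime (fun s : α × List γ × β => match s.2.1 with
      | [] => false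
      | _ :: _ => true) :=
    listCases (L := fun s : α × List γ × β => s.2.1) (h := fun _ _ _ => true)
      (by fun_prop) (by fun_prop) (by fun_prop)
  -- The state keeps the parameter, the remaining list and the intermediate result.
  refine whileLoop hcond hstep (init := fun a => (a, L a, I a)) (out := fun s => s.2.2)
    (by fun_prop) (by fun_prop)
    (fun a s => s.1 = a ∧ ∃ l₁, L a = l₁ ++ s.2.1 ∧ s.2.2 = l₁.foldl (F a) (I a))
    (fun s => s.2.1.length) (N := fun a => esize (L a))
    (B := fun a => esize a + esize (L a) + B a + 2)
    (((PolyBounded.esize_self.add hL.bounded).add hB).add (.const 2)) hL.bounded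
    (fun a => ⟨rfl, [], by simp⟩) (fun a => (length_lt_esize _).le) ?_ ?_ ?_
  · rintro a ⟨a', l, b⟩ ⟨rfl, l₁, h1, h2⟩ hc
    dsimp only at h1 h2 hc ⊢
    cases l with
    | nil => simp at hc
    | cons g l => exact ⟨⟨rfl, l₁ ++ [g], by simp [h1], by simp [h2]⟩, by simp⟩
  · rintro a ⟨a', l, b⟩ ⟨rfl, l₁, h1, h2⟩
    dsimp only at h1 h2 ⊢
    rw [esize_pair, esize_pair, h1, h2]
    have := hsize a' l₁ l h1
    have := esize_append l₁ l
    have := one_le_esize l₁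
    omega
  · rintro a ⟨a', l, b⟩ ⟨rfl, l₁, h1, h2⟩ hc
    dsimp only at h1 h2 hc ⊢
    cases l with
    | nil => rw [h2, h1, List.append_nil]
    | cons g l => simp at hc

/-- Folds whose intermediate results grow by a bounded amount in each step. -/
theorem foldl_of_le {L : α → List γ} {I : α → β} {F : α → β → γ → β} (hL : PolyTime L)
    (hI : PolyTime I) (hF : PolyTime (fun x : α × β × γ => F x.1 x.2.1 x.2.2)) {K : α → ℕ}
    (hK : PolyBounded K) (hsize : ∀ a b, ∀ g ∈ L a, esize (F a b g) ≤ esize b + K a) :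
    PolyTime (fun a => (L a).foldl (F a) (I a)) := by
  refine foldl hL hI hF (B := fun a => esize (I a) + esize (L a) * K a)
    (hI.bounded.add (hL.bounded.mul hK)) fun a l₁ l₂ h => ?_
  have key : ∀ (l : List γ), (∀ g ∈ l, g ∈ L a) → ∀ b,
      esize (l.foldl (F a) b) ≤ esize b + l.length * K a := by
    intro l
    induction l with
    | nil => simp
    | cons g l ih =>
      intro hl b
      have h1 := ih (fun g' hg' => hl g' (List.mem_cons_of_mem _ hg')) (F a b g)
      have h2 := hsize a b g (hl g List.mem_cons_self)
      rw [List.foldl_cons, List.length_cons, add_mul]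
      omega
  refine (key l₁ (fun g hg => by simp [h, hg]) (I a)).trans ?_
  have h1 : l₁.length ≤ esize (L a) := by
    have := length_lt_esize (L a)
    rw [h, List.length_append, ← h] at this
    omega
  exact Nat.add_le_add_left (Nat.mul_le_mul_right _ h1) _

theorem reverseAppend {f g : α → List γ} (hf : PolyTime f) (hg : PolyTime g) :
    PolyTime (fun a => (f a).reverse ++ g a) := by
  have : PolyTime (fun a => (f a).foldl (fun b x => x :: b) (g a)) :=
    foldl_of_le hf hg (F := fun _ b x => x :: b) (by fun_prop)
      (K := fun a => esize (f a) + 1) (hf.bounded.add (.const 1)) fun a b x hx => by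
        have := esize_lt_of_mem hx
        rw [esize_cons]
        omega
  simpa using this

@[fun_prop]
theorem reverse {f : α → List γ} (hf : PolyTime f) : PolyTime (fun a => (f a).reverse) := by
  simpa using hf.reverseAppend (const [])

@[fun_prop]
theorem append {f g : α → List γ} (hf : PolyTime f) (hg : PolyTime g) :
    PolyTime (fun a => f a ++ g a) := by
  simpa using hf.reverse.reverseAppend hg

/-- Right folds whose intermediate results grow by a bounded amount in each step. -/
theorem foldr_of_le {L : α → List γ} {I : α → β} {F : α → γ → β → β} (hL : PolyTime L)
    (hI : PolyTime I) (hF : PolyTime (fun x : α × γ × β => F x.1 x.2.1 x.2.2)) {K : α → ℕ}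
    (hK : PolyBounded K) (hsize : ∀ a b, ∀ g ∈ L a, esize (F a g b) ≤ esize b + K a) :
    PolyTime (fun a => (L a).foldr (F a) (I a)) := by
  have := foldl_of_le hL.reverse hI (F := fun a b g => F a g b)
    (hF.comp (g := fun x : α × β × γ => (x.1, x.2.2, x.2.1)) (by fun_prop)) hK
    fun a b g hg => hsize a b g (by simpa using hg)
  simpa using this

theorem map {L : α → List γ} {f : α → γ → δ} (hL : PolyTime L)
    (hf : PolyTime (fun x : α × γ => f x.1 x.2)) : PolyTime (fun a => (L a).map (f a)) := by
  obtain ⟨K, hK, h⟩ := hf.bounded.exists_forall_mem hL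
  have := foldr_of_le hL (const []) (F := fun a g l => f a g :: l)
    (by
      have := hf.comp (g := fun x : α × γ × List δ => (x.1, x.2.1)) (by fun_prop)
      dsimp only at this
      fun_prop) (hK.add (.const 1)) fun a b g hg => by
        have := h a g hg
        rw [esize_cons]
        dsimp only at this
        omega
  simpa only [List.foldr_cons_eq_append, List.append_nil] using this

@[fun_prop]
theorem flatten {L : α → List (List γ)} (hL : PolyTime L) :
    PolyTime (fun a => (L a).flatten) := by
  have := foldr_of_le hL (const []) (F := fun _ l l' => l ++ l') (by fun_prop)
    (K := fun a => esize (L a)) hL.bounded fun a b g hg => by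
      have := esize_lt_of_mem hg
      have := esize_append g b
      omega
  refine this.of_eq fun a => ?_
  induction L a with
  | nil => rfl
  | cons l L ih => rw [List.foldr_cons, ih, List.flatten_cons]

theorem flatMap {L : α → List γ} {f : α → γ → List δ} (hL : PolyTime L)
    (hf : PolyTime (fun x : α × γ => f x.1 x.2)) : PolyTime (fun a => (L a).flatMap (f a)) := by
  simpa only [List.flatMap_def] using (hL.map hf).flatten

theorem filter {L : α → List γ} {p : α → γ → Bool} (hL : PolyTime L)
    (hp : PolyTime (fun x : α × γ => p x.1 x.2)) : PolyTime (fun a => (L a).filter (p a)) := by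
  have := hL.flatMap (f := fun a g => if p a g then [g] else []) (by fun_prop)
  refine this.of_eq fun a => ?_
  induction L a with
  | nil => rfl
  | cons l L ih => rw [List.flatMap_cons, ih, List.filter_cons]; split <;> simp

@[fun_prop]
theorem or {f g : α → Bool} (hf : PolyTime f) (hg : PolyTime g) :
    PolyTime (fun a => f a || g a) := by
  have := hf.ite (const true) hg
  refine this.of_eq fun a => ?_
  cases f a <;> simp

theorem any {L : α → List γ} {p : α → γ → Bool} (hL : PolyTime L)
    (hp : PolyTime (fun x : α × γ => p x.1 x.2)) : PolyTime (fun a => (L a).any (p a)) := by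
  have := foldr_of_le hL (const false) (F := fun a g b => p a g || b)
    (by
      have := hp.comp (g := fun x : α × γ × Bool => (x.1, x.2.1)) (by fun_prop)
      dsimp only at this
      fun_prop) (K := fun _ => 3) (.const 3) fun a b g _ =>
        (esize_bool _).trans (Nat.le_add_left _ _)
  refine this.of_eq fun a => ?_
  induction L a with
  | nil => rfl
  | cons l L ih => rw [List.foldr_cons, ih, List.any_cons]

end PolyTime

/-! ### Equality in polynomial time -/

/-- Types whose encoding is injective. -/
class EncInj (α : Type) [Enc α] : Prop where
  inj : ∀ a b : α, enc a = enc b → a = b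

instance : EncInj Dat := ⟨fun _ _ h => h⟩

instance : EncInj Bool := ⟨fun a b h => by cases a <;> cases b <;> first | rfl | cases h⟩

instance [EncInj α] [EncInj β] : EncInj (α × β) := ⟨fun a b h => by
  obtain ⟨h1, h2⟩ := Dat.cons.inj h
  exact Prod.ext (EncInj.inj _ _ h1) (EncInj.inj _ _ h2)⟩

instance [EncInj α] : EncInj (List α) := ⟨fun l => by
  induction l with
  | nil => intro l' h; cases l' with
    | nil => rfl
    | cons a l' => cases h
  | cons a l ih => intro l' h; cases l' with
    | nil => cases h
    | cons b l' =>
      obtain ⟨h1, h2⟩ := Dat.cons.inj h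
      rw [EncInj.inj _ _ h1, ih _ h2]⟩

theorem bits_injective : Function.Injective Nat.bits := fun a b h => by
  rw [← Nat.ofDigits_digits 2 a, ← Nat.ofDigits_digits 2 b, Nat.digits_two_eq_bits,
    Nat.digits_two_eq_bits, h]

instance : EncInj ℕ := ⟨fun a b h => bits_injective (EncInj.inj a.bits b.bits h)⟩

instance : EncInj ℤ := ⟨fun a b h => by
  obtain ⟨h1, h2⟩ := Dat.cons.inj h
  have h1 := EncInj.inj (decide (a < 0)) (decide (b < 0)) h1
  have h2 := EncInj.inj a.natAbs b.natAbs h2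
  rw [decide_eq_decide] at h1
  omega⟩

end

section

variable {α β γ δ σ : Type} [Enc α] [Enc β] [Enc γ] [Enc δ] [Enc σ]

/-- Equality of trees is decided classically; `PolyTime.eq` shows that a program can decide it. -/
noncomputable instance : DecidableEq Dat := Classical.decEq _

/-- A tree as the list that it encodes. -/
def Dat.toList : Dat → List Dat
  | .nil => []
  | .cons a b => a :: b.toList

theorem Dat.enc_toList (x : Dat) : enc x.toList = x := by
  induction x with
  | nil => rfl
  | cons a b _ ih => rw [Dat.toList, enc_cons, ih]; rfl

namespace PolyTime

@[fun_prop]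
theorem toList {f : α → Dat} (hf : PolyTime f) : PolyTime (fun a => (f a).toList) :=
  hf.of_enc_eq fun a => (f a).enc_toList

@[fun_prop]
theorem datCons {f g : α → Dat} (hf : PolyTime f) (hg : PolyTime g) :
    PolyTime (fun a => Dat.cons (f a) (g a)) := (hf.pair hg).of_enc_eq fun _ => rfl

@[fun_prop]
theorem encode {f : α → β} (hf : PolyTime f) : PolyTime (fun a => enc (f a)) :=
  hf.of_enc_eq fun _ => rfl

/-- Case distinction on a tree. -/
theorem datCases {D : α → Dat} {f : α → β} {h : α → Dat → Dat → β} (hD : PolyTime D)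
    (hf : PolyTime f) (hh : PolyTime (fun x : α × Dat × Dat => h x.1 x.2.1 x.2.2)) :
    PolyTime (fun a => match D a with
      | .nil => f a
      | .cons x y => h a x y) := by
  have := listCases hD.toList hf (h := fun a x l => h a x (enc l))
    (hh.comp (g := fun x : α × Dat × List Dat => (x.1, x.2.1, enc x.2.2)) (by fun_prop))
  refine this.of_eq fun a => ?_
  cases D a with
  | nil => rfl
  | cons x y => simp only [Dat.toList, Dat.enc_toList]

end PolyTime

/-- One step of the comparison of trees; the first component is a list of pairs that remain to be
compared. -/
def eqStep (s : List (Dat × Dat) × Bool) : List (Dat × Dat) × Bool :=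
  match s.1 with
  | [] => s
  | g :: l => match g.1 with
    | .nil => match g.2 with
      | .nil => (l, s.2)
      | .cons _ _ => (l, false)
    | .cons x y => match g.2 with
      | .nil => (l, false)
      | .cons x' y' => ((x, x') :: (y, y') :: l, s.2)

theorem polyTime_eqStep : PolyTime eqStep := by
  refine (PolyTime.listCases (L := fun s : List (Dat × Dat) × Bool => s.1) (f := fun s => s)
    (h := fun s g l => match g.1 with
    | .nil => match g.2 with
      | .nil => (l, s.2)
      | .cons _ _ => (l, false)
    | .cons x y => match g.2 with
      | .nil => (l, false)
      | .cons x' y' => ((x, x') :: (y, y') :: l, s.2)) (by fun_prop) (by fun_prop) ?_).of_eq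
    fun s => by rcases s with ⟨_ | ⟨⟨_ | _, _ | _⟩, _⟩, _⟩ <;> rfl
  refine (PolyTime.datCases
    (D := fun s : (List (Dat × Dat) × Bool) × (Dat × Dat) × List (Dat × Dat) => s.2.1.1)
    (f := fun s => match s.2.1.2 with
      | .nil => (s.2.2, s.1.2)
      | .cons _ _ => (s.2.2, false))
    (h := fun s x y => match s.2.1.2 with
      | .nil => (s.2.2, false)
      | .cons x' y' => ((x, x') :: (y, y') :: s.2.2, s.1.2)) (by fun_prop) ?_ ?_).of_eq
    fun s => by rcases s with ⟨_, ⟨_ | _, _ | _⟩, _⟩ <;> rfl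
  · exact (PolyTime.datCases
      (D := fun s : (List (Dat × Dat) × Bool) × (Dat × Dat) × List (Dat × Dat) => s.2.1.2)
      (f := fun s => (s.2.2, s.1.2)) (h := fun s _ _ => (s.2.2, false))
      (by fun_prop) (by fun_prop) (by fun_prop)).of_eq
        fun s => by rcases s with ⟨_, ⟨_, _ | _⟩, _⟩ <;> rfl
  · exact (PolyTime.datCases
      (D := fun s : ((List (Dat × Dat) × Bool) × (Dat × Dat) × List (Dat × Dat)) × Dat × Dat =>
        s.1.2.1.2)
      (f := fun s => (s.1.2.2, false))
      (h := fun s x' y' => ((s.2.1, x') :: (s.2.2, y') :: s.1.2.2, s.1.1.2))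
      (by fun_prop) (by fun_prop) (by fun_prop)).of_eq
        fun s => by rcases s with ⟨⟨_, ⟨_, _ | _⟩, _⟩, _⟩ <;> rfl

@[fun_prop]
theorem PolyTime.isEmpty {f : α → List β} (hf : PolyTime f) :
    PolyTime (fun a => (f a).isEmpty) :=
  (PolyTime.listCases hf (.const true) (h := fun _ _ _ => false) (.const false)).of_eq
    fun a => by cases f a <;> rfl

@[fun_prop]
theorem PolyTime.not {f : α → Bool} (hf : PolyTime f) : PolyTime (fun a => !f a) :=
  (hf.ite (const false) (const true)).of_eq fun a => by cases f a <;> rfl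

/-- Equality of trees is decided by working through the pairs of subtrees that remain to be
compared. -/
theorem polyTime_eqDat : PolyTime (fun x : Dat × Dat => decide (x.1 = x.2)) := by
  refine PolyTime.whileLoop
    (c := fun s : List (Dat × Dat) × Bool => !s.1.isEmpty) (by fun_prop) polyTime_eqStep
    (init := fun x => ([x], true)) (out := fun s => s.2) (by fun_prop) (by fun_prop)
    (fun x s => (x.1 = x.2 ↔ s.2 = true ∧ ∀ g ∈ s.1, g.1 = g.2) ∧ esize s.1 ≤ esize x + 2)
    (fun s => (s.1.map fun g => g.1.size).sum) (B := fun x => esize x + 6)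
    (N := fun x => esize x) (.add .esize_self (.const 6)) .esize_self ?_ ?_ ?_ ?_ ?_
  · rintro x
    refine ⟨by simp, ?_⟩
    dsimp only
    rw [esize_cons, esize_nil]
  · rintro ⟨x, y⟩
    rw [esize_pair]
    simp [esize, enc]
    omega
  · rintro x ⟨l, b⟩ ⟨h1, h2⟩ hc
    rcases l with - | ⟨⟨g, g'⟩, l⟩
    · simp at hc
    dsimp only at h1 h2
    rw [esize_cons, esize_pair] at h2
    cases g with
    | nil =>
      cases g' with
      | nil =>
        refine ⟨⟨by simpa [eqStep] using h1, ?_⟩, by simp [eqStep, Dat.size]⟩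
        dsimp only [eqStep]
        omega
      | cons a b =>
        refine ⟨⟨by simpa [eqStep] using h1, ?_⟩, by simp [eqStep, Dat.size]⟩
        dsimp only [eqStep]
        omega
    | cons a b =>
      cases g' with
      | nil =>
        refine ⟨⟨by simpa [eqStep] using h1, ?_⟩, by simp [eqStep, Dat.size]⟩
        dsimp only [eqStep]
        omega
      | cons a' b' =>
        refine ⟨⟨?_, ?_⟩, ?_⟩
        · rw [h1]
          simp [eqStep, and_assoc]
        · dsimp only [eqStep]
          rw [esize_cons, esize_cons, esize_pair, esize_pair]
          simp only [esize, enc, Dat.size] at h2 ⊢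
          omega
        · simp [eqStep, Dat.size]
          omega
  · rintro x ⟨l, b⟩ ⟨h1, h2⟩
    rw [esize_pair]
    have := esize_bool b
    dsimp only at h2
    omega
  · rintro x ⟨l, b⟩ ⟨h1, h2⟩ hc
    cases l with
    | cons g l => simp at hc
    | nil =>
      dsimp only at h1 ⊢
      rw [Bool.eq_iff_iff, decide_eq_true_iff, h1]
      simp

@[fun_prop]
theorem PolyTime.eq [EncInj β] [DecidableEq β] {f g : α → β} (hf : PolyTime f)
    (hg : PolyTime g) : PolyTime (fun a => decide (f a = g a)) := by
  refine (polyTime_eqDat.comp (hf.encode.pair hg.encode)).of_eq fun a => ?_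
  rw [decide_eq_decide]
  exact ⟨EncInj.inj _ _, fun h => by rw [h]⟩

/-- The distinct elements of a list. -/
def distinct [DecidableEq γ] (l : List γ) : List γ :=
  l.foldl (fun acc g => if acc.any fun x => decide (x = g) then acc else g :: acc) []

omit [Enc γ] in
theorem mem_distinct [DecidableEq γ] (l : List γ) (x : γ) : x ∈ distinct l ↔ x ∈ l := by
  suffices h : ∀ acc : List γ, x ∈ l.foldl (fun acc g =>
      if acc.any fun x => decide (x = g) then acc else g :: acc) acc ↔ x ∈ l ∨ x ∈ acc by
    exact (h []).trans (by simp)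
  induction l with
  | nil => simp
  | cons g l ih =>
    intro acc
    rw [List.foldl_cons, ih, List.mem_cons]
    split
    · rename_i h
      simp only [List.any_eq_true, decide_eq_true_eq, exists_eq_right] at h
      grind
    · grind

omit [Enc γ] in
theorem nodup_distinct [DecidableEq γ] (l : List γ) : (distinct l).Nodup := by
  suffices h : ∀ acc : List γ, acc.Nodup → (l.foldl (fun acc g =>
      if acc.any fun x => decide (x = g) then acc else g :: acc) acc).Nodup from h [] .nil
  induction l with
  | nil => exact fun _ h => h
  | cons g l ih =>
    intro acc h
    rw [List.foldl_cons]
    apply ih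
    split
    · exact h
    · rename_i h'
      exact List.nodup_cons.2 ⟨by simpa using h', h⟩

namespace PolyTime

@[fun_prop]
theorem distinct [EncInj γ] [DecidableEq γ] {L : α → List γ} (hL : PolyTime L) :
    PolyTime (fun a => distinct (L a)) := by
  refine foldl_of_le hL (const []) (F := fun _ acc g =>
    if acc.any fun x => decide (x = g) then acc else g :: acc) ?_
    (K := fun a => esize (L a)) hL.bounded fun a b g hg => ?_
  · have : PolyTime (fun x : α × List γ × γ => x.2.1.any fun y => decide (y = x.2.2)) :=
      any (by fun_prop) (by fun_prop)
    fun_prop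
  · have := esize_lt_of_mem hg
    split
    · omega
    · rw [esize_cons]
      omega

end PolyTime

/-! ### Binary counters -/

theorem esize_nat_le (n : ℕ) : esize n ≤ 4 * n.size + 1 := by
  rw [← Nat.size_eq_bits_len, mul_comm]
  exact esize_le_of_forall (l := n.bits) fun b _ => esize_bool b

theorem size_le_esize (n : ℕ) : n.size ≤ esize n := by
  rw [← Nat.size_eq_bits_len]
  exact (length_lt_esize n.bits).le

/-- The binary successor, least significant bit first. -/
def incBits : List Bool → List Bool
  | [] => [true]
  | false :: l => true :: l
  | true :: l => false :: incBits l

theorem incBits_bits (n : ℕ) : incBits n.bits = (n + 1).bits := by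
  induction n using Nat.evenOddStrongRec with
  | h_even n ih =>
    rcases Nat.eq_zero_or_pos n with rfl | h
    · simp [incBits]
    · rw [Nat.bit0_bits n h.ne', Nat.bit1_bits]
      rfl
  | h_odd n ih =>
    rw [Nat.bit1_bits, incBits, ih n (by omega), show 2 * n + 1 + 1 = 2 * (n + 1) by ring,
      Nat.bit0_bits _ (by omega)]

@[fun_prop]
theorem PolyTime.bits {f : α → ℕ} (hf : PolyTime f) : PolyTime (fun a => (f a).bits) :=
  hf.of_enc_eq fun _ => rfl

/-- The binary successor as a fold with a carry. -/
theorem incBits_eq_foldl (l : List Bool) : ∀ acc : List Bool,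
    (l.foldl (fun (s : Bool × List Bool) b =>
      if s.1 then (if b then (true, false :: s.2) else (false, true :: s.2))
      else (false, b :: s.2)) (false, acc) = (false, l.reverse ++ acc)) ∧
    (let s := l.foldl (fun (s : Bool × List Bool) b =>
      if s.1 then (if b then (true, false :: s.2) else (false, true :: s.2))
      else (false, b :: s.2)) (true, acc)
    (if s.1 then true :: s.2 else s.2) = (incBits l).reverse ++ acc) := by
  induction l with
  | nil => intro acc; simp [incBits]
  | cons b l ih =>
    intro acc
    constructor
    · simp [ih]
    · cases b
      · simp [ih, incBits]
      · simpa [incBits] using (ih (false :: acc)).2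

@[fun_prop]
theorem PolyTime.succ {f : α → ℕ} (hf : PolyTime f) : PolyTime (fun a => f a + 1) := by
  have h1 := foldl_of_le hf.bits (const (true, [])) (F := fun _ (s : Bool × List Bool) b =>
      if s.1 then (if b then (true, false :: s.2) else (false, true :: s.2))
      else (false, b :: s.2)) (by fun_prop) (K := fun _ => 10) (.const 10) (by
    rintro a ⟨c, l⟩ b -
    have := esize_bool c
    have := esize_bool b
    have := one_le_esize c
    have h1 : esize true = 3 := rfl
    have h2 : esize false = 1 := rfl
    dsimp only
    split <;> try split
    all_goals rw [esize_pair, esize_cons, esize_pair]; omega)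
  have h2 : PolyTime (fun s : Bool × List Bool => if s.1 then true :: s.2 else s.2) := by
    fun_prop
  refine (h2.comp h1).reverse.of_enc_eq fun a => ?_
  have := (incBits_eq_foldl (f a).bits []).2
  dsimp only at this ⊢
  rw [this, List.append_nil, List.reverse_reverse, incBits_bits]
  rfl

theorem size_add_le (m n : ℕ) : (m + n).size ≤ m.size + n := by
  induction n with
  | zero => simp
  | succ n ih =>
    have h : (m + n + 1).size ≤ (m + n).size + 1 := by
      rw [Nat.size_le, pow_succ]
      have := Nat.lt_size_self (m + n)
      have := Nat.one_le_two_pow (n := (m + n).size)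
      omega
    rw [← add_assoc]
    omega

omit [Enc γ] in
theorem foldl_zipIdx (l : List γ) (n : ℕ) (acc : List (γ × ℕ)) :
    l.foldl (fun (s : List (γ × ℕ) × ℕ) g => ((g, s.2) :: s.1, s.2 + 1)) (acc, n) =
      ((l.zipIdx n).reverse ++ acc, n + l.length) := by
  induction l generalizing n acc with
  | nil => simp
  | cons g l ih => rw [List.foldl_cons, ih]; simp; omega

@[fun_prop]
theorem PolyTime.zipIdx {L : α → List γ} {f : α → ℕ} (hL : PolyTime L) (hf : PolyTime f) :
    PolyTime (fun a => (L a).zipIdx (f a)) := by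
  have key : ∀ (a : α) (l₁ l₂ : List γ), L a = l₁ ++ l₂ →
      l₁.length ≤ esize (L a) ∧ ∀ i ≤ l₁.length,
        esize (f a + i) ≤ 4 * (esize (f a) + esize (L a)) + 1 := by
    intro a l₁ l₂ h
    have h1 := length_lt_esize (L a)
    rw [h, List.length_append, ← h] at h1
    refine ⟨by omega, fun i hi => ?_⟩
    have := esize_nat_le (f a + i)
    have := size_add_le (f a) i
    have := size_le_esize (f a)
    omega
  have h1 := foldl hL (I := fun a => (([] : List (γ × ℕ)), f a)) (by fun_prop)
    (F := fun _ (s : List (γ × ℕ) × ℕ) g => ((g, s.2) :: s.1, s.2 + 1)) (by fun_prop)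
    (B := fun a => esize (L a) * (esize (L a) + (4 * (esize (f a) + esize (L a)) + 1) + 1 + 1) + 1
      + (4 * (esize (f a) + esize (L a)) + 1) + 1) (by
      have h1 := hL.bounded
      have h2 := hf.bounded
      have h3 := ((PolyBounded.const 4).mul (h2.add h1)).add (.const 1)
      exact (((h1.mul (((h1.add h3).add (.const 1)).add (.const 1))).add (.const 1)).add h3).add
        (.const 1)) (by
      intro a l₁ l₂ h
      obtain ⟨h1, h2⟩ := key a l₁ l₂ h
      rw [foldl_zipIdx, List.append_nil, esize_pair, esize_reverse]
      have h3 := h2 _ le_rfl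
      have h4 : esize (l₁.zipIdx (f a)) ≤ (l₁.zipIdx (f a)).length *
          (esize (L a) + (4 * (esize (f a) + esize (L a)) + 1) + 1 + 1) + 1 := by
        refine esize_le_of_forall ?_
        rintro ⟨g, i⟩ hg
        obtain ⟨hi, hi', hg'⟩ := List.mem_zipIdx hg
        obtain ⟨j, rfl⟩ := Nat.exists_eq_add_of_le hi
        have h5 := h2 j (by omega)
        have h6 : esize g < esize (L a) := esize_lt_of_mem (by
          rw [h, hg']
          exact List.mem_append_left _ (List.getElem_mem _))
        rw [esize_pair]
        omega
      rw [List.length_zipIdx] at h4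
      have h5 := Nat.mul_le_mul_right
        (esize (L a) + (4 * (esize (f a) + esize (L a)) + 1) + 1 + 1) h1
      omega)
  refine (PolyTime.fst.comp h1).reverse.of_eq fun a => ?_
  rw [foldl_zipIdx]
  simp

omit [Enc γ] in
theorem foldl_length (l : List γ) (n : ℕ) :
    l.foldl (fun (s : ℕ) _ => s + 1) n = n + l.length := by
  induction l generalizing n with
  | nil => simp
  | cons g l ih => rw [List.foldl_cons, ih]; simp; omega

@[fun_prop]
theorem PolyTime.add_length {L : α → List γ} {f : α → ℕ} (hf : PolyTime f) (hL : PolyTime L) :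
    PolyTime (fun a => f a + (L a).length) := by
  have h1 := foldl hL hf (F := fun _ s _ => s + 1) (by fun_prop)
    (B := fun a => 4 * (esize (f a) + esize (L a)) + 1)
    (((PolyBounded.const 4).mul (hf.bounded.add hL.bounded)).add (.const 1)) (by
      intro a l₁ l₂ h
      have h1 := length_lt_esize (L a)
      rw [h, List.length_append, ← h] at h1
      rw [foldl_length]
      have := esize_nat_le (f a + l₁.length)
      have := size_add_le (f a) l₁.length
      have := size_le_esize (f a)
      omega)
  exact h1.of_eq fun a => foldl_length _ _

end

section

variable {α β γ δ σ : Type} [Enc α] [Enc β] [Enc γ] [Enc δ] [Enc σ]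

/-! ### Recursion on trees in polynomial time -/

/-- Recursion on trees. -/
def Dat.fold (N : β) (G : Dat → Dat → β → β → β) : Dat → β
  | .nil => N
  | .cons x y => G x y (x.fold N G) (y.fold N G)

/-- Tasks in the evaluation of `Dat.fold`: a task `(false, t, nil)` asks for the value at the tree
`t`, a task `(true, x, y)` for the value at `cons x y`, where the values at `y` and `x` are on top
of the stack of values. -/
abbrev FoldTask : Type := Bool × Dat × Dat

/-- The parameter, the stack of tasks and the stack of values. -/
abbrev FoldState (α β : Type) : Type := α × List FoldTask × List β

/-- One step of the evaluation of `Dat.fold`. -/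
def foldStep (N : α → β) (G : α → Dat → Dat → β → β → β)
    (s : FoldState α β) : FoldState α β :=
  match s.2.1 with
  | [] => s
  | g :: ts =>
    if g.1 then
      match s.2.2 with
      | [] => s
      | v :: vs =>
        match vs with
        | [] => s
        | u :: us => (s.1, ts, G s.1 g.2.1 g.2.2 u v :: us)
    else
      match g.2.1 with
      | .nil => (s.1, ts, N s.1 :: s.2.2)
      | .cons x y => (s.1, (false, x, .nil) :: (false, y, .nil) :: (true, x, y) :: ts, s.2.2)

theorem polyTime_foldStep {N : α → β} {G : α → Dat → Dat → β → β → β} (hN : PolyTime N)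
    (hG : PolyTime fun x : α × Dat × Dat × β × β => G x.1 x.2.1 x.2.2.1 x.2.2.2.1 x.2.2.2.2) :
    PolyTime (foldStep N G) := by
  have h1 : PolyTime (fun x :
      ((FoldState α β × FoldTask × List FoldTask) × β × List β) × β × List β =>
      (x.1.1.1.1, x.1.1.2.2,
        G x.1.1.1.1 x.1.1.2.1.2.1 x.1.1.2.1.2.2 x.2.1 x.1.2.1 :: x.2.2)) := by
    have := hG.comp (g := fun x :
        ((FoldState α β × FoldTask × List FoldTask) × β × List β) × β × List β =>
      (x.1.1.1.1, x.1.1.2.1.2.1, x.1.1.2.1.2.2, x.2.1, x.1.2.1)) (by fun_prop)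
    dsimp only at this
    fun_prop
  have h2 := PolyTime.listCases
    (L := fun x : (FoldState α β × FoldTask × List FoldTask) × β × List β => x.2.2)
    (f := fun x => x.1.1) (h := fun x u us =>
      (x.1.1.1, x.1.2.2, G x.1.1.1 x.1.2.1.2.1 x.1.2.1.2.2 u x.2.1 :: us))
    (by fun_prop) (by fun_prop) h1
  have h3 := PolyTime.listCases (L := fun x : FoldState α β × FoldTask × List FoldTask => x.1.2.2)
    (f := fun x => x.1) (h := fun x v vs => match vs with
        | [] => x.1
        | u :: us => (x.1.1, x.2.2, G x.1.1 x.2.1.2.1 x.2.1.2.2 u v :: us))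
    (by fun_prop) (by fun_prop)
    (h2.of_eq fun x => by rcases x with ⟨_, _, _ | _⟩ <;> rfl)
  have h4 := PolyTime.datCases (D := fun x : FoldState α β × FoldTask × List FoldTask => x.2.1.2.1)
    (f := fun x => (x.1.1, x.2.2, N x.1.1 :: x.1.2.2))
    (h := fun s x y => (s.1.1, (false, x, Dat.nil) :: (false, y, Dat.nil) :: (true, x, y) :: s.2.2,
      s.1.2.2)) (by fun_prop) (by fun_prop) (by fun_prop)
  have h5 := PolyTime.ite (c := fun x : FoldState α β × FoldTask × List FoldTask => x.2.1.1)
    (by fun_prop) h3 h4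
  refine (PolyTime.listCases (L := fun s : FoldState α β => s.2.1)
    (f := fun s => s)
    (h := fun s g ts => if g.1 then
      match s.2.2 with
      | [] => s
      | v :: vs =>
        match vs with
        | [] => s
        | u :: us => (s.1, ts, G s.1 g.2.1 g.2.2 u v :: us)
    else
      match g.2.1 with
      | .nil => (s.1, ts, N s.1 :: s.2.2)
      | .cons x y => (s.1, (false, x, .nil) :: (false, y, .nil) :: (true, x, y) :: ts, s.2.2))
    (by fun_prop) (by fun_prop) (h5.of_eq fun s => ?_)).of_eq fun s => ?_
  · rcases s with ⟨⟨_, _, _ | ⟨_, _ | _⟩⟩, ⟨_ | _, _ | _, _⟩, _⟩ <;> rfl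
  · rcases s with ⟨a, _ | ⟨⟨_ | _, _ | _, _⟩, _⟩, _ | ⟨_, _ | _⟩⟩ <;> rfl

/-- The stacks `ts` and `vs` of tasks and values lead to the value of the fold at `D`. -/
def FoldInv (F : Dat → β) (D : Dat) : List FoldTask → List β → Prop
  | [], vs => vs = [F D]
  | (false, t, t') :: ts, vs => t' = .nil ∧ t.size ≤ D.size ∧ FoldInv F D ts (F t :: vs)
  | (true, x, y) :: ts, vs => ∃ us, vs = F y :: F x :: us ∧ x.size + y.size + 1 ≤ D.size ∧
      FoldInv F D ts (F (.cons x y) :: us)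

omit [Enc β] in
theorem FoldInv.size_le {F : Dat → β} {D : Dat} {ts : List FoldTask} :
    ∀ {vs : List β}, FoldInv F D ts vs → ∀ g ∈ ts, esize g ≤ D.size + 10 := by
  induction ts with
  | nil => simp
  | cons g ts ih =>
    intro vs h g' hg'
    obtain ⟨b, x, y⟩ := g
    cases b with
    | false =>
      obtain ⟨rfl, h1, h2⟩ := h
      rcases List.mem_cons.1 hg' with rfl | hg'
      · have := esize_bool false
        have h3 : esize x = x.size := rfl
        have h4 : esize Dat.nil = 1 := rfl
        rw [esize_pair, esize_pair]
        omega
      · exact ih h2 g' hg'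
    | true =>
      obtain ⟨us, rfl, h1, h2⟩ := h
      rcases List.mem_cons.1 hg' with rfl | hg'
      · have := esize_bool true
        have h3 : esize x = x.size := rfl
        have h4 : esize y = y.size := rfl
        rw [esize_pair, esize_pair]
        omega
      · exact ih h2 g' hg'

/-- The number of steps that a stack of tasks takes at most. -/
def taskMeasure : List FoldTask → ℕ
  | [] => 0
  | (true, _) :: ts => 1 + taskMeasure ts
  | (false, t, _) :: ts => 2 * t.size + taskMeasure ts

theorem length_le_taskMeasure (ts : List FoldTask) : ts.length ≤ taskMeasure ts := by
  induction ts with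
  | nil => simp
  | cons g ts ih =>
    obtain ⟨b, t, t'⟩ := g
    have := t.one_le_size
    cases b <;> simp only [taskMeasure, List.length_cons] <;> omega

/-- Recursion on trees takes polynomial time if all intermediate results have polynomial size. -/
theorem PolyTime.datFold {D : α → Dat} {N : α → β} {G : α → Dat → Dat → β → β → β}
    (hD : PolyTime D) (hN : PolyTime N)
    (hG : PolyTime fun x : α × Dat × Dat × β × β => G x.1 x.2.1 x.2.2.1 x.2.2.2.1 x.2.2.2.2)
    {B : α → ℕ} (hB : PolyBounded B)
    (hsize : ∀ a (t : Dat), t.size ≤ (D a).size → esize (t.fold (N a) (G a)) ≤ B a) :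
    PolyTime (fun a => (D a).fold (N a) (G a)) := by
  have hout : PolyTime (fun s : FoldState α β => match s.2.2 with
      | [] => N s.1
      | v :: _ => v) :=
    (listCases (L := fun s : FoldState α β => s.2.2)
      (f := fun s => N s.1) (h := fun _ v _ => v) (by fun_prop) (by fun_prop)
      (by fun_prop)).of_eq fun s => by rcases s with ⟨_, _, _ | _⟩ <;> rfl
  have hD' := hD.bounded
  refine whileLoop (c := fun s : FoldState α β => !s.2.1.isEmpty)
    (by fun_prop) (polyTime_foldStep hN hG) (init := fun a => (a, [(false, D a, .nil)], []))
    (by fun_prop) hout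
    (fun a s => s.1 = a ∧ FoldInv (fun t : Dat => t.fold (N a) (G a)) (D a) s.2.1 s.2.2 ∧
      (∀ v ∈ s.2.2, esize v ≤ B a) ∧ taskMeasure s.2.1 + s.2.2.length ≤ 2 * esize (D a))
    (fun s => taskMeasure s.2.1) (N := fun a => 2 * esize (D a))
    (B := fun a => esize a + ((2 * esize (D a) * (esize (D a) + 10 + 1) + 1) +
      (2 * esize (D a) * (B a + 1) + 1) + 1) + 1)
    ?_ ((PolyBounded.const 2).mul hD') ?_ ?_ ?_ ?_ ?_
  · have h1 := (PolyBounded.const 2).mul hD'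
    have h2 := (h1.mul ((hD'.add (.const 10)).add (.const 1))).add (.const 1)
    have h3 := (h1.mul (hB.add (.const 1))).add (.const 1)
    exact (PolyBounded.esize_self.add ((h2.add h3).add (.const 1))).add (.const 1)
  · exact fun a => ⟨rfl, ⟨rfl, le_rfl, rfl⟩, by simp, by simp [taskMeasure]; rfl⟩
  · exact fun a => le_rfl
  · rintro a ⟨a', ts, vs⟩ ⟨rfl, h1, h2, h3⟩ hc
    dsimp only at h1 h2 h3 hc
    rcases ts with - | ⟨⟨b, x, y⟩, ts⟩
    · simp at hc
    cases b with
    | true =>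
      obtain ⟨us, rfl, h4, h5⟩ := h1
      refine ⟨⟨rfl, h5, ?_, ?_⟩, ?_⟩
      · intro v hv
        rcases List.mem_cons.1 hv with rfl | hv
        · exact hsize a' (.cons x y) h4
        · exact h2 v (by simp [hv])
      · simp only [foldStep, taskMeasure, if_true,
          List.length_cons] at h3 ⊢
        omega
      · simp [foldStep, taskMeasure]
    | false =>
      obtain ⟨rfl, h4, h5⟩ := h1
      cases x with
      | nil =>
        refine ⟨⟨rfl, h5, ?_, ?_⟩, ?_⟩
        · intro v hv
          rcases List.mem_cons.1 hv with rfl | hv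
          · exact hsize a' .nil h4
          · exact h2 v hv
        · simp only [foldStep, taskMeasure, Dat.size, Bool.false_eq_true, if_false,
            List.length_cons] at h3 ⊢
          omega
        · simp [foldStep, taskMeasure, Dat.size]
      | cons x y =>
        have hs : (Dat.cons x y).size = x.size + y.size + 1 := rfl
        refine ⟨⟨rfl, ?_, h2, ?_⟩, ?_⟩
        · refine ⟨rfl, ?_, rfl, ?_, _, rfl, ?_, h5⟩ <;> dsimp only <;> omega
        · simp only [foldStep, taskMeasure, Dat.size, Bool.false_eq_true, if_false] at h3 ⊢
          omega
        · simp only [foldStep, taskMeasure, Dat.size, Bool.false_eq_true, if_false]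
          omega
  · rintro a ⟨a', ts, vs⟩ ⟨rfl, h1, h2, h3⟩
    dsimp only at h1 h2 h3 ⊢
    rw [esize_pair, esize_pair]
    have h4 := esize_le_of_forall h1.size_le
    have h5 := esize_le_of_forall h2
    have h6 := length_le_taskMeasure ts
    have h7 := Nat.mul_le_mul_right (esize (D a') + 10 + 1)
      (show ts.length ≤ 2 * esize (D a') by omega)
    have h8 := Nat.mul_le_mul_right (B a' + 1) (show vs.length ≤ 2 * esize (D a') by omega)
    have h9 : (D a').size = esize (D a') := rfl
    rw [h9] at h4
    omega
  · rintro a ⟨a', ts, vs⟩ ⟨rfl, h1, -, -⟩ hc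
    cases ts with
    | cons => simp at hc
    | nil =>
      dsimp only [FoldInv] at h1
      subst h1
      rfl

end

/-! ### Quantifier-free formulas with unrestricted variables -/

/-- Terms with variables `x_0, x_1, …`. -/
inductive RTerm : Type
  | var (i : ℕ) : RTerm
  | zero : RTerm
  | one : RTerm
  | add (s t : RTerm) : RTerm
  | dbl (t : RTerm) : RTerm

/-- Quantifier-free formulas with variables `x_0, x_1, …`. -/
inductive RForm : Type
  | le (s t : RTerm) : RForm
  | and (φ χ : RForm) : RForm
  | or (φ χ : RForm) : RForm
  | not (φ : RForm) : RForm

namespace RTerm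

/-- The value of a term. -/
def eval (v : ℕ → ℤ) : RTerm → ℤ
  | var i => v i
  | zero => 0
  | one => 1
  | add s t => s.eval v + t.eval v
  | dbl t => 2 * t.eval v

/-- The number of symbols of a term. -/
def size : RTerm → ℕ
  | var _ => 1
  | zero => 1
  | one => 1
  | add s t => s.size + t.size + 1
  | dbl t => t.size + 1

/-- The encoding, which agrees with `Term.encode`. -/
def encode : RTerm → Dat
  | var i => .cons (encNat 0) (encNat i)
  | zero => .cons (encNat 1) .nil
  | one => .cons (encNat 2) .nil
  | add s t => .cons (encNat 3) (.cons s.encode t.encode)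
  | dbl t => .cons (encNat 4) t.encode

/-- All variables of the term have a number less than `m`. -/
def Below (m : ℕ) : RTerm → Prop
  | var i => i < m
  | zero => True
  | one => True
  | add s t => s.Below m ∧ t.Below m
  | dbl t => t.Below m

/-- The term as a well-scoped one; variables that are out of scope become `0`. -/
def toTerm (n : ℕ) : RTerm → Term n
  | var i => if h : i < n then .var ⟨i, h⟩ else .zero
  | zero => .zero
  | one => .one
  | add s t => .add (s.toTerm n) (t.toTerm n)
  | dbl t => .dbl (t.toTerm n)

theorem toTerm_spec {n : ℕ} {t : RTerm} (h : t.Below n) :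
    (∀ w : ℕ → ℤ, (t.toTerm n).eval (fun i => w i) = t.eval w) ∧
      (t.toTerm n).size = t.size ∧ (t.toTerm n).encode = t.encode := by
  induction t with
  | var i => simp [toTerm, show i < n from h, Term.eval, eval, Term.size, size, Term.encode, encode]
  | zero => simp [toTerm, Term.eval, eval, Term.size, size, Term.encode, encode]
  | one => simp [toTerm, Term.eval, eval, Term.size, size, Term.encode, encode]
  | add s t hs ht =>
    obtain ⟨h1, h2, h3⟩ := hs h.1
    obtain ⟨h4, h5, h6⟩ := ht h.2
    simp [toTerm, Term.eval, eval, Term.size, size, Term.encode, encode, *]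
  | dbl t ht =>
    obtain ⟨h4, h5, h6⟩ := ht h
    simp [toTerm, Term.eval, eval, Term.size, size, Term.encode, encode, *]

/-- The sum of a list of terms. -/
def sum (l : List RTerm) : RTerm := l.foldr add zero

theorem eval_sum (v : ℕ → ℤ) (l : List RTerm) : (sum l).eval v = (l.map (eval v)).sum := by
  induction l with
  | nil => rfl
  | cons t l ih => rw [List.map_cons, List.sum_cons, ← ih]; rfl

theorem size_sum_le {l : List RTerm} {K : ℕ} (h : ∀ t ∈ l, t.size ≤ K) :
    (sum l).size ≤ l.length * (K + 1) + 1 := by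
  induction l with
  | nil => simp [sum, size]
  | cons t l ih =>
    have h1 := ih fun s hs => h s (List.mem_cons_of_mem _ hs)
    have h2 := h t List.mem_cons_self
    have h3 : (sum (t :: l)).size = t.size + (sum l).size + 1 := rfl
    rw [List.length_cons, add_mul]
    omega

theorem below_sum {l : List RTerm} {m : ℕ} (h : ∀ t ∈ l, t.Below m) : (sum l).Below m := by
  induction l with
  | nil => trivial
  | cons t l ih => exact ⟨h t List.mem_cons_self, ih fun s hs => h s (List.mem_cons_of_mem _ hs)⟩

/-- The product of a term and a natural number, which is given by its bits, by doubling. -/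
def mulBits (l : List Bool) (t : RTerm) : RTerm :=
  l.foldr (fun b s => add (dbl s) (if b then t else zero)) zero

theorem eval_mulBits (v : ℕ → ℤ) (n : ℕ) (t : RTerm) :
    (mulBits n.bits t).eval v = n * t.eval v := by
  induction n using Nat.evenOddStrongRec with
  | h_even n ih =>
    rcases Nat.eq_zero_or_pos n with rfl | h
    · simp [mulBits, eval]
    · rw [Nat.bit0_bits n h.ne']
      have := ih n (by omega)
      simp only [mulBits] at this
      simp only [mulBits, List.foldr_cons, eval, this, Bool.false_eq_true, if_false]
      push_cast
      ring
  | h_odd n ih =>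
    rw [Nat.bit1_bits n]
    have := ih n (by omega)
    simp only [mulBits] at this
    simp only [mulBits, List.foldr_cons, eval, this, if_true]
    push_cast
    ring

theorem size_mulBits_le (l : List Bool) (t : RTerm) :
    (mulBits l t).size ≤ l.length * (t.size + 3) + 1 := by
  induction l with
  | nil => simp [mulBits, size]
  | cons b l ih =>
    have h : (mulBits (b :: l) t).size =
      (mulBits l t).size + 1 + (if b then t else zero).size + 1 := rfl
    have h' : (if b then t else zero).size ≤ t.size + 1 := by split <;> simp [size]
    rw [List.length_cons, add_mul]
    omega

theorem below_mulBits {l : List Bool} {t : RTerm} {m : ℕ} (h : t.Below m) :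
    (mulBits l t).Below m := by
  induction l with
  | nil => trivial
  | cons b l ih =>
    refine ⟨ih, ?_⟩
    split
    · exact h
    · trivial

end RTerm

namespace RForm

/-- The truth of a formula under an assignment. -/
def Holds (v : ℕ → ℤ) : RForm → Prop
  | le s t => s.eval v ≤ t.eval v
  | and φ χ => φ.Holds v ∧ χ.Holds v
  | or φ χ => φ.Holds v ∨ χ.Holds v
  | not φ => ¬ φ.Holds v

/-- The number of symbols of a formula. -/
def size : RForm → ℕ
  | le s t => s.size + t.size + 1
  | and φ χ => φ.size + χ.size + 1
  | or φ χ => φ.size + χ.size + 1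
  | not φ => φ.size + 1

/-- The encoding, which agrees with `Formula.encode`; the tag `1` is that of quantifiers. -/
def encode : RForm → Dat
  | le s t => .cons (encNat 0) (.cons s.encode t.encode)
  | and φ χ => .cons (encNat 2) (.cons φ.encode χ.encode)
  | or φ χ => .cons (encNat 3) (.cons φ.encode χ.encode)
  | not φ => .cons (encNat 4) φ.encode

/-- All variables of the formula have a number less than `m`. -/
def Below (m : ℕ) : RForm → Prop
  | le s t => s.Below m ∧ t.Below m
  | and φ χ => φ.Below m ∧ χ.Below m
  | or φ χ => φ.Below m ∧ χ.Below m
  | not φ => φ.Below m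

/-- The formula as a well-scoped one; variables that are out of scope become `0`. -/
def toFormula (n : ℕ) : RForm → Formula n
  | le s t => .le (s.toTerm n) (t.toTerm n)
  | and φ χ => .and (φ.toFormula n) (χ.toFormula n)
  | or φ χ => .or (φ.toFormula n) (χ.toFormula n)
  | not φ => .not (φ.toFormula n)

theorem toFormula_quantifierFree (n : ℕ) (φ : RForm) : (φ.toFormula n).QuantifierFree := by
  induction φ with
  | le s t => trivial
  | and φ χ h h' => exact ⟨h, h'⟩
  | or φ χ h h' => exact ⟨h, h'⟩
  | not φ h => exact h

theorem toFormula_spec {n : ℕ} {φ : RForm} (h : φ.Below n) :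
    (∀ w : ℕ → ℤ, (φ.toFormula n).Holds (fun i => w i) ↔ φ.Holds w) ∧
      (φ.toFormula n).size = φ.size ∧ (φ.toFormula n).encode = φ.encode := by
  induction φ with
  | le s t =>
    obtain ⟨h1, h2, h3⟩ := RTerm.toTerm_spec h.1
    obtain ⟨h4, h5, h6⟩ := RTerm.toTerm_spec h.2
    simp [toFormula, Formula.Holds, Holds, Formula.size, size, Formula.encode, encode, *]
  | and φ χ hs ht =>
    obtain ⟨h1, h2, h3⟩ := hs h.1
    obtain ⟨h4, h5, h6⟩ := ht h.2
    simp [toFormula, Formula.Holds, Holds, Formula.size, size, Formula.encode, encode, *]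
  | or φ χ hs ht =>
    obtain ⟨h1, h2, h3⟩ := hs h.1
    obtain ⟨h4, h5, h6⟩ := ht h.2
    simp [toFormula, Formula.Holds, Holds, Formula.size, size, Formula.encode, encode, *]
  | not φ ht =>
    obtain ⟨h4, h5, h6⟩ := ht h
    simp [toFormula, Formula.Holds, Holds, Formula.size, size, Formula.encode, encode, *]

/-- The formula `∃ x_n … ∃ x_{n+r-1} φ` with free variables `x_0, …, x_{n-1}`. -/
def exClosure (φ : RForm) : ℕ → (n : ℕ) → Formula n
  | 0, n => φ.toFormula n
  | r + 1, n => .ex (exClosure φ r (n + 1))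

theorem exClosure_isExistential (φ : RForm) (r n : ℕ) : (φ.exClosure r n).IsExistential := by
  induction r generalizing n with
  | zero => exact .qf (toFormula_quantifierFree n φ)
  | succ r ih => exact .ex (ih (n + 1))

theorem exClosure_size {φ : RForm} {r n : ℕ} (h : φ.Below (n + r)) :
    (φ.exClosure r n).size = φ.size + 2 * r := by
  induction r generalizing n with
  | zero => exact (toFormula_spec h).2.1
  | succ r ih =>
    rw [exClosure, Formula.size, ih (by rwa [add_right_comm, add_assoc])]
    ring

/-- The encoding only adds the tags of the quantifiers, as variables are written by their numbers
independently of the scope. -/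
theorem exClosure_encode {φ : RForm} {r n : ℕ} (h : φ.Below (n + r)) {γ : Type} {l : List γ}
    (hl : l.length = r) :
    (φ.exClosure r n).encode = l.foldr (fun _ D => .cons (encNat 1) D) φ.encode := by
  induction l generalizing r n with
  | nil => subst hl; exact (toFormula_spec h).2.2
  | cons g l ih =>
    subst hl
    rw [List.length_cons, exClosure, Formula.encode, List.foldr_cons, ih _ rfl]
    rwa [add_assoc, add_comm 1]

theorem exClosure_holds {φ : RForm} {r n : ℕ} (h : φ.Below (n + r)) (v : Fin n → ℤ) :
    (φ.exClosure r n).Holds v ↔ ∃ w : ℕ → ℤ, (∀ i : Fin n, w i = v i) ∧ φ.Holds w := by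
  induction r generalizing n with
  | zero =>
    constructor
    · intro h'
      let w : ℕ → ℤ := fun i => if hi : i < n then v ⟨i, hi⟩ else 0
      have hw : (fun i : Fin n => w i) = v := by ext i; simp [w]
      refine ⟨w, fun i => congrFun hw i, ?_⟩
      rw [← (toFormula_spec (n := n) h).1 w, hw]
      exact h'
    · rintro ⟨w, hw, h'⟩
      rw [← (toFormula_spec (n := n) h).1 w, funext hw] at h'
      exact h'
  | succ r ih =>
    rw [exClosure, Formula.Holds]
    have h' : φ.Below (n + 1 + r) := by rwa [add_right_comm, add_assoc]
    constructor
    · rintro ⟨x, hx⟩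
      obtain ⟨w, hw, hφ⟩ := (ih h' _).1 hx
      refine ⟨w, fun i => ?_, hφ⟩
      simpa using hw i.castSucc
    · rintro ⟨w, hw, hφ⟩
      refine ⟨w n, (ih h' _).2 ⟨w, fun i => ?_, hφ⟩⟩
      induction i using Fin.lastCases with
      | last => simp
      | cast i => simp [hw]

/-- The conjunction of a list of formulas. -/
def conj (l : List RForm) : RForm := l.foldr and (le .zero .zero)

/-- The disjunction of a list of formulas. -/
def disj (l : List RForm) : RForm := l.foldr or (le .one .zero)

/-- The formula `s = t`. -/
def eq (s t : RTerm) : RForm := and (le s t) (le t s)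

theorem holds_conj (v : ℕ → ℤ) (l : List RForm) : (conj l).Holds v ↔ ∀ φ ∈ l, φ.Holds v := by
  induction l with
  | nil => simp [conj, Holds]
  | cons φ l ih => rw [List.forall_mem_cons, ← ih]; rfl

theorem holds_disj (v : ℕ → ℤ) (l : List RForm) : (disj l).Holds v ↔ ∃ φ ∈ l, φ.Holds v := by
  induction l with
  | nil => simp [disj, Holds, RTerm.eval]
  | cons φ l ih => rw [List.exists_mem_cons_iff, ← ih]; rfl

theorem holds_eq (v : ℕ → ℤ) (s t : RTerm) : (eq s t).Holds v ↔ s.eval v = t.eval v :=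
  le_antisymm_iff.symm

theorem size_conj_le {l : List RForm} {K : ℕ} (h : ∀ φ ∈ l, φ.size ≤ K) :
    (conj l).size ≤ l.length * (K + 1) + 3 := by
  induction l with
  | nil => simp [conj, size, RTerm.size]
  | cons t l ih =>
    have h1 := ih fun s hs => h s (List.mem_cons_of_mem _ hs)
    have h2 := h t List.mem_cons_self
    have h3 : (conj (t :: l)).size = t.size + (conj l).size + 1 := rfl
    rw [List.length_cons, add_mul]
    omega

theorem size_disj_le {l : List RForm} {K : ℕ} (h : ∀ φ ∈ l, φ.size ≤ K) :
    (disj l).size ≤ l.length * (K + 1) + 3 := by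
  induction l with
  | nil => simp [disj, size, RTerm.size]
  | cons t l ih =>
    have h1 := ih fun s hs => h s (List.mem_cons_of_mem _ hs)
    have h2 := h t List.mem_cons_self
    have h3 : (disj (t :: l)).size = t.size + (disj l).size + 1 := rfl
    rw [List.length_cons, add_mul]
    omega

theorem below_conj {l : List RForm} {m : ℕ} (h : ∀ φ ∈ l, φ.Below m) : (conj l).Below m := by
  induction l with
  | nil => exact ⟨trivial, trivial⟩
  | cons t l ih => exact ⟨h t List.mem_cons_self, ih fun s hs => h s (List.mem_cons_of_mem _ hs)⟩

theorem below_disj {l : List RForm} {m : ℕ} (h : ∀ φ ∈ l, φ.Below m) : (disj l).Below m := by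
  induction l with
  | nil => exact ⟨trivial, trivial⟩
  | cons t l ih => exact ⟨h t List.mem_cons_self, ih fun s hs => h s (List.mem_cons_of_mem _ hs)⟩

theorem below_eq {s t : RTerm} {m : ℕ} (hs : s.Below m) (ht : t.Below m) : (eq s t).Below m :=
  ⟨⟨hs, ht⟩, ⟨ht, hs⟩⟩

end RForm

/-! ### Substitution of differences of terms -/

/-- The term after replacing each variable `x_i` by the difference of the two terms `σ i`, as a
difference of two terms. Signs are kept apart as the signature has no subtraction. -/
def Term.subst (σ : ℕ → RTerm × RTerm) {n : ℕ} : Term n → RTerm × RTerm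
  | .var i => σ i
  | .zero => (.zero, .zero)
  | .one => (.one, .zero)
  | .add s t => (.add (s.subst σ).1 (t.subst σ).1, .add (s.subst σ).2 (t.subst σ).2)
  | .dbl t => (.dbl (t.subst σ).1, .dbl (t.subst σ).2)

/-- The matrix of the formula after replacing each variable `x_i` by the difference of the two
terms `σ i`. Quantifiers are dropped. -/
def Formula.subst (σ : ℕ → RTerm × RTerm) : {n : ℕ} → Formula n → RForm
  | _, .le s t => .le (.add (s.subst σ).1 (t.subst σ).2) (.add (t.subst σ).1 (s.subst σ).2)
  | _, .ex φ => φ.subst σ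
  | _, .and φ χ => .and (φ.subst σ) (χ.subst σ)
  | _, .or φ χ => .or (φ.subst σ) (χ.subst σ)
  | _, .not φ => .not (φ.subst σ)

/-- The number of leading existential quantifiers. -/
def Formula.exDepth : {n : ℕ} → Formula n → ℕ
  | _, .ex φ => φ.exDepth + 1
  | _, _ => 0

/-- The truth of the matrix of a formula, that is, of the formula without its quantifiers. -/
def Formula.MatrixHolds (w : ℕ → ℤ) : {n : ℕ} → Formula n → Prop
  | _, .le s t => s.eval (fun i => w i) ≤ t.eval (fun i => w i)
  | _, .ex φ => φ.MatrixHolds w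
  | _, .and φ χ => φ.MatrixHolds w ∧ χ.MatrixHolds w
  | _, .or φ χ => φ.MatrixHolds w ∨ χ.MatrixHolds w
  | _, .not φ => ¬ φ.MatrixHolds w

theorem Term.eval_subst (σ : ℕ → RTerm × RTerm) (W : ℕ → ℤ) {n : ℕ} (t : Term n) :
    (t.subst σ).1.eval W - (t.subst σ).2.eval W =
      t.eval fun i => (σ i).1.eval W - (σ i).2.eval W := by
  induction t with
  | var i => rfl
  | zero => rfl
  | one => rfl
  | add s t hs ht => simp only [Term.subst, Term.eval, RTerm.eval, ← hs, ← ht]; ring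
  | dbl t ht => simp only [Term.subst, Term.eval, RTerm.eval, ← ht]; ring

theorem Formula.holds_subst (σ : ℕ → RTerm × RTerm) (W : ℕ → ℤ) {n : ℕ} (φ : Formula n) :
    (φ.subst σ).Holds W ↔ φ.MatrixHolds fun i => (σ i).1.eval W - (σ i).2.eval W := by
  induction φ with
  | le s t =>
    simp only [Formula.subst, RForm.Holds, RTerm.eval, Formula.MatrixHolds, ← Term.eval_subst]
    constructor <;> intro h <;> linarith
  | ex φ h => exact h
  | and φ χ h h' => exact and_congr h h'
  | or φ χ h h' => exact or_congr h h'
  | not φ h => exact not_congr h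

theorem Term.below_subst {σ : ℕ → RTerm × RTerm} {m : ℕ}
    (h : ∀ i, (σ i).1.Below m ∧ (σ i).2.Below m) {n : ℕ} (t : Term n) :
    (t.subst σ).1.Below m ∧ (t.subst σ).2.Below m := by
  induction t with
  | var i => exact h i
  | zero => exact ⟨trivial, trivial⟩
  | one => exact ⟨trivial, trivial⟩
  | add s t hs ht => exact ⟨⟨hs.1, ht.1⟩, ⟨hs.2, ht.2⟩⟩
  | dbl t ht => exact ht

theorem Formula.below_subst {σ : ℕ → RTerm × RTerm} {m : ℕ}
    (h : ∀ i, (σ i).1.Below m ∧ (σ i).2.Below m) {n : ℕ} (φ : Formula n) :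
    (φ.subst σ).Below m := by
  induction φ with
  | le s t =>
    have hs := Term.below_subst h s
    have ht := Term.below_subst h t
    exact ⟨⟨hs.1, ht.2⟩, ⟨ht.1, hs.2⟩⟩
  | ex φ h => exact h
  | and φ χ h h' => exact ⟨h, h'⟩
  | or φ χ h h' => exact ⟨h, h'⟩
  | not φ h => exact h

theorem Term.size_subst_le {σ : ℕ → RTerm × RTerm} {K : ℕ} {n : ℕ} (t : Term n)
    (h : ∀ i < n, (σ i).1.size ≤ K ∧ (σ i).2.size ≤ K) :
    (t.subst σ).1.size + 1 ≤ t.size * (K + 2) ∧ (t.subst σ).2.size + 1 ≤ t.size * (K + 2) := by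
  induction t with
  | var i => have := h i i.2; simp only [Term.subst, Term.size]; omega
  | zero => simp [Term.subst, Term.size, RTerm.size]
  | one => simp [Term.subst, Term.size, RTerm.size]
  | add s t hs ht => simp only [Term.subst, Term.size, RTerm.size, add_mul]; omega
  | dbl t ht => simp only [Term.subst, Term.size, RTerm.size, add_mul]; omega

theorem Formula.size_subst_le {σ : ℕ → RTerm × RTerm} {K : ℕ} {n : ℕ} {φ : Formula n}
    (hφ : φ.IsExistential) :
    (∀ i < n + φ.exDepth, (σ i).1.size ≤ K ∧ (σ i).2.size ≤ K) →
    (φ.subst σ).size ≤ φ.size * (2 * (K + 2)) := by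
  have qf : ∀ {n : ℕ} (φ : Formula n), φ.QuantifierFree →
      (∀ i < n, (σ i).1.size ≤ K ∧ (σ i).2.size ≤ K) →
      (φ.subst σ).size ≤ φ.size * (2 * (K + 2)) := by
    intro n φ
    induction φ with
    | le s t =>
      intro _ h
      have h1 := Term.size_subst_le s h
      have h2 := Term.size_subst_le t h
      simp only [Formula.subst, Formula.size, RForm.size, RTerm.size, add_mul]
      rw [mul_left_comm, mul_left_comm _ 2]
      omega
    | ex φ _ => exact fun h => h.elim
    | and φ χ h h' =>
      intro hq hσ
      have := h hq.1 hσ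
      have := h' hq.2 hσ
      simp only [Formula.subst, Formula.size, RForm.size, add_mul]
      omega
    | or φ χ h h' =>
      intro hq hσ
      have := h hq.1 hσ
      have := h' hq.2 hσ
      simp only [Formula.subst, Formula.size, RForm.size, add_mul]
      omega
    | not φ h =>
      intro hq hσ
      have := h hq hσ
      simp only [Formula.subst, Formula.size, RForm.size, add_mul]
      omega
  induction hφ with
  | @qf n φ hφ => exact fun h => qf φ hφ fun i hi => h i (by omega)
  | @ex n φ _ ih =>
    intro h
    have := ih fun i hi => h i (by rw [Formula.exDepth]; omega)
    simp only [Formula.subst, Formula.size, add_mul]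
    omega

theorem Formula.matrixHolds_iff_of_quantifierFree {w : ℕ → ℤ} {n : ℕ} {φ : Formula n}
    (hφ : φ.QuantifierFree) : φ.MatrixHolds w ↔ φ.Holds fun i => w i := by
  induction φ with
  | le s t => rfl
  | ex φ _ => exact hφ.elim
  | and φ χ h h' => exact and_congr (h hφ.1) (h' hφ.2)
  | or φ χ h h' => exact or_congr (h hφ.1) (h' hφ.2)
  | not φ h => exact not_congr (h hφ)

/-- The truth of the matrix depends on the values of the variables in its scope only. -/
theorem Formula.matrixHolds_congr {w w' : ℕ → ℤ} {n : ℕ} {φ : Formula n}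
    (hφ : φ.IsExistential) :
    (∀ i < n + φ.exDepth, w i = w' i) → (φ.MatrixHolds w ↔ φ.MatrixHolds w') := by
  induction hφ with
  | @qf n φ hφ =>
    intro h
    rw [matrixHolds_iff_of_quantifierFree hφ, matrixHolds_iff_of_quantifierFree hφ,
      funext fun i : Fin n => h i (by omega)]
  | @ex n φ _ ih =>
    exact fun h => ih fun i hi => h i (by rw [Formula.exDepth]; omega)

/-- An existential formula holds iff its matrix does for some values of the bound variables. -/
theorem Formula.holds_iff_exists_matrixHolds {n : ℕ} {φ : Formula n} (hφ : φ.IsExistential) :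
    ∀ v : Fin n → ℤ,
      φ.Holds v ↔ ∃ w : ℕ → ℤ, (∀ i : Fin n, w i = v i) ∧ φ.MatrixHolds w := by
  induction hφ with
  | @qf n φ hφ =>
    intro v
    constructor
    · intro h'
      let w : ℕ → ℤ := fun i => if hi : i < n then v ⟨i, hi⟩ else 0
      have hw : (fun i : Fin n => w i) = v := by ext i; simp [w]
      exact ⟨w, fun i => congrFun hw i, by rwa [matrixHolds_iff_of_quantifierFree hφ, hw]⟩
    · rintro ⟨w, hw, h'⟩
      rwa [matrixHolds_iff_of_quantifierFree hφ, funext hw] at h'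
  | @ex n φ _ ih =>
    intro v
    rw [Formula.Holds]
    constructor
    · rintro ⟨x, hx⟩
      obtain ⟨w, hw, hφ⟩ := (ih _).1 hx
      exact ⟨w, fun i => by simpa using hw i.castSucc, hφ⟩
    · rintro ⟨w, hw, hφ⟩
      refine ⟨w n, (ih _).2 ⟨w, fun i => ?_, hφ⟩⟩
      induction i using Fin.lastCases with
      | last => simp
      | cast i => simp [hw]

theorem Formula.exDepth_le_size {n : ℕ} (φ : Formula n) : φ.exDepth ≤ φ.size := by
  induction φ <;> simp only [Formula.exDepth, Formula.size] <;> omega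

/-! ### Trails with prescribed edges -/

section

variable {ε ν : Type} {src tgt : ε → ν}

/-- The edges `l` form a walk from the first vertex to the second one. -/
def IsTrail (src tgt : ε → ν) : ν → List ε → ν → Prop
  | u, [], v => u = v
  | u, e :: l, v => src e = u ∧ IsTrail src tgt (tgt e) l v

theorem isTrail_append {u v : ν} {l l' : List ε} :
    IsTrail src tgt u (l ++ l') v ↔ ∃ w, IsTrail src tgt u l w ∧ IsTrail src tgt w l' v := by
  induction l generalizing u with
  | nil => simp [IsTrail]
  | cons e l ih => simp [IsTrail, ih, and_assoc]

variable [DecidableEq ν]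

/-- What an edge contributes to the balance of a vertex: `1` if it leaves the vertex, `-1` if it
enters the vertex. -/
def flow (src tgt : ε → ν) (v : ν) (e : ε) : ℤ :=
  (if src e = v then 1 else 0) - (if tgt e = v then 1 else 0)

/-- The multiset `X` of edges is balanced at all vertices, apart from a unit that flows from `s` to
`t`. -/
def Balanced (src tgt : ε → ν) (s t : ν) (X : Multiset ε) : Prop :=
  ∀ v, (X.map (flow src tgt v)).sum = (if v = s then 1 else 0) - (if v = t then 1 else 0)

theorem IsTrail.balanced {s t : ν} {l : List ε} (h : IsTrail src tgt s l t) :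
    Balanced src tgt s t (l : Multiset ε) := by
  intro v
  induction l generalizing s with
  | nil => obtain rfl : s = t := h; simp
  | cons e l ih =>
    obtain ⟨rfl, h⟩ := h
    have := ih h
    simp only [Multiset.map_coe, Multiset.sum_coe, List.map_cons, List.sum_cons] at this ⊢
    rw [this, flow]
    simp only [eq_comm (a := v)]
    ring

variable [DecidableEq ε]

theorem Balanced.erase {s t : ν} {X : Multiset ε} (h : Balanced src tgt s t X) {e : ε}
    (he : e ∈ X) (hs : src e = s) : Balanced src tgt (tgt e) t (X.erase e) := by
  intro v
  have h1 := h v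
  rw [← Multiset.cons_erase he, Multiset.map_cons, Multiset.sum_cons, flow, hs] at h1
  simp only [eq_comm (b := v)] at h1
  rw [eq_sub_iff_add_eq.2 ((add_comm _ _).trans h1)]
  ring

omit [DecidableEq ε] in
theorem Balanced.exists_src {s t : ν} {X : Multiset ε} (h : Balanced src tgt s t X)
    (hst : s ≠ t) : ∃ e ∈ X, src e = s := by
  by_contra! hX
  have h1 := h s
  rw [if_pos rfl, if_neg hst] at h1
  have h2 : (X.map (flow src tgt s)).sum ≤ 0 := by
    refine (Multiset.sum_map_le_sum_map (g := fun _ => 0) _ fun e he => ?_).trans (by simp)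
    rw [flow, if_neg (hX e he)]
    split <;> simp
  omega

/-- A balanced multiset of edges contains a trail with the right end points. -/
theorem Balanced.exists_trail {s t : ν} {X : Multiset ε} (h : Balanced src tgt s t X) :
    ∃ l : List ε, (l : Multiset ε) ≤ X ∧ IsTrail src tgt s l t := by
  induction hn : X.card using Nat.strong_induction_on generalizing s X with
  | _ n ih =>
    subst hn
    by_cases hst : s = t
    · exact ⟨[], by simp, hst⟩
    · obtain ⟨e, he, hs⟩ := h.exists_src hst
      obtain ⟨l, hl, ht⟩ := ih _ (Multiset.card_erase_lt_of_mem he) (h.erase he hs) rfl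
      refine ⟨e :: l, ?_, hs, ht⟩
      rw [← Multiset.cons_coe, ← Multiset.cons_erase he]
      exact Multiset.cons_le_cons e hl

/-- A balanced multiset of edges is used up by a trail if all its edges can be reached from the
start: a trail that leaves out some edges can be extended by a closed trail. -/
theorem Balanced.exists_trail_eq {s t : ν} {X : Multiset ε} (h : Balanced src tgt s t X)
    (hX : ∀ U : Set ν, s ∈ U → (∀ e ∈ X, src e ∈ U → tgt e ∈ U) → ∀ e ∈ X, src e ∈ U) :
    ∃ l : List ε, (l : Multiset ε) = X ∧ IsTrail src tgt s l t := by
  obtain ⟨l₀, h₀, ht₀⟩ := h.exists_trail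
  suffices key : ∀ (k : ℕ) (l : List ε), (l : Multiset ε) ≤ X → IsTrail src tgt s l t →
      X.card ≤ l.length + k → ∃ l : List ε, (l : Multiset ε) = X ∧ IsTrail src tgt s l t from
    key X.card l₀ h₀ ht₀ (by omega)
  intro k
  induction k with
  | zero => exact fun l hl ht hk => ⟨l, Multiset.eq_of_le_of_card_le hl (by simpa using hk), ht⟩
  | succ k ih =>
    intro l hl ht hk
    obtain ⟨R, rfl⟩ := Multiset.le_iff_exists_add.1 hl
    by_cases hR : R = 0
    · exact ⟨l, by simp [hR], ht⟩
    have hbal : ∀ v, Balanced src tgt v v R := by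
      intro v w
      have h1 := h w
      have h2 := ht.balanced w
      rw [Multiset.map_add, Multiset.sum_add, h2] at h1
      simpa using h1
    let U : Set ν := {v | ∃ l₁ l₂, l = l₁ ++ l₂ ∧ IsTrail src tgt s l₁ v ∧ IsTrail src tgt v l₂ t}
    obtain ⟨e, he, l₁, l₂, rfl, h1, h2⟩ : ∃ e ∈ R, src e ∈ U := by
      by_contra! hU
      obtain ⟨e, he⟩ := Multiset.exists_mem_of_ne_zero hR
      refine hU e he (hX U ⟨[], l, rfl, rfl, ht⟩ ?_ e (by simp [he]))
      intro e' he' hs'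
      rcases Multiset.mem_add.1 he' with he' | he'
      · obtain ⟨l₁, l₂, rfl⟩ := List.append_of_mem (Multiset.mem_coe.1 he')
        obtain ⟨w, h1, h2, h3⟩ := isTrail_append.1 ht
        exact ⟨l₁ ++ [e'], l₂, by simp, isTrail_append.2 ⟨w, h1, h2, rfl⟩, h3⟩
      · exact absurd hs' (hU e' he')
    obtain ⟨c, hc, htc⟩ := ((hbal (src e)).erase he rfl).exists_trail
    have hc' : (↑(e :: c) : Multiset ε) ≤ R := by
      rw [← Multiset.cons_coe, ← Multiset.cons_erase he]
      exact Multiset.cons_le_cons e hc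
    refine ih (l₁ ++ ((e :: c) ++ l₂)) ?_ ?_ ?_
    · have : (↑(l₁ ++ ((e :: c) ++ l₂)) : Multiset ε) = ↑(l₁ ++ l₂) + ↑(e :: c) := by
        simp only [← Multiset.coe_add]
        abel
      rw [this]
      gcongr
    · exact isTrail_append.2 ⟨_, h1, isTrail_append.2 ⟨_, ⟨rfl, htc⟩, h2⟩⟩
    · simp only [List.length_append, List.length_cons] at hk ⊢
      omega

omit [DecidableEq ν] [DecidableEq ε] in
/-- A labelling of the vertices that decreases along some edge into each vertex but `s` at which an
edge starts witnesses that these vertices can be reached from `s`. -/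
theorem src_mem_of_labelling {s : ν} {X : Multiset ε} (z : ν → ℤ)
    (hz : ∀ e ∈ X, src e = s ∨ ∃ e' ∈ X, tgt e' = src e ∧ z (src e') < z (src e)) (U : Set ν)
    (hs : s ∈ U) (hU : ∀ e ∈ X, src e ∈ U → tgt e ∈ U) : ∀ e ∈ X, src e ∈ U := by
  classical
  by_contra! hX
  obtain ⟨e, he, heU⟩ := hX
  obtain ⟨e, he, hmin⟩ := (X.toFinset.filter fun e => src e ∉ U).exists_min_image
    (fun e => z (src e)) ⟨e, by simp [he, heU]⟩
  simp only [Finset.mem_filter, Multiset.mem_toFinset] at he hmin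
  rcases hz e he.1 with h | ⟨e', he', h1, h2⟩
  · exact he.2 (h ▸ hs)
  · by_cases h3 : src e' ∈ U
    · exact he.2 (h1 ▸ hU e' he' h3)
    · exact absurd (hmin e' ⟨he', h3⟩) (by omega)

omit [DecidableEq ε] in
/-- The first visits of a trail to its vertices provide a labelling as in
`src_mem_of_labelling`. -/
theorem IsTrail.exists_labelling {s t : ν} {l : List ε} (h : IsTrail src tgt s l t) :
    ∃ z : ν → ℤ, ∀ e ∈ l, src e = s ∨ ∃ e' ∈ l, tgt e' = src e ∧ z (src e') < z (src e) := by
  suffices key : ∃ z : ν → ℤ, (∀ e ∈ l, src e = s ∨ ∃ e' ∈ l, tgt e' = src e) ∧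
      (t = s ∨ ∃ e' ∈ l, tgt e' = t) ∧
      ∀ v, (∃ e ∈ l, tgt e = v) → v = s ∨ ∃ e' ∈ l, tgt e' = v ∧ z (src e') < z v by
    obtain ⟨z, h1, -, h2⟩ := key
    exact ⟨z, fun e he => (h1 e he).elim Or.inl fun h => h2 _ h⟩
  induction l using List.reverseRecOn generalizing t with
  | nil => exact ⟨0, by simp, Or.inl h.symm, by simp⟩
  | append_singleton l e ih =>
    obtain ⟨w, h1, rfl, rfl⟩ := isTrail_append.1 h
    obtain ⟨z, h2, h3, h4⟩ := ih h1
    by_cases hv : tgt e = s ∨ ∃ e' ∈ l, tgt e' = tgt e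
    · refine ⟨z, ?_, Or.inr ⟨e, by simp⟩, ?_⟩
      · grind
      · rintro v ⟨e', he', rfl⟩
        have h5 : tgt e' = s ∨ ∃ a ∈ l, tgt a = tgt e' := by
          rcases List.mem_append.1 he' with he' | he'
          · exact Or.inr ⟨e', he', rfl⟩
          · obtain rfl : e' = e := by simpa using he'
            exact hv
        rcases h5 with h5 | ⟨a, ha, h5⟩
        · exact Or.inl h5
        · rcases h4 _ ⟨a, ha, h5⟩ with h6 | ⟨b, hb, h6⟩
          · exact Or.inl h6
          · exact Or.inr ⟨b, by simp [hb], h6⟩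
    · refine ⟨Function.update z (tgt e) (z (src e) + 1), ?_, Or.inr ⟨e, by simp⟩, ?_⟩
      · grind
      · push Not at hv
        rintro v ⟨e', he', rfl⟩
        rcases List.mem_append.1 he' with he' | he'
        · rcases h4 _ ⟨e', he', rfl⟩ with h5 | ⟨e'', h5, h6, h7⟩
          · exact Or.inl h5
          · refine Or.inr ⟨e'', by simp [h5], h6, ?_⟩
            rw [Function.update_of_ne, Function.update_of_ne]
            · exact h7
            · exact hv.2 e' he'
            · rcases h2 e'' h5 with h8 | ⟨a, h8, h9⟩
              · rw [h8]; exact Ne.symm hv.1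
              · rw [← h9]; exact hv.2 a h8
        · obtain rfl : e' = e := by simpa using he'
          refine Or.inr ⟨e', by simp, rfl, ?_⟩
          rw [Function.update_self, Function.update_of_ne]
          · omega
          · rcases h3 with h8 | ⟨a, h8, h9⟩
            · rw [h8]; exact Ne.symm hv.1
            · rw [← h9]; exact hv.2 a h8

end

/-! ### The formula for the trails of a graph -/

/-- Edges of a graph on natural numbers: source, weight vector and target. -/
abbrev GEdge : Type := ℕ × List ℤ × ℕ

/-- The number of edges with property `p`, where the multiplicity of an edge is the variable that
is paired with it. -/
def countTerm (p : GEdge → Bool) (EV : List (GEdge × ℕ)) : RTerm :=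
  .sum ((EV.filter fun e => p e.1).map fun e => .var e.2)

/-- The term `1` or `0`. -/
def indTerm (b : Bool) : RTerm := if b then .one else .zero

/-- The condition at the vertex `v` on the multiplicities of edges: the edges are balanced up to a
unit that flows from `0` to `1`, and if some edge leaves `v ≠ 0`, then some edge enters `v` from a
vertex with a smaller label. The label of `v` is the variable `x_{v+1}`. -/
def nodeForm (EV : List (GEdge × ℕ)) (v : ℕ) : RForm :=
  .and
    (.eq (.add (countTerm (fun e => decide (e.1 = v)) EV) (indTerm (decide (v = 1))))
      (.add (countTerm (fun e => decide (e.2.2 = v)) EV) (indTerm (decide (v = 0)))))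
    (.or (if decide (v = 0) then .le .zero .zero
        else .le (countTerm (fun e => decide (e.1 = v)) EV) .zero)
      (.disj ((EV.filter fun e => decide (e.1.2.2 = v)).map fun e =>
        .and (.le .one (.var e.2)) (.le (.add .one (.var (e.1.1 + 1))) (.var (v + 1))))))

/-- The binary digits of the positive part of an integer. -/
def posBits (c : ℤ) : List Bool := if decide (c < 0) then [] else c.natAbs.bits

/-- The binary digits of the negative part of an integer. -/
def negBits (c : ℤ) : List Bool := if decide (c < 0) then c.natAbs.bits else []

/-- The summands of the `i`-th component of the weight of the edges, for one of the two signs. The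
index `i` is given by its encoding. -/
noncomputable def weightTerms (bits : ℤ → List Bool) (EV : List (GEdge × ℕ)) (i : Dat) :
    List RTerm :=
  EV.flatMap fun e => (e.1.2.1.zipIdx.filter fun c => decide (enc c.2 = i)).map fun c =>
    .mulBits (bits c.1) (.var e.2)

/-- The terms that replace a variable of the acceptance constraint: the components of the weight
vector for the free variables, and fresh variables, as listed in the table `tab`, for the bound
ones. -/
noncomputable def substTerms (EV : List (GEdge × ℕ)) (tab : List ((Dat × ℕ) × ℕ)) (i : Dat) :
    RTerm × RTerm :=
  (.sum (weightTerms posBits EV i ++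
      (tab.filter fun r => decide (enc r.1.2 = i)).map fun r => .var r.2),
    .sum (weightTerms negBits EV i))

/-- The quantifier-free formula which says that a trail from `0` to `1` with `x_0 + 2` edges
satisfies the constraint `χ`. -/
def trailForm (nodes : List ℕ) (EV : List (GEdge × ℕ)) (χ : RForm) : RForm :=
  .conj (nodes.map (nodeForm EV) ++ (EV.map fun e => .le .zero (.var e.2)) ++
    [.eq (.add .one (.add .one (.var 0))) (countTerm (fun _ => true) EV), χ])

/-- The sum of the values of `f` at the edges, with multiplicities. -/
def lin (W : ℕ → ℤ) (EV : List (GEdge × ℕ)) (f : GEdge → ℤ) : ℤ :=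
  (EV.map fun e => W e.2 * f e.1).sum

theorem lin_sub (W : ℕ → ℤ) (EV : List (GEdge × ℕ)) (f g : GEdge → ℤ) :
    lin W EV (fun e => f e - g e) = lin W EV f - lin W EV g := by
  induction EV with
  | nil => rfl
  | cons e EV ih =>
    simp only [lin, List.map_cons, List.sum_cons] at ih ⊢
    rw [ih]
    ring

theorem eval_countTerm (W : ℕ → ℤ) (p : GEdge → Bool) (EV : List (GEdge × ℕ)) :
    (countTerm p EV).eval W = lin W EV fun e => if p e then 1 else 0 := by
  rw [countTerm, RTerm.eval_sum, List.map_map]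
  induction EV with
  | nil => rfl
  | cons e EV ih =>
    rw [List.filter_cons]
    simp only [lin, List.map_cons, List.sum_cons] at ih ⊢
    split
    · rw [List.map_cons, List.sum_cons, ih]
      simp [RTerm.eval]
    · rw [ih]
      simp

theorem eval_indTerm (W : ℕ → ℤ) (b : Bool) : (indTerm b).eval W = if b then 1 else 0 := by
  cases b <;> rfl

theorem eval_pos_sub_neg (W : ℕ → ℤ) (c : ℤ) (t : RTerm) :
    (RTerm.mulBits (posBits c) t).eval W - (RTerm.mulBits (negBits c) t).eval W =
      t.eval W * c := by
  have h0 : (RTerm.mulBits [] t).eval W = 0 := rfl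
  by_cases h : c < 0
  · rw [posBits, negBits, if_pos (by simpa using h), if_pos (by simpa using h), h0,
      RTerm.eval_mulBits, show (c.natAbs : ℤ) = -c by omega]
    ring
  · rw [posBits, negBits, if_neg (by simpa using h), if_neg (by simpa using h), h0,
      RTerm.eval_mulBits, show (c.natAbs : ℤ) = c by omega]
    ring

theorem enc_nat_inj {i j : ℕ} : enc i = enc j ↔ i = j := ⟨EncInj.inj i j, fun h => h ▸ rfl⟩

theorem filter_zipIdx {γ : Type} (w : List γ) (s i : ℕ) :
    (w.zipIdx s).filter (fun c => decide (c.2 = i)) =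
      if s ≤ i then (w[i - s]?.map fun g => (g, i)).toList else [] := by
  induction w generalizing s with
  | nil => simp
  | cons g w ih =>
    rw [List.zipIdx_cons, List.filter_cons, ih]
    rcases lt_trichotomy s i with h | rfl | h
    · rw [if_neg (by simp; omega), if_pos (by omega), if_pos (by omega),
        show i - s = (i - (s + 1)) + 1 by omega, List.getElem?_cons_succ]
    · simp
    · rw [if_neg (by simp; omega), if_neg (by omega), if_neg (by omega)]

theorem eval_weightTerms (W : ℕ → ℤ) (EV : List (GEdge × ℕ)) (i : ℕ) :
    (RTerm.sum (weightTerms posBits EV (enc i))).eval W -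
      (RTerm.sum (weightTerms negBits EV (enc i))).eval W =
      lin W EV fun e => e.2.1.getD i 0 := by
  simp only [weightTerms, enc_nat_inj, filter_zipIdx, Nat.zero_le, if_true, Nat.sub_zero,
    RTerm.eval_sum]
  induction EV with
  | nil => rfl
  | cons e EV ih =>
    simp only [lin, List.map_cons, List.sum_cons, List.flatMap_cons, List.map_append,
      List.sum_append] at ih ⊢
    rw [← ih, List.getD_eq_getElem?_getD]
    cases e.1.2.1[i]? with
    | none => simp
    | some c =>
      have := eval_pos_sub_neg W c (.var e.2)
      simp only [RTerm.eval] at this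
      simp only [Option.map_some, Option.toList_some, List.map_cons, List.map_nil, List.sum_cons,
        List.sum_nil, Option.getD_some, ← this]
      ring

theorem sum_map_filter_table (W : ℕ → ℤ) (u : List Dat) (d M i : ℕ) :
    ((((u.zipIdx d).zipIdx M).filter fun r => decide (r.1.2 = i)).map fun r => W r.2).sum =
      if d ≤ i ∧ i < d + u.length then W (M + (i - d)) else 0 := by
  induction u generalizing d M with
  | nil => simp
  | cons g u ih =>
    rw [List.zipIdx_cons, List.zipIdx_cons, List.filter_cons, List.length_cons]
    rcases lt_trichotomy d i with h | rfl | h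
    · rw [if_neg (by simp; omega), ih, show M + 1 + (i - (d + 1)) = M + (i - d) by omega]
      exact if_congr (by omega) rfl rfl
    · simp [ih]
    · rw [if_neg (by simp; omega), ih, if_neg (by omega), if_neg (by omega)]

theorem eval_substTerms (W : ℕ → ℤ) (EV : List (GEdge × ℕ)) (u : List Dat) (d M i : ℕ) :
    (substTerms EV ((u.zipIdx d).zipIdx M) (enc i)).1.eval W -
      (substTerms EV ((u.zipIdx d).zipIdx M) (enc i)).2.eval W =
    lin W EV (fun e => e.2.1.getD i 0) +
      if d ≤ i ∧ i < d + u.length then W (M + (i - d)) else 0 := by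
  rw [← eval_weightTerms, ← sum_map_filter_table]
  simp only [substTerms, RTerm.eval_sum, List.map_append, List.sum_append, enc_nat_inj,
    List.map_map, Function.comp_def, RTerm.eval]
  ring

/-- The meaning of the condition at a vertex. -/
theorem holds_nodeForm (W : ℕ → ℤ) (EV : List (GEdge × ℕ)) (v : ℕ) :
    (nodeForm EV v).Holds W ↔
      lin W EV (flow Prod.fst (fun e => e.2.2) v) =
        (if v = 0 then 1 else 0) - (if v = 1 then 1 else 0) ∧
      ((v = 0 ∨ lin W EV (fun e => if e.1 = v then 1 else 0) ≤ 0) ∨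
        ∃ e ∈ EV, e.1.2.2 = v ∧ 1 ≤ W e.2 ∧ W (e.1.1 + 1) < W (v + 1)) := by
  have h1 : lin W EV (flow Prod.fst (fun e => e.2.2) v) =
      lin W EV (fun e => if e.1 = v then 1 else 0) -
        lin W EV (fun e => if e.2.2 = v then 1 else 0) := lin_sub _ _ _ _
  simp only [nodeForm, RForm.Holds, RForm.holds_eq, RForm.holds_disj, RTerm.eval, eval_countTerm,
    eval_indTerm, decide_eq_true_eq, List.mem_map, List.mem_filter, h1]
  refine and_congr ⟨fun h => by omega, fun h => by omega⟩ (or_congr ?_ ?_)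
  · split
    · simp [RForm.Holds, *]
    · simp [RForm.Holds, RTerm.eval, eval_countTerm, *]
  · constructor
    · rintro ⟨φ, ⟨e, ⟨h2, h3⟩, rfl⟩, h4, h5⟩
      simp only [RForm.Holds, RTerm.eval] at h4 h5
      exact ⟨e, h2, h3, h4, by omega⟩
    · rintro ⟨e, h2, h3, h4, h5⟩
      refine ⟨_, ⟨e, ⟨h2, h3⟩, rfl⟩, h4, ?_⟩
      simp only [RForm.Holds, RTerm.eval]
      omega

theorem holds_trailForm (W : ℕ → ℤ) (nodes : List ℕ) (EV : List (GEdge × ℕ)) (χ : RForm) :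
    (trailForm nodes EV χ).Holds W ↔
      (∀ v ∈ nodes, (nodeForm EV v).Holds W) ∧ (∀ e ∈ EV, 0 ≤ W e.2) ∧
        W 0 + 2 = lin W EV (fun _ => 1) ∧ χ.Holds W := by
  simp only [trailForm, RForm.holds_conj, List.mem_append, List.mem_map, List.mem_cons,
    List.not_mem_nil, or_false, or_imp, forall_and, forall_eq, forall_exists_index, and_imp,
    forall_apply_eq_imp_iff₂, RForm.holds_eq, RTerm.eval, eval_countTerm, if_true, and_assoc,
    RForm.Holds]
  refine and_congr_right fun _ => and_congr_right fun _ => and_congr_left fun _ =>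
    ⟨fun h => by omega, fun h => by omega⟩

/-- Multiplicities as a list of edges in which each edge is repeated accordingly. -/
theorem lin_eq_sum_replicate {W : ℕ → ℤ} {EV : List (GEdge × ℕ)} (h : ∀ e ∈ EV, 0 ≤ W e.2)
    (f : GEdge → ℤ) :
    lin W EV f = ((EV.flatMap fun e => List.replicate (W e.2).toNat e.1).map f).sum := by
  induction EV with
  | nil => rfl
  | cons e EV ih =>
    have h1 := h e List.mem_cons_self
    simp only [lin, List.map_cons, List.sum_cons, List.flatMap_cons, List.map_append,
      List.sum_append] at ih ⊢
    rw [ih fun e he => h e (List.mem_cons_of_mem _ he)]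
    simp [h1]

/-- The edges of a trail with their numbers of occurrences as multiplicities. -/
theorem lin_count {W : ℕ → ℤ} {E : List GEdge} {s : ℕ} (hE : E.Nodup) {l : List GEdge}
    (hl : ∀ e ∈ l, e ∈ E) (hW : ∀ e ∈ E.zipIdx s, W e.2 = l.count e.1) (f : GEdge → ℤ) :
    lin W (E.zipIdx s) f = (l.map f).sum := by
  have h1 : lin W (E.zipIdx s) f = (E.map fun e => (l.count e : ℤ) * f e).sum := by
    rw [lin, List.map_congr_left (g := fun e => (l.count e.1 : ℤ) * f e.1)
      fun e he => by rw [hW e he]]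
    conv_rhs => rw [← List.zipIdx_map_fst s E, List.map_map]
    rfl
  rw [h1, ← List.sum_toFinset _ hE, Finset.sum_list_map_count]
  simp only [nsmul_eq_mul]
  -- The two sides count with different instances of `BEq`.
  rw [lawful_beq_subsingleton (instBEqOfDecidableEq : BEq GEdge) instBEqProd]
  symm
  apply Finset.sum_subset
  · intro e he
    exact List.mem_toFinset.2 (hl e (List.mem_toFinset.1 he))
  · intro e _ he
    rw [List.count_eq_zero_of_not_mem fun h => he (List.mem_toFinset.2 h)]
    simp

/-- The formula is correct: its models with `x_0 = ℓ` correspond to the trails from `0` to `1` with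
`ℓ + 2` edges whose weight satisfies the constraint. -/
theorem exists_holds_trailForm_iff {n d : ℕ} {nodes : List ℕ} (hn : ∀ v, v ∈ nodes ↔ v < n + 2)
    {E : List GEdge} (hE : E.Nodup)
    (hEn : ∀ e ∈ E, e.1 < n + 2 ∧ e.2.1.length = d ∧ e.2.2 < n + 2)
    {ψ : Formula d} (hψ : ψ.IsExistential) {u : List Dat} (hu : u.length = ψ.exDepth) (ℓ : ℕ) :
    (∃ W : ℕ → ℤ, W 0 = ℓ ∧ (trailForm nodes (E.zipIdx (n + 3)) (ψ.subst fun i =>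
      substTerms (E.zipIdx (n + 3)) ((u.zipIdx d).zipIdx (n + 3 + E.length)) (enc i))).Holds W) ↔
    ∃ l : List GEdge, IsTrail Prod.fst (fun e => e.2.2) 0 l 1 ∧ (∀ e ∈ l, e ∈ E) ∧
      l.length = ℓ + 2 ∧ ψ.Holds fun i : Fin d => (l.map fun e => e.2.1.getD i 0).sum := by
  have hmem : ∀ e ∈ E.zipIdx (n + 3), e.1 ∈ E := fun e he => List.fst_mem_of_mem_zipIdx he
  constructor
  · rintro ⟨W, hW0, hW⟩
    rw [holds_trailForm] at hW
    obtain ⟨h1, h2, h3, h4⟩ := hW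
    simp only [holds_nodeForm] at h1
    set EV := E.zipIdx (n + 3)
    set L := EV.flatMap fun e => List.replicate (W e.2).toNat e.1 with hL
    have hlin : ∀ f, lin W EV f = (L.map f).sum := fun f => lin_eq_sum_replicate h2 f
    have hmemL : ∀ e, e ∈ L ↔ ∃ i, (e, i) ∈ EV ∧ 1 ≤ W i := by
      intro e
      simp only [hL, List.mem_flatMap, List.mem_replicate]
      constructor
      · rintro ⟨⟨e', i⟩, h, h', rfl⟩
        exact ⟨i, h, by dsimp only at h'; omega⟩
      · rintro ⟨i, h, h'⟩
        exact ⟨(e, i), h, by dsimp only; omega, rfl⟩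
    have hLE : ∀ e ∈ L, e ∈ E := fun e he =>
      let ⟨i, hi, _⟩ := (hmemL e).1 he
      hmem _ hi
    have hbal : Balanced Prod.fst (fun e : GEdge => e.2.2) 0 1 (L : Multiset GEdge) := by
      intro v
      by_cases hv : v ∈ nodes
      · rw [Multiset.map_coe, Multiset.sum_coe, ← hlin, (h1 v hv).1]
      · rw [hn] at hv
        rw [Multiset.map_coe, Multiset.sum_coe, List.sum_eq_zero]
        · rw [if_neg (by omega), if_neg (by omega), sub_zero]
        · intro x hx
          obtain ⟨e, he, rfl⟩ := List.mem_map.1 hx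
          have := hEn e (hLE e he)
          rw [flow, if_neg (by omega), if_neg (by omega), sub_zero]
    have hlabel : ∀ e ∈ (L : Multiset GEdge), e.1 = 0 ∨
        ∃ e' ∈ (L : Multiset GEdge), e'.2.2 = e.1 ∧ W (e'.1 + 1) < W (e.1 + 1) := by
      intro e he
      have he' := hEn e (hLE e he)
      rcases (h1 e.1 ((hn _).2 he'.1)).2 with (h | h) | ⟨⟨e', i⟩, h5, h6, h7, h8⟩
      · exact Or.inl h
      · exfalso
        rw [hlin] at h
        have h9 := List.single_le_sum (l := L.map fun e' => if e'.1 = e.1 then (1 : ℤ) else 0)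
          (by simp only [List.mem_map]; rintro x ⟨e', -, rfl⟩; split <;> simp) 1
          (List.mem_map.2 ⟨e, he, by simp⟩)
        omega
      · exact Or.inr ⟨e', (hmemL e').2 ⟨i, h5, h7⟩, h6, h8⟩
    obtain ⟨l, hl, ht⟩ := hbal.exists_trail_eq
      (src_mem_of_labelling (fun v => W (v + 1)) hlabel)
    have hperm : ∀ f : GEdge → ℤ, (l.map f).sum = lin W EV f := by
      intro f
      rw [hlin, ← Multiset.sum_coe, ← Multiset.sum_coe, ← Multiset.map_coe, ← Multiset.map_coe,
        hl]
    refine ⟨l, ht, fun e he => hLE e ?_, ?_, ?_⟩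
    · rw [← Multiset.mem_coe, hl, Multiset.mem_coe] at he
      exact he
    · have := hperm fun _ => 1
      rw [← h3, hW0] at this
      simp only [List.map_const', List.sum_replicate, nsmul_eq_mul, mul_one] at this
      omega
    · rw [Formula.holds_subst] at h4
      refine (Formula.holds_iff_exists_matrixHolds hψ _).2 ⟨_, fun i => ?_, h4⟩
      rw [eval_substTerms, hperm, if_neg (by omega), add_zero]
  · rintro ⟨l, ht, hl, hlen, hψl⟩
    obtain ⟨w, hw, hm⟩ := (Formula.holds_iff_exists_matrixHolds hψ _).1 hψl
    obtain ⟨z, hz⟩ := ht.exists_labelling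
    -- The variable `0` is the length; the labels of the vertices, the multiplicities of the edges
    -- and the bound variables of the constraint follow.
    let W : ℕ → ℤ := fun k => if k = 0 then ℓ else if k < n + 3 then z (k - 1) else
      if h : k - (n + 3) < E.length then l.count E[k - (n + 3)] else
        w (d + (k - (n + 3 + E.length)))
    have hWe : ∀ e ∈ E.zipIdx (n + 3), W e.2 = l.count e.1 := by
      rintro ⟨e, i⟩ he
      obtain ⟨h1, h2, h3⟩ := List.mem_zipIdx he
      simp only [W]
      rw [if_neg (by omega), if_neg (by omega), dif_pos (by omega), h3]
    have hWz : ∀ v < n + 2, W (v + 1) = z v := by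
      intro v hv
      simp only [W]
      rw [if_neg (by omega), if_pos (by omega), Nat.add_sub_cancel]
    have hWw : ∀ j, W (n + 3 + E.length + j) = w (d + j) := by
      intro j
      simp only [W]
      rw [if_neg (by omega), if_neg (by omega), dif_neg (by omega), Nat.add_sub_cancel_left]
    have hlin := lin_count hE hl hWe
    refine ⟨W, rfl, (holds_trailForm _ _ _ _).2 ⟨fun v hv => ?_, fun e he => ?_, ?_, ?_⟩⟩
    · rw [holds_nodeForm, hlin, hlin]
      refine ⟨?_, ?_⟩
      · have := ht.balanced v
        rwa [Multiset.map_coe, Multiset.sum_coe] at this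
      · by_cases h : ∃ e ∈ l, e.1 = v
        · obtain ⟨e, he, rfl⟩ := h
          rcases hz e he with h | ⟨e', he', h1, h2⟩
          · exact Or.inl (Or.inl h)
          · obtain ⟨i, hi, hi'⟩ := List.getElem_of_mem (hl e' he')
            refine Or.inr ⟨(e', n + 3 + i), ?_, h1, ?_, ?_⟩
            · rw [List.mk_mem_zipIdx_iff_le_and_getElem?_sub]
              simp [hi, hi']
            · have hmem' : (e', n + 3 + i) ∈ E.zipIdx (n + 3) := by
                rw [List.mk_mem_zipIdx_iff_le_and_getElem?_sub]
                simp [hi, hi']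
              have := hWe _ hmem'
              have := List.count_pos_iff.2 he'
              dsimp only at *
              omega
            · dsimp only
              rw [hWz _ (hEn e' (hl e' he')).1, hWz _ (hEn e (hl e he)).1]
              exact h2
        · refine Or.inl (Or.inr (le_of_eq (List.sum_eq_zero ?_)))
          intro x hx
          obtain ⟨e, he, rfl⟩ := List.mem_map.1 hx
          exact if_neg fun h' => h ⟨e, he, h'⟩
    · rw [hWe e he]
      positivity
    · have hW0 : W 0 = ℓ := rfl
      rw [hlin, hW0]
      simp [hlen]
    · rw [Formula.holds_subst, ← Formula.matrixHolds_congr hψ (w := w)]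
      · exact hm
      · intro i hi
        rw [eval_substTerms, hlin, hu]
        by_cases hid : i < d
        · rw [if_neg (by omega), add_zero, hw ⟨i, hid⟩]
        · rw [if_pos ⟨by omega, hi⟩, hWw, List.sum_eq_zero, zero_add,
            show d + (i - d) = i by omega]
          intro x hx
          obtain ⟨e, he, rfl⟩ := List.mem_map.1 hx
          rw [List.getD_eq_default]
          rw [(hEn e (hl e he)).2.1]
          omega

/-! ### The graph of an automaton -/

/-- The weight vectors of the transitions from a state on a letter, for each target. -/
abbrev Row : Type := List (List (List ℤ))

/-- The data that the encoding of an automaton holds about a state. -/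
abbrev StateData : Type := Bool × Bool × Bool × Bool × Row × Row × List Row × Unit

/-- The data that the encoding of an automaton holds: the dimension, the states, and the acceptance
constraint. -/
abbrev InputData : Type := ℕ × List StateData × Dat × Unit

/-- The edges from the start `0`, which read `⊢`. The state `p` is the vertex `p + 2`. -/
def startEdges (sts : List StateData) : List GEdge :=
  (sts.zipIdx 2).flatMap fun s =>
    if s.1.2.1 then
      (s.1.2.2.2.2.1.zipIdx 2).flatMap fun c => c.1.map fun w => (0, w, c.2)
    else []

/-- The edges between states, which read letters. -/
def innerEdges (sts : List StateData) : List GEdge :=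
  (sts.zipIdx 2).flatMap fun s => s.1.2.2.2.2.2.2.1.flatMap fun row =>
    (row.zipIdx 2).flatMap fun c => c.1.map fun w => (s.2, w, c.2)

/-- The vertices of the accepting states. -/
def acceptingNodes (sts : List StateData) : List ℕ :=
  ((sts.zipIdx 2).filter fun s => s.1.2.2.2.1).map fun s => s.2

/-- The edges to the end `1`, which read `⊣` and lead to an accepting state. -/
def endEdges (sts : List StateData) : List GEdge :=
  (sts.zipIdx 2).flatMap fun s =>
    ((s.1.2.2.2.2.2.1.zipIdx 2).filter fun c =>
      (acceptingNodes sts).any fun q => decide (q = c.2)).flatMap fun c =>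
        c.1.map fun w => (s.2, w, 1)

/-- The edges of the graph of an automaton. Transitions on different letters that agree in their
states and weights give the same edge, so that the number of edges does not depend on the
alphabet. -/
def edges (sts : List StateData) : List GEdge :=
  distinct (startEdges sts ++ innerEdges sts ++ endEdges sts)

/-- The vertices `0`, `1` and `p + 2` for the states `p`. -/
def nodes (sts : List StateData) : List ℕ := 0 :: 1 :: (sts.zipIdx 2).map fun s => s.2

namespace TwoPA

variable {n k d : ℕ}

/-- The weight vector of a transition as a list. -/
def weightList {Q σ : Type} (P : TwoPA Q σ d) (t : Q × Letter σ × Q) : List ℤ :=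
  List.ofFn (P.wt t)

/-- The weight vectors of the transitions from `p` on `a`, in the form of the encoding. -/
def row (P : TwoPA (Fin n) (Fin k) d) (p : Fin n) (a : Letter (Fin k)) : Row :=
  List.ofFn fun q : Fin n => if (p, a, q) ∈ P.Δ then [P.weightList (p, a, q)] else []

/-- The data that the encoding holds about the state `p`. -/
def stateData (P : TwoPA (Fin n) (Fin k) d) (p : Fin n) : StateData :=
  (decide (p ∈ P.QL), decide (p ∈ P.QI), decide (p ∈ P.QH), decide (p ∈ P.QF),
    P.row p .lend, P.row p .rend, List.ofFn fun a : Fin k => P.row p (.sym a), ())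

/-- The data that the encoding holds about all states. -/
def states (P : TwoPA (Fin n) (Fin k) d) : List StateData := List.ofFn P.stateData

theorem enc_row (P : TwoPA (Fin n) (Fin k) d) (p : Fin n) (a : Letter (Fin k)) :
    enc (P.row p a) = P.encRow p a := by
  rw [row, encRow]
  change encList ((List.ofFn _).map enc) = _
  rw [List.map_ofFn]
  congr 2
  ext q
  dsimp only [Function.comp]
  split
  · rw [weightList]
    change encList [encList ((List.ofFn _).map enc)] = _
    rw [List.map_ofFn]
    rfl
  · rfl

theorem enc_stateData (P : TwoPA (Fin n) (Fin k) d) (p : Fin n) :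
    enc (P.stateData p) = P.encState p := by
  rw [encState, ← enc_row, ← enc_row]
  have h : enc (List.ofFn fun a : Fin k => P.row p (.sym a)) =
      encList (List.ofFn fun a : Fin k => P.encRow p (.sym a)) := by
    change encList ((List.ofFn _).map enc) = _
    rw [List.map_ofFn]
    congr 2
    ext a
    exact P.enc_row p _
  rw [← h]
  rfl

theorem enc_input (P : TwoPA (Fin n) (Fin k) d) :
    enc (d, P.states, P.ψ.encode, ()) = P.encode := by
  rw [encode]
  have h : enc P.states = encList (List.ofFn fun p : Fin n => P.encState p) := by
    change encList ((List.ofFn _).map enc) = _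
    rw [List.map_ofFn]
    congr 2
    ext a
    exact P.enc_stateData _
  rw [← h]
  rfl

end TwoPA

theorem mem_zipIdx_ofFn {α : Type} {n s : ℕ} {f : Fin n → α} {x : α × ℕ} :
    x ∈ (List.ofFn f).zipIdx s ↔ ∃ p : Fin n, x = (f p, p + s) := by
  obtain ⟨x, i⟩ := x
  rw [List.mk_mem_zipIdx_iff_le_and_getElem?_sub, List.getElem?_ofFn]
  constructor
  · rintro ⟨h1, h2⟩
    split at h2
    · rename_i h
      refine ⟨⟨i - s, h⟩, ?_⟩
      simp only [Option.some.injEq] at h2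
      rw [← h2, Prod.mk.injEq]
      exact ⟨rfl, by dsimp only; omega⟩
    · simp at h2
  · rintro ⟨p, h⟩
    obtain ⟨rfl, rfl⟩ := Prod.mk.inj h
    simp

namespace TwoPA

variable {n k d : ℕ} (P : TwoPA (Fin n) (Fin k) d)

theorem mem_zipIdx_row {p : Fin n} {a : Letter (Fin k)} {c : List (List ℤ) × ℕ} {w : List ℤ} :
    c ∈ (P.row p a).zipIdx 2 ∧ w ∈ c.1 ↔ ∃ q : Fin n, (p, a, q) ∈ P.Δ ∧
      c = ([P.weightList (p, a, q)], q.val + 2) ∧ w = P.weightList (p, a, q) := by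
  rw [row, mem_zipIdx_ofFn]
  constructor
  · rintro ⟨⟨q, rfl⟩, h⟩
    dsimp only at h
    split at h
    · rename_i h'
      refine ⟨q, h', ?_, by simpa using h⟩
      rw [if_pos h']
    · simp at h
  · rintro ⟨q, h, rfl, rfl⟩
    exact ⟨⟨q, by rw [if_pos h]⟩, by simp⟩

theorem mem_startEdges (e : GEdge) : e ∈ startEdges P.states ↔
    ∃ p ∈ P.QI, ∃ q, (p, Letter.lend, q) ∈ P.Δ ∧
      e = (0, P.weightList (p, .lend, q), q.val + 2) := by
  simp only [startEdges, List.mem_flatMap, states, mem_zipIdx_ofFn]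
  constructor
  · rintro ⟨_, ⟨p, rfl⟩, h⟩
    split at h
    · rename_i h'
      obtain ⟨c, hc, h⟩ := List.mem_flatMap.1 h
      obtain ⟨w, hw, rfl⟩ := List.mem_map.1 h
      obtain ⟨q, hq, rfl, rfl⟩ := P.mem_zipIdx_row.1 ⟨hc, hw⟩
      exact ⟨p, by simpa [stateData] using h', q, hq, rfl⟩
    · simp at h
  · rintro ⟨p, hp, q, hq, rfl⟩
    refine ⟨_, ⟨p, rfl⟩, ?_⟩
    rw [if_pos (by simpa [stateData] using hp)]
    obtain ⟨h1, h2⟩ := P.mem_zipIdx_row.2 ⟨q, hq, rfl, rfl⟩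
    exact List.mem_flatMap.2 ⟨_, h1, List.mem_map.2 ⟨_, h2, rfl⟩⟩

theorem mem_innerEdges (e : GEdge) : e ∈ innerEdges P.states ↔
    ∃ p a q, (p, Letter.sym a, q) ∈ P.Δ ∧
      e = (p.val + 2, P.weightList (p, .sym a, q), q.val + 2) := by
  simp only [innerEdges, List.mem_flatMap, states, mem_zipIdx_ofFn]
  constructor
  · rintro ⟨_, ⟨p, rfl⟩, row, hrow, c, hc, h⟩
    simp only [stateData, List.mem_ofFn] at hrow
    obtain ⟨a, rfl⟩ := hrow
    obtain ⟨w, hw, rfl⟩ := List.mem_map.1 h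
    obtain ⟨q, hq, rfl, rfl⟩ := P.mem_zipIdx_row.1 ⟨hc, hw⟩
    exact ⟨p, a, q, hq, rfl⟩
  · rintro ⟨p, a, q, hq, rfl⟩
    obtain ⟨h1, h2⟩ := P.mem_zipIdx_row.2 ⟨q, hq, rfl, rfl⟩
    exact ⟨_, ⟨p, rfl⟩, P.row p (.sym a), by simp [stateData], _, h1,
      List.mem_map.2 ⟨_, h2, rfl⟩⟩

theorem mem_acceptingNodes (q : Fin n) : q.val + 2 ∈ acceptingNodes P.states ↔ q ∈ P.QF := by
  simp only [acceptingNodes, List.mem_map, List.mem_filter, states, mem_zipIdx_ofFn]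
  constructor
  · rintro ⟨_, ⟨⟨p, rfl⟩, h⟩, h'⟩
    obtain rfl : p = q := Fin.ext (by dsimp only at h'; omega)
    simpa [stateData] using h
  · exact fun h => ⟨_, ⟨⟨q, rfl⟩, by simpa [stateData] using h⟩, rfl⟩

theorem mem_endEdges (e : GEdge) : e ∈ endEdges P.states ↔
    ∃ p q, q ∈ P.QF ∧ (p, Letter.rend, q) ∈ P.Δ ∧
      e = (p.val + 2, P.weightList (p, .rend, q), 1) := by
  simp only [endEdges, List.mem_flatMap, List.mem_filter, List.any_eq_true, decide_eq_true_eq]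
  constructor
  · rintro ⟨s, hs, c, ⟨hc, q', hq', h'⟩, h⟩
    subst h'
    obtain ⟨p, rfl⟩ := mem_zipIdx_ofFn.1 hs
    obtain ⟨w, hw, rfl⟩ := List.mem_map.1 h
    obtain ⟨q, hq, rfl, rfl⟩ := P.mem_zipIdx_row.1 ⟨hc, hw⟩
    exact ⟨p, q, (P.mem_acceptingNodes q).1 hq', hq, rfl⟩
  · rintro ⟨p, q, hqF, hq, rfl⟩
    obtain ⟨h1, h2⟩ := P.mem_zipIdx_row.2 ⟨q, hq, rfl, rfl⟩
    exact ⟨_, mem_zipIdx_ofFn.2 ⟨p, rfl⟩, _, ⟨h1, _, (P.mem_acceptingNodes q).2 hqF, rfl⟩,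
      List.mem_map.2 ⟨_, h2, rfl⟩⟩

theorem mem_edges (e : GEdge) : e ∈ edges P.states ↔
    (∃ p ∈ P.QI, ∃ q, (p, Letter.lend, q) ∈ P.Δ ∧
      e = (0, P.weightList (p, .lend, q), q.val + 2)) ∨
    (∃ p a q, (p, Letter.sym a, q) ∈ P.Δ ∧
      e = (p.val + 2, P.weightList (p, .sym a, q), q.val + 2)) ∨
    ∃ p q, q ∈ P.QF ∧ (p, Letter.rend, q) ∈ P.Δ ∧
      e = (p.val + 2, P.weightList (p, .rend, q), 1) := by
  rw [edges, mem_distinct, List.mem_append, List.mem_append, mem_startEdges, mem_innerEdges,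
    mem_endEdges, or_assoc]

theorem mem_nodes (v : ℕ) : v ∈ nodes P.states ↔ v < n + 2 := by
  simp only [nodes, List.mem_cons, List.mem_map, states, mem_zipIdx_ofFn]
  constructor
  · rintro (rfl | rfl | ⟨_, ⟨p, rfl⟩, rfl⟩) <;> simp
  · intro h
    by_cases h0 : v = 0
    · exact Or.inl h0
    by_cases h1 : v = 1
    · exact Or.inr (Or.inl h1)
    exact Or.inr (Or.inr ⟨_, ⟨⟨v - 2, by omega⟩, rfl⟩, by dsimp only; omega⟩)

theorem of_mem_edges {e : GEdge} (he : e ∈ edges P.states) :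
    e.1 < n + 2 ∧ e.2.1.length = d ∧ e.2.2 < n + 2 ∧ ∃ t ∈ P.Δ, e.2.1 = P.weightList t := by
  rcases (P.mem_edges e).1 he with ⟨p, -, q, h, rfl⟩ | ⟨p, a, q, h, rfl⟩ | ⟨p, q, -, h, rfl⟩
  · exact ⟨by simp, by simp [weightList], by simp, _, h, rfl⟩
  · exact ⟨by simp, by simp [weightList], by simp, _, h, rfl⟩
  · exact ⟨by simp, by simp [weightList], by simp, _, h, rfl⟩

/-- The value of a sequence of transitions agrees with the weight of a list of edges. -/
def SameWeight (ts : List (Fin n × Letter (Fin k) × Fin n)) (l : List GEdge) : Prop :=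
  ∀ i : Fin d, (l.map fun e => e.2.1.getD i 0).sum = (ts.map P.wt).sum i

theorem sameWeight_nil : P.SameWeight [] [] := fun i => by simp

theorem SameWeight.cons {P : TwoPA (Fin n) (Fin k) d}
    {ts : List (Fin n × Letter (Fin k) × Fin n)} {l : List GEdge} (h : P.SameWeight ts l)
    (t : Fin n × Letter (Fin k) × Fin n) (u v : ℕ) :
    P.SameWeight (t :: ts) ((u, P.weightList t, v) :: l) := fun i => by
  rw [List.map_cons, List.map_cons, List.sum_cons, List.sum_cons, h i, Pi.add_apply]
  simp [weightList]

variable {P}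

theorem exists_trail_of_run (hP : P.IsOneWay) {c c' : Config (Fin n) (Fin k)}
    {ts : List (Fin n × Letter (Fin k) × Fin n)} (h : P.Run c ts c') :
    ∀ u : List (Fin k), c.right = u.map .sym ++ [.rend] → c'.right = [] → c'.state ∈ P.QF →
      ∃ l : List GEdge, IsTrail Prod.fst (fun e => e.2.2) (c.state.val + 2) l 1 ∧
        (∀ e ∈ l, e ∈ edges P.states) ∧ l.length = u.length + 1 ∧ P.SameWeight ts l := by
  induction h with
  | nil c =>
    intro u h1 h2
    rw [h1] at h2
    simp at h2
  | @cons c c₁ c₂ a ts hstep hrun ih =>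
    intro u h1 h2 h3
    obtain ⟨hΔ, ⟨-, hr, -⟩ | ⟨hL, -⟩⟩ := hstep
    · cases u with
      | nil =>
        rw [h1] at hr
        obtain ⟨rfl, hr₁⟩ := List.cons.inj hr
        have hr₂ : c₁.right = [] := hr₁.symm
        cases hrun with
        | nil =>
          exact ⟨[(_, P.weightList _, 1)], ⟨rfl, rfl⟩, by
            simpa using (P.mem_edges _).2 (Or.inr (Or.inr ⟨_, _, h3, hΔ, rfl⟩)), rfl,
            P.sameWeight_nil.cons _ _ _⟩
        | cons hstep' _ =>
          obtain ⟨-, ⟨-, hr', -⟩ | ⟨hL, -⟩⟩ := hstep'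
          · rw [hr₂] at hr'
            simp at hr'
          · rw [show P.QL = ∅ from hP] at hL
            simp at hL
      | cons b u =>
        rw [h1] at hr
        obtain ⟨rfl, hr₁⟩ := List.cons.inj hr
        obtain ⟨l, h4, h5, h6, h7⟩ := ih u hr₁.symm h2 h3
        refine ⟨_ :: l, ⟨rfl, h4⟩, ?_, by simp [h6], h7.cons _ (c.state.val + 2) _⟩
        intro e he
        rcases List.mem_cons.1 he with rfl | he
        · exact (P.mem_edges _).2 (Or.inr (Or.inl ⟨_, _, _, hΔ, rfl⟩))
        · exact h5 e he
    · rw [show P.QL = ∅ from hP] at hL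
      simp at hL

theorem exists_run_of_trail (hP : P.IsOneWay) (l : List GEdge) :
    ∀ p : Fin n, IsTrail Prod.fst (fun e => e.2.2) (p.val + 2) l 1 →
      (∀ e ∈ l, e ∈ edges P.states) →
      ∃ (u : List (Fin k)) (ts : _), l.length = u.length + 1 ∧ P.SameWeight ts l ∧
        ∀ left, ∃ c, P.Run ⟨left, p, u.map .sym ++ [.rend]⟩ ts c ∧ c.state ∈ P.QF ∧
          c.right = [] := by
  have hQL : ∀ p, p ∉ P.QL := fun p => by rw [show P.QL = ∅ from hP]; simp
  induction l with
  | nil => exact fun p h => absurd (show p.val + 2 = 1 from h) (by omega)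
  | cons e l ih =>
    rintro p ⟨h1, h2⟩ h3
    have h4 := fun e he => h3 e (List.mem_cons_of_mem _ he)
    rcases (P.mem_edges e).1 (h3 e List.mem_cons_self) with
      ⟨p', -, q, h, rfl⟩ | ⟨p', a, q, h, rfl⟩ | ⟨p', q, hq, h, rfl⟩
    · dsimp only at h1
      omega
    · obtain rfl : p' = p := Fin.ext (by dsimp only at h1; omega)
      obtain ⟨u, ts, h5, h6, h7⟩ := ih q h2 h4
      refine ⟨a :: u, _, by simp [h5], h6.cons _ _ _, fun left => ?_⟩
      obtain ⟨c, h8, h9⟩ := h7 (left ++ [.sym a])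
      exact ⟨c, .cons (c := ⟨left, p', _⟩) (a := .sym a) ⟨h, Or.inl ⟨hQL _, rfl, rfl⟩⟩ h8, h9⟩
    · obtain rfl : p' = p := Fin.ext (by dsimp only at h1; omega)
      -- No edge starts at the vertex `1`.
      obtain rfl : l = [] := by
        cases l with
        | nil => rfl
        | cons e' l =>
          have h5 : e'.1 = 1 := h2.1
          rcases (P.mem_edges e').1 (h4 e' List.mem_cons_self) with
            ⟨p', -, q, h, rfl⟩ | ⟨p', a, q, h, rfl⟩ | ⟨p', q, hq, h, rfl⟩ <;>
          · dsimp only at h5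
            omega
      refine ⟨[], _, rfl, P.sameWeight_nil.cons _ _ _, fun left => ?_⟩
      exact ⟨⟨left ++ [.rend], q, []⟩,
        .cons (c := ⟨left, p', _⟩) (c' := ⟨_, q, _⟩) (a := .rend) ⟨h, Or.inl ⟨hQL _, rfl, rfl⟩⟩
          (.nil _), hq, rfl⟩

/-- Words in the language correspond to trails from `0` to `1`; the two delimiters make the trail
longer than the word by two. -/
theorem exists_mem_language_iff (hP : P.IsOneWay) (ℓ : ℕ) :
    (∃ w ∈ P.language, w.length = ℓ) ↔
    ∃ l : List GEdge, IsTrail Prod.fst (fun e => e.2.2) 0 l 1 ∧ (∀ e ∈ l, e ∈ edges P.states) ∧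
      l.length = ℓ + 2 ∧ P.ψ.Holds fun i : Fin d => (l.map fun e => e.2.1.getD i 0).sum := by
  constructor
  · rintro ⟨u, ⟨ts, ⟨q₀, hq₀, c, hrun, hF, hc⟩, hψ⟩, rfl⟩
    cases hrun with
    | nil => simp [delimited] at hc
    | @cons _ c₁ _ a ts hstep hrun =>
      obtain ⟨hΔ, ⟨-, hr, -⟩ | ⟨hL, -⟩⟩ := hstep
      · obtain ⟨rfl, hr₁⟩ := List.cons.inj hr
        obtain ⟨l, h1, h2, h3, h4⟩ := exists_trail_of_run hP hrun u hr₁.symm hc hF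
        have h5 := h4.cons (q₀, .lend, c₁.state) 0 (c₁.state.val + 2)
        refine ⟨_ :: l, ⟨rfl, h1⟩, ?_, by simp [h3], (funext h5 : _ = _) ▸ hψ⟩
        intro e he
        rcases List.mem_cons.1 he with rfl | he
        · exact (P.mem_edges _).2 (Or.inl ⟨_, hq₀, _, hΔ, rfl⟩)
        · exact h2 e he
      · rw [show P.QL = ∅ from hP] at hL
        simp at hL
  · rintro ⟨l, h1, h2, h3, h4⟩
    cases l with
    | nil => simp at h3
    | cons e l =>
      obtain ⟨h5, h6⟩ := h1
      rcases (P.mem_edges e).1 (h2 e List.mem_cons_self) with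
        ⟨p, hp, q, h, rfl⟩ | ⟨p, a, q, h, rfl⟩ | ⟨p, q, hq, h, rfl⟩
      · obtain ⟨u, ts, h7, h8, h9⟩ := exists_run_of_trail hP l q h6
          fun e he => h2 e (List.mem_cons_of_mem _ he)
        obtain ⟨c, h10, h11, h12⟩ := h9 [.lend]
        refine ⟨u, ⟨(p, .lend, q) :: ts, ⟨p, hp, c, ?_, h11, h12⟩, ?_⟩, ?_⟩
        · refine .cons (c := ⟨[], p, _⟩) (a := .lend) ⟨h, Or.inl ⟨?_, rfl, rfl⟩⟩ h10
          rw [show P.QL = ∅ from hP]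
          simp
        · rwa [← (funext (h8.cons (p, .lend, q) 0 (q.val + 2)) : _ = _)]
        · simp only [List.length_cons] at h3
          omega
      · dsimp only at h5
        omega
      · dsimp only at h5
        omega

end TwoPA

/-! ### The construction of the formula in polynomial time -/

instance : Enc RTerm := ⟨RTerm.encode⟩
instance : Enc RForm := ⟨RForm.encode⟩

/-- The tags of the encodings of terms and formulas have bounded size. -/
theorem tag_size_le {c : ℕ} (hc : c ≤ 4) : (encNat c).size ≤ 13 := by
  have h1 : (encNat c).size ≤ 4 * c.size + 1 := esize_nat_le c
  have h2 : c.size ≤ 3 := Nat.size_le.2 (by omega)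
  omega

theorem esize_rterm_const : esize RTerm.zero ≤ 15 ∧ esize RTerm.one ≤ 15 := by
  have h1 := tag_size_le (c := 1) (by omega)
  have h2 := tag_size_le (c := 2) (by omega)
  have h3 : esize RTerm.zero = (encNat 1).size + 1 + 1 := rfl
  have h4 : esize RTerm.one = (encNat 2).size + 1 + 1 := rfl
  omega

theorem esize_add_le (s t : RTerm) : esize (RTerm.add s t) ≤ esize s + esize t + 15 := by
  have h1 := tag_size_le (c := 3) (by omega)
  have h2 : esize (RTerm.add s t) = (encNat 3).size + (esize s + esize t + 1) + 1 := rfl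
  omega

theorem esize_dbl_le (t : RTerm) : esize (RTerm.dbl t) ≤ esize t + 15 := by
  have h1 := tag_size_le (c := 4) (by omega)
  have h2 : esize (RTerm.dbl t) = (encNat 4).size + esize t + 1 := rfl
  omega

theorem esize_le_le (s t : RTerm) : esize (RForm.le s t) ≤ esize s + esize t + 15 := by
  have h1 := tag_size_le (c := 0) (by omega)
  have h2 : esize (RForm.le s t) = (encNat 0).size + (esize s + esize t + 1) + 1 := rfl
  omega

theorem esize_and_le (φ χ : RForm) : esize (RForm.and φ χ) ≤ esize φ + esize χ + 15 := by
  have h1 := tag_size_le (c := 2) (by omega)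
  have h2 : esize (RForm.and φ χ) = (encNat 2).size + (esize φ + esize χ + 1) + 1 := rfl
  omega

theorem esize_or_le (φ χ : RForm) : esize (RForm.or φ χ) ≤ esize φ + esize χ + 15 := by
  have h1 := tag_size_le (c := 3) (by omega)
  have h2 : esize (RForm.or φ χ) = (encNat 3).size + (esize φ + esize χ + 1) + 1 := rfl
  omega

theorem esize_not_le (φ : RForm) : esize (RForm.not φ) ≤ esize φ + 15 := by
  have h1 := tag_size_le (c := 4) (by omega)
  have h2 : esize (RForm.not φ) = (encNat 4).size + esize φ + 1 := rfl
  omega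

namespace PolyTime

section

variable {α : Type} [Enc α]

@[fun_prop]
theorem var {f : α → ℕ} (hf : PolyTime f) : PolyTime (fun a => RTerm.var (f a)) :=
  ((const (enc 0)).pair hf).of_enc_eq fun _ => rfl

@[fun_prop]
theorem add {f g : α → RTerm} (hf : PolyTime f) (hg : PolyTime g) :
    PolyTime (fun a => RTerm.add (f a) (g a)) :=
  ((const (enc 3)).pair (hf.pair hg)).of_enc_eq fun _ => rfl

@[fun_prop]
theorem dbl {f : α → RTerm} (hf : PolyTime f) : PolyTime (fun a => RTerm.dbl (f a)) :=
  ((const (enc 4)).pair hf).of_enc_eq fun _ => rfl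

@[fun_prop]
theorem le {f g : α → RTerm} (hf : PolyTime f) (hg : PolyTime g) :
    PolyTime (fun a => RForm.le (f a) (g a)) :=
  ((const (enc 0)).pair (hf.pair hg)).of_enc_eq fun _ => rfl

@[fun_prop]
theorem formAnd {f g : α → RForm} (hf : PolyTime f) (hg : PolyTime g) :
    PolyTime (fun a => RForm.and (f a) (g a)) :=
  ((const (enc 2)).pair (hf.pair hg)).of_enc_eq fun _ => rfl

@[fun_prop]
theorem formOr {f g : α → RForm} (hf : PolyTime f) (hg : PolyTime g) :
    PolyTime (fun a => RForm.or (f a) (g a)) :=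
  ((const (enc 3)).pair (hf.pair hg)).of_enc_eq fun _ => rfl

@[fun_prop]
theorem formNot {f : α → RForm} (hf : PolyTime f) : PolyTime (fun a => RForm.not (f a)) :=
  ((const (enc 4)).pair hf).of_enc_eq fun _ => rfl

@[fun_prop]
theorem formEq {f g : α → RTerm} (hf : PolyTime f) (hg : PolyTime g) :
    PolyTime (fun a => RForm.eq (f a) (g a)) := by
  unfold RForm.eq
  fun_prop

@[fun_prop]
theorem sum {L : α → List RTerm} (hL : PolyTime L) : PolyTime (fun a => RTerm.sum (L a)) :=
  foldr_of_le hL (const _) (F := fun _ => RTerm.add) (by fun_prop)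
    (K := fun a => esize (L a) + 15) (hL.bounded.add (.const 15)) fun a b g hg => by
      have := esize_add_le g b
      have := esize_lt_of_mem hg
      omega

@[fun_prop]
theorem conj {L : α → List RForm} (hL : PolyTime L) : PolyTime (fun a => RForm.conj (L a)) :=
  foldr_of_le hL (const _) (F := fun _ => RForm.and) (by fun_prop)
    (K := fun a => esize (L a) + 15) (hL.bounded.add (.const 15)) fun a b g hg => by
      have := esize_and_le g b
      have := esize_lt_of_mem hg
      omega

@[fun_prop]
theorem disj {L : α → List RForm} (hL : PolyTime L) : PolyTime (fun a => RForm.disj (L a)) :=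
  foldr_of_le hL (const _) (F := fun _ => RForm.or) (by fun_prop)
    (K := fun a => esize (L a) + 15) (hL.bounded.add (.const 15)) fun a b g hg => by
      have := esize_or_le g b
      have := esize_lt_of_mem hg
      omega

@[fun_prop]
theorem mulBits {L : α → List Bool} {t : α → RTerm} (hL : PolyTime L) (ht : PolyTime t) :
    PolyTime (fun a => RTerm.mulBits (L a) (t a)) :=
  foldr_of_le hL (const _)
    (F := fun a b s => RTerm.add (RTerm.dbl s) (if b then t a else RTerm.zero)) (by fun_prop)
    (K := fun a => esize (t a) + 50) (ht.bounded.add (.const 50)) fun a s b hb => by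
      have := esize_add_le (.dbl s) (if b then t a else .zero)
      have := esize_dbl_le s
      have := esize_rterm_const.1
      have : esize (if b then t a else RTerm.zero) ≤ esize (t a) + 15 := by split <;> omega
      omega

@[fun_prop]
theorem indTerm {b : α → Bool} (hb : PolyTime b) : PolyTime (fun a => indTerm (b a)) := by
  unfold Parikh.indTerm
  fun_prop

theorem countTerm {p : α → GEdge → Bool} {EV : α → List (GEdge × ℕ)}
    (hp : PolyTime (fun x : α × GEdge => p x.1 x.2)) (hEV : PolyTime EV) :
    PolyTime (fun a => countTerm (p a) (EV a)) := by
  refine sum (map (filter hEV ?_) (by fun_prop))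
  exact hp.comp (g := fun x : α × GEdge × ℕ => (x.1, x.2.1)) (by fun_prop)

theorem nodeForm {EV : α → List (GEdge × ℕ)} {v : α → ℕ} (hEV : PolyTime EV) (hv : PolyTime v) :
    PolyTime (fun a => nodeForm (EV a) (v a)) := by
  have h1 : PolyTime (fun a => Parikh.countTerm (fun e => decide (e.1 = v a)) (EV a)) :=
    countTerm (p := fun a e => decide (e.1 = v a)) (by fun_prop) hEV
  have h2 : PolyTime (fun a => Parikh.countTerm (fun e => decide (e.2.2 = v a)) (EV a)) :=
    countTerm (p := fun a e => decide (e.2.2 = v a)) (by fun_prop) hEV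
  have h3 : PolyTime (fun a => ((EV a).filter fun e => decide (e.1.2.2 = v a)).map fun e =>
        RForm.and (.le .one (.var e.2)) (.le (.add .one (.var (e.1.1 + 1))) (.var (v a + 1)))) :=
    map (filter hEV (by fun_prop)) (by fun_prop)
  unfold Parikh.nodeForm
  fun_prop

@[fun_prop]
theorem natAbs_bits {f : α → ℤ} (hf : PolyTime f) : PolyTime (fun a => (f a).natAbs.bits) :=
  (snd (α := Bool) (β := ℕ)).bits.comp
    (f := fun x : Bool × ℕ => x.2.bits) (g := fun a => (decide (f a < 0), (f a).natAbs))
    (hf.of_enc_eq fun _ => rfl)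

@[fun_prop]
theorem decide_neg {f : α → ℤ} (hf : PolyTime f) : PolyTime (fun a => decide (f a < 0)) :=
  (fst (α := Bool) (β := ℕ)).comp (g := fun a => (decide (f a < 0), (f a).natAbs))
    (hf.of_enc_eq fun _ => rfl)

theorem weightTerms {bits : ℤ → List Bool} {EV : α → List (GEdge × ℕ)} {i : α → Dat}
    (hbits : PolyTime bits) (hEV : PolyTime EV) (hi : PolyTime i) :
    PolyTime (fun a => weightTerms bits (EV a) (i a)) := by
  refine flatMap hEV (map (filter (by fun_prop) (by fun_prop)) (by fun_prop))

theorem substTerms {EV : α → List (GEdge × ℕ)} {tab : α → List ((Dat × ℕ) × ℕ)} {i : α → Dat}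
    (hEV : PolyTime EV) (htab : PolyTime tab) (hi : PolyTime i) :
    PolyTime (fun a => substTerms (EV a) (tab a) (i a)) := by
  have h1 := weightTerms (bits := posBits) (by unfold posBits; fun_prop) hEV hi
  have h2 := weightTerms (bits := negBits) (by unfold negBits; fun_prop) hEV hi
  have h3 : PolyTime (fun a => ((tab a).filter fun r => decide (enc r.1.2 = i a)).map fun r =>
      RTerm.var r.2) := map (filter htab (by fun_prop)) (by fun_prop)
  unfold Parikh.substTerms
  fun_prop

theorem trailForm {nodes : α → List ℕ} {EV : α → List (GEdge × ℕ)} {χ : α → RForm}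
    (hn : PolyTime nodes) (hEV : PolyTime EV) (hχ : PolyTime χ) :
    PolyTime (fun a => trailForm (nodes a) (EV a) (χ a)) := by
  have h1 : PolyTime (fun a => (nodes a).map (Parikh.nodeForm (EV a))) :=
    map hn (nodeForm (by fun_prop) (by fun_prop))
  have h2 : PolyTime (fun a => (EV a).map fun e => RForm.le .zero (.var e.2)) :=
    map hEV (by fun_prop)
  have h3 : PolyTime (fun a => Parikh.countTerm (fun _ => true) (EV a)) :=
    countTerm (p := fun _ _ => true) (by fun_prop) hEV
  unfold Parikh.trailForm
  fun_prop

theorem edges {sts : α → List StateData} (hs : PolyTime sts) :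
    PolyTime (fun a => edges (sts a)) := by
  have h1 : PolyTime (fun a => startEdges (sts a)) :=
    flatMap (by fun_prop) (ite (by fun_prop)
      (flatMap (by fun_prop) (map (by fun_prop) (by fun_prop))) (by fun_prop))
  have h2 : PolyTime (fun a => innerEdges (sts a)) :=
    flatMap (by fun_prop) (flatMap (by fun_prop)
      (flatMap (by fun_prop) (map (by fun_prop) (by fun_prop))))
  have h3 : PolyTime (fun a => acceptingNodes (sts a)) :=
    map (filter (by fun_prop) (by fun_prop)) (by fun_prop)
  have h4 : PolyTime (fun a => endEdges (sts a)) := by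
    refine flatMap (by fun_prop) (flatMap (filter (by fun_prop) ?_)
      (map (by fun_prop) (by fun_prop)))
    exact any (h3.comp (by fun_prop)) (by fun_prop)
  unfold Parikh.edges
  fun_prop

theorem nodes {sts : α → List StateData} (hs : PolyTime sts) :
    PolyTime (fun a => nodes (sts a)) := by
  have h1 : PolyTime (fun a => ((sts a).zipIdx 2).map fun s => s.2) :=
    map (by fun_prop) (by fun_prop)
  unfold Parikh.nodes
  fun_prop

end

end PolyTime

/-- The intermediate results of the substitution at a tree: the tree as a term, as a pair of terms,
as a formula and as a pair of formulas. The readings as pairs are needed as the two children of a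
binary node are encoded in a tree of their own. -/
abbrev SubstVal : Type :=
  (RTerm × RTerm) × ((RTerm × RTerm) × (RTerm × RTerm)) × RForm × (RForm × RForm)

/-- The value at `nil`, which is never read as a term or formula and is therefore arbitrary. -/
def substNil : SubstVal :=
  ((.zero, .zero), ((.zero, .zero), (.zero, .zero)), .le .zero .zero,
    (.le .zero .zero, .le .zero .zero))

/-- The reading of `cons a b` as a term with the tag `a`, from the results `y` at `b`. -/
noncomputable def substTermStep (σ : Dat → RTerm × RTerm) (a b : Dat) (y : SubstVal) :
    RTerm × RTerm :=
  if decide (a = encNat 0) then σ b else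
  if decide (a = encNat 1) then (.zero, .zero) else
  if decide (a = encNat 2) then (.one, .zero) else
  if decide (a = encNat 3) then (.add y.2.1.1.1 y.2.1.2.1, .add y.2.1.1.2 y.2.1.2.2) else
  (.dbl y.1.1, .dbl y.1.2)

/-- The reading of `cons a b` as a formula with the tag `a`, from the results `y` at `b`. An
inequality `s ≤ t` between differences of terms becomes one between sums. -/
noncomputable def substFormStep (a : Dat) (y : SubstVal) : RForm :=
  if decide (a = encNat 0) then
    .le (.add y.2.1.1.1 y.2.1.2.2) (.add y.2.1.2.1 y.2.1.1.2) else
  if decide (a = encNat 1) then y.2.2.1 else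
  if decide (a = encNat 2) then .and y.2.2.2.1 y.2.2.2.2 else
  if decide (a = encNat 3) then .or y.2.2.2.1 y.2.2.2.2 else
  .not y.2.2.1

/-- The substitution on encodings, as a recursion on trees. -/
noncomputable def substDat (σ : Dat → RTerm × RTerm) : Dat → SubstVal :=
  Dat.fold substNil fun a b x y =>
    (substTermStep σ a b y, (x.1, y.1), substFormStep a y, (x.2.2.1, y.2.2.1))

theorem encNat_inj {i j : ℕ} : encNat i = encNat j ↔ i = j := enc_nat_inj

theorem substDat_cons (σ : Dat → RTerm × RTerm) (a b : Dat) :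
    substDat σ (.cons a b) = (substTermStep σ a b (substDat σ b),
      ((substDat σ a).1, (substDat σ b).1), substFormStep a (substDat σ b),
      ((substDat σ a).2.2.1, (substDat σ b).2.2.1)) := rfl

theorem substDat_term (σ : Dat → RTerm × RTerm) {n : ℕ} (t : Term n) :
    (substDat σ t.encode).1 = t.subst fun i => σ (enc i) := by
  induction t with
  | var i => simp [Term.encode, substDat_cons, substTermStep, Term.subst]; rfl
  | zero => simp [Term.encode, substDat_cons, substTermStep, Term.subst, encNat_inj]
  | one => simp [Term.encode, substDat_cons, substTermStep, Term.subst, encNat_inj]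
  | add s t hs ht =>
    simp [Term.encode, substDat_cons, substTermStep, Term.subst, encNat_inj, hs, ht]
  | dbl t ht => simp [Term.encode, substDat_cons, substTermStep, Term.subst, encNat_inj, ht]

theorem substDat_form (σ : Dat → RTerm × RTerm) {n : ℕ} (φ : Formula n) :
    (substDat σ φ.encode).2.2.1 = φ.subst fun i => σ (enc i) := by
  induction φ with
  | le s t =>
    simp [Formula.encode, substDat_cons, substFormStep, Formula.subst, substDat_term]
  | ex φ h => simp [Formula.encode, substDat_cons, substFormStep, Formula.subst, encNat_inj, h]
  | and φ χ h h' =>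
    simp [Formula.encode, substDat_cons, substFormStep, Formula.subst, encNat_inj, h, h']
  | or φ χ h h' =>
    simp [Formula.encode, substDat_cons, substFormStep, Formula.subst, encNat_inj, h, h']
  | not φ h => simp [Formula.encode, substDat_cons, substFormStep, Formula.subst, encNat_inj, h]

/-- The substitution increases the size of an encoding by at most a factor that depends on the
substituted terms. -/
theorem esize_substDat_le {σ : Dat → RTerm × RTerm} {S m : ℕ}
    (hσ : ∀ b, b.size ≤ m → esize (σ b) ≤ S) (t : Dat) (ht : t.size ≤ m) :
    esize (substDat σ t).1 ≤ (S + 150) * t.size ∧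
    esize (substDat σ t).2.1 ≤ (S + 150) * t.size ∧
    esize (substDat σ t).2.2.1 ≤ (S + 150) * t.size ∧
    esize (substDat σ t).2.2.2 ≤ (S + 150) * t.size := by
  have h0 := esize_rterm_const.1
  have h1 := esize_rterm_const.2
  have hle := esize_le_le .zero .zero
  induction t with
  | nil =>
    simp only [substDat, Dat.fold, substNil, Dat.size, mul_one, esize_pair]
    omega
  | cons a b ha hb =>
    simp only [Dat.size] at ht ⊢
    obtain ⟨a1, a2, a3, a4⟩ := ha (by omega)
    obtain ⟨b1, b2, b3, b4⟩ := hb (by omega)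
    have hS := hσ b (by omega)
    rw [mul_add, mul_add, mul_one]
    rw [substDat_cons]
    generalize substDat σ a = x at *
    generalize substDat σ b = y at *
    obtain ⟨x1, x2, x3, x4⟩ := x
    obtain ⟨⟨y1, y2⟩, ⟨⟨y3, y4⟩, ⟨y5, y6⟩⟩, y7, y8, y9⟩ := y
    dsimp only at a1 a2 a3 a4 b1 b2 b3 b4 ⊢
    simp only [esize_pair] at b1 b2 b3 b4
    refine ⟨?_, ?_, ?_, ?_⟩
    · have h2 := esize_add_le y3 y5
      have h3 := esize_add_le y4 y6
      have h4 := esize_dbl_le y1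
      have h5 := esize_dbl_le y2
      simp only [substTermStep]
      split_ifs <;> (try simp only [esize_pair]) <;> omega
    · simp only [esize_pair]
      omega
    · have h2 := esize_add_le y3 y6
      have h3 := esize_add_le y5 y4
      have h4 := esize_le_le (.add y3 y6) (.add y5 y4)
      have h5 := esize_and_le y8 y9
      have h6 := esize_or_le y8 y9
      have h7 := esize_not_le y7
      simp only [substFormStep]
      split_ifs <;> omega
    · rw [esize_pair]
      omega

theorem PolyTime.substDat {α : Type} [Enc α] {σ : α → Dat → RTerm × RTerm} {D : α → Dat}
    (hσ : PolyTime (fun x : α × Dat => σ x.1 x.2)) (hD : PolyTime D) :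
    PolyTime (fun a => substDat (σ a) (D a)) := by
  obtain ⟨c, hc⟩ := hσ.bounded
  refine datFold hD (const _) (G := fun s a b x y =>
    (substTermStep (σ s) a b y, (x.1, y.1), substFormStep a y, (x.2.2.1, y.2.2.1))) ?_
    (B := fun a => 4 * ((c * (esize a + esize (D a) + 1) ^ c + 150) * esize (D a)) + 3) ?_ ?_
  · have := hσ.comp (g := fun x : α × Dat × Dat × SubstVal × SubstVal => (x.1, x.2.2.1))
      (by fun_prop)
    dsimp only at this
    unfold substTermStep substFormStep
    fun_prop
  · have h1 := ((PolyBounded.esize_self.add hD.bounded).add (.const 1)).pow c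
    exact ((PolyBounded.const 4).mul
      ((((PolyBounded.const c).mul h1).add (.const 150)).mul hD.bounded)).add (.const 3)
  · intro a t ht
    have h1 := esize_substDat_le (σ := σ a) (m := esize (D a))
      (S := c * (esize a + esize (D a) + 1) ^ c) (fun b hb => by
        refine (hc (a, b)).trans (Nat.mul_le_mul_left _ (Nat.pow_le_pow_left ?_ _))
        rw [esize_pair]
        have : esize b = b.size := rfl
        omega) t ht
    have h2 := Nat.mul_le_mul_left (c * (esize a + esize (D a) + 1) ^ c + 150)
      (show t.size ≤ esize (D a) from ht)
    change esize (Parikh.substDat (σ a) t) ≤ _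
    generalize Parikh.substDat (σ a) t = y at h1
    obtain ⟨y1, y2, y3, y4⟩ := y
    dsimp only at h1
    simp only [esize_pair]
    omega

/-- The leading existential quantifiers of an encoded formula, as a list of as many trees. -/
noncomputable def exPrefix : Dat → List Dat :=
  Dat.fold [] fun a _ _ y => if decide (a = encNat 1) then .nil :: y else []

theorem exPrefix_cons (a b : Dat) :
    exPrefix (.cons a b) = if decide (a = encNat 1) then .nil :: exPrefix b else [] := rfl

theorem length_exPrefix {n : ℕ} (φ : Formula n) : (exPrefix φ.encode).length = φ.exDepth := by
  induction φ with
  | ex φ h =>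
    simp [Formula.encode, exPrefix_cons, Formula.exDepth, h]
  | _ => simp [Formula.encode, exPrefix_cons, Formula.exDepth, encNat_inj]

@[fun_prop]
theorem PolyTime.exPrefix {α : Type} [Enc α] {D : α → Dat} (hD : PolyTime D) :
    PolyTime (fun a => exPrefix (D a)) := by
  refine datFold hD (const _)
    (G := fun _ a _ _ y => if decide (a = encNat 1) then Dat.nil :: y else []) (by fun_prop)
    (B := fun a => 2 * esize (D a)) ((PolyBounded.const 2).mul hD.bounded) fun a t ht => ?_
  have h : ∀ t : Dat, esize (Parikh.exPrefix t) ≤ 2 * t.size := by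
    intro t
    induction t with
    | nil => exact le_add_self
    | cons a b _ hb =>
      have : esize Dat.nil = 1 := rfl
      rw [exPrefix_cons, Dat.size]
      split
      · rw [esize_cons]
        omega
      · rw [esize_nil]
        omega
  exact (h t).trans (Nat.mul_le_mul_left _ ht)

/-- The edges of the graph with their variables. -/
def edgeVars (sts : List StateData) : List (GEdge × ℕ) :=
  (edges sts).zipIdx (1 + (nodes sts).length)

/-- The bound variables of the acceptance constraint with the variables that replace them. -/
noncomputable def boundVars (x : InputData) : List ((Dat × ℕ) × ℕ) :=
  ((exPrefix x.2.2.1).zipIdx x.1).zipIdx (1 + (nodes x.2.1).length + (edges x.2.1).length)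

/-- The matrix of the formula for the lengths of words. -/
noncomputable def lengthMatrix (x : InputData) : RForm :=
  trailForm (nodes x.2.1) (edgeVars x.2.1)
    (substDat (substTerms (edgeVars x.2.1) (boundVars x)) x.2.2.1).2.2.1

/-- A list of as many trees as the formula for the lengths of words has quantifiers. -/
noncomputable def lengthPrefix (x : InputData) : List Dat :=
  (nodes x.2.1).map enc ++ (edges x.2.1).map enc ++ exPrefix x.2.2.1

/-- The encoding of the list that consists of the formula for the lengths of words. -/
noncomputable def lengthFormulas (x : InputData) : List Dat :=
  [(lengthPrefix x).foldr (fun _ D => .cons (encNat 1) D) (enc (lengthMatrix x))]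

theorem polyTime_lengthFormulas : PolyTime lengthFormulas := by
  have h1 : PolyTime (fun x : InputData => nodes x.2.1) := .nodes (by fun_prop)
  have h2 : PolyTime (fun x : InputData => edges x.2.1) := .edges (by fun_prop)
  have h3 : PolyTime (fun x : InputData => edgeVars x.2.1) := by
    unfold edgeVars
    fun_prop
  have h4 : PolyTime boundVars := by
    unfold boundVars
    fun_prop
  have h5 : PolyTime lengthMatrix := by
    have h5 : PolyTime (fun x : InputData × Dat => edgeVars x.1.2.1) :=
      h3.comp (g := fun x : InputData × Dat => x.1) .fst
    have h6 : PolyTime (fun x : InputData × Dat => boundVars x.1) :=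
      h4.comp (g := fun x : InputData × Dat => x.1) .fst
    have h7 := PolyTime.substDat (σ := fun x => substTerms (edgeVars x.2.1) (boundVars x))
      (D := fun x : InputData => x.2.2.1) (.substTerms h5 h6 .snd) (by fun_prop)
    exact .trailForm h1 h3 (PolyTime.fst.comp (PolyTime.snd.comp (PolyTime.snd.comp h7)))
  have h6 : PolyTime lengthPrefix := by
    have h7 : PolyTime (fun x : InputData => (nodes x.2.1).map enc) := .map h1 (by fun_prop)
    have h8 : PolyTime (fun x : InputData => (edges x.2.1).map enc) := .map h2 (by fun_prop)
    unfold lengthPrefix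
    fun_prop
  have h7 : PolyTime (fun x =>
      (lengthPrefix x).foldr (fun _ D => Dat.cons (encNat 1) D) (enc (lengthMatrix x))) :=
    .foldr_of_le h6 (by fun_prop) (F := fun _ _ D => Dat.cons (encNat 1) D) (by fun_prop)
      (K := fun _ => 14) (.const 14) fun a b g _ => by
        have h8 := tag_size_le (c := 1) (by omega)
        have h9 : esize (Dat.cons (encNat 1) b) = (encNat 1).size + esize b + 1 := rfl
        omega
  unfold lengthFormulas
  fun_prop

/-! ### Scope and size of the formula -/

theorem mem_edgeVars {E : List GEdge} {s : ℕ} {e : GEdge × ℕ} (he : e ∈ E.zipIdx s) :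
    e.1 ∈ E ∧ e.2 < s + E.length := by
  obtain ⟨e, i⟩ := e
  exact ⟨List.fst_mem_of_mem_zipIdx he, (List.mem_zipIdx he).2.1⟩

section

variable {EV : List (GEdge × ℕ)} {tab : List ((Dat × ℕ) × ℕ)} {m : ℕ}

theorem below_countTerm (hEV : ∀ e ∈ EV, e.2 < m) (p : GEdge → Bool) :
    (countTerm p EV).Below m := by
  refine RTerm.below_sum fun t ht => ?_
  obtain ⟨e, he, rfl⟩ := List.mem_map.1 ht
  exact hEV e (List.mem_of_mem_filter he)

theorem below_indTerm (b : Bool) : (indTerm b).Below m := by cases b <;> trivial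

theorem below_nodeForm (hEV : ∀ e ∈ EV, e.2 < m ∧ e.1.1 + 1 < m) {v : ℕ} (hv : v + 1 < m) :
    (nodeForm EV v).Below m := by
  have h := below_countTerm fun e he => (hEV e he).1
  refine ⟨RForm.below_eq ⟨h _, below_indTerm _⟩ ⟨h _, below_indTerm _⟩, ?_,
    RForm.below_disj fun φ hφ => ?_⟩
  · split
    · exact ⟨trivial, trivial⟩
    · exact ⟨h _, trivial⟩
  · obtain ⟨e, he, rfl⟩ := List.mem_map.1 hφ
    have := hEV e (List.mem_of_mem_filter he)
    exact ⟨⟨trivial, this.1⟩, ⟨trivial, this.2⟩, hv⟩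

theorem below_weightTerms (hEV : ∀ e ∈ EV, e.2 < m) (bits : ℤ → List Bool) (i : Dat) :
    ∀ t ∈ weightTerms bits EV i, t.Below m := by
  intro t ht
  obtain ⟨e, he, ht⟩ := List.mem_flatMap.1 ht
  obtain ⟨c, -, rfl⟩ := List.mem_map.1 ht
  exact RTerm.below_mulBits (hEV e he)

theorem below_substTerms (hEV : ∀ e ∈ EV, e.2 < m) (htab : ∀ r ∈ tab, r.2 < m) (i : Dat) :
    (substTerms EV tab i).1.Below m ∧ (substTerms EV tab i).2.Below m := by
  refine ⟨RTerm.below_sum fun t ht => ?_, RTerm.below_sum (below_weightTerms hEV _ _)⟩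
  rcases List.mem_append.1 ht with ht | ht
  · exact below_weightTerms hEV _ _ t ht
  · obtain ⟨r, hr, rfl⟩ := List.mem_map.1 ht
    exact htab r (List.mem_of_mem_filter hr)

theorem below_trailForm {nodes : List ℕ} {χ : RForm} (hm : 0 < m)
    (hEV : ∀ e ∈ EV, e.2 < m ∧ e.1.1 + 1 < m) (hn : ∀ v ∈ nodes, v + 1 < m) (hχ : χ.Below m) :
    (trailForm nodes EV χ).Below m := by
  refine RForm.below_conj fun φ hφ => ?_
  simp only [List.mem_append, List.mem_map, List.mem_cons, List.not_mem_nil, or_false] at hφ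
  rcases hφ with (⟨v, hv, rfl⟩ | ⟨e, he, rfl⟩) | rfl | rfl
  · exact below_nodeForm hEV (hn v hv)
  · exact ⟨trivial, (hEV e he).1⟩
  · exact RForm.below_eq ⟨trivial, trivial, hm⟩ (below_countTerm (fun e he => (hEV e he).1) _)
  · exact hχ

theorem size_countTerm_le (p : GEdge → Bool) : (countTerm p EV).size ≤ 2 * EV.length + 1 := by
  have h1 : (countTerm p EV).size ≤ _ := RTerm.size_sum_le (K := 1) fun t ht => by
    obtain ⟨e, -, rfl⟩ := List.mem_map.1 ht
    exact le_rfl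
  rw [List.length_map] at h1
  have h2 := List.length_filter_le (fun e => p e.1) EV
  omega

theorem size_indTerm (b : Bool) : (indTerm b).size = 1 := by cases b <;> rfl

theorem size_nodeForm_le (v : ℕ) : (nodeForm EV v).size ≤ 20 * EV.length + 30 := by
  have h1 := size_countTerm_le (EV := EV) fun e => decide (e.1 = v)
  have h2 := size_countTerm_le (EV := EV) fun e => decide (e.2.2 = v)
  have h3 : (RForm.disj ((EV.filter fun e => decide (e.1.2.2 = v)).map fun e =>
      RForm.and (.le .one (.var e.2)) (.le (.add .one (.var (e.1.1 + 1))) (.var (v + 1))))).size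
      ≤ _ := RForm.size_disj_le (K := 9) fun t ht => by
    obtain ⟨e, -, rfl⟩ := List.mem_map.1 ht
    exact le_rfl
  rw [List.length_map] at h3
  have h4 := List.length_filter_le (fun e => decide (e.1.2.2 = v)) EV
  simp only [nodeForm, RForm.eq, RForm.size, RTerm.size, size_indTerm]
  split <;> simp only [RForm.size, RTerm.size] <;> omega

theorem size_substTerms_le {L : ℕ} (hL : ∀ e ∈ EV, ∀ c ∈ e.1.2.1, c.natAbs.size ≤ L) (i : ℕ) :
    (substTerms EV tab (enc i)).1.size ≤ (EV.length + tab.length) * (4 * L + 2) + 1 ∧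
      (substTerms EV tab (enc i)).2.size ≤ (EV.length + tab.length) * (4 * L + 2) + 1 := by
  have hlen : ∀ bits, (weightTerms bits EV (enc i)).length ≤ EV.length := by
    intro bits
    simp only [weightTerms, enc_nat_inj, filter_zipIdx, Nat.zero_le, if_true, Nat.sub_zero]
    clear hL
    induction EV with
    | nil => simp
    | cons e EV ih =>
      rw [List.flatMap_cons, List.length_append, List.length_cons, List.length_map]
      have : ((e.1.2.1[i]?.map fun g => (g, i)).toList).length ≤ 1 := by
        cases e.1.2.1[i]? <;> simp
      omega
  have hsize : ∀ bits : ℤ → List Bool, (∀ c, (bits c).length ≤ c.natAbs.size) →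
      ∀ t ∈ weightTerms bits EV (enc i), t.size ≤ 4 * L + 1 := by
    intro bits hbits t ht
    obtain ⟨e, he, ht⟩ := List.mem_flatMap.1 ht
    obtain ⟨c, hc, rfl⟩ := List.mem_map.1 ht
    have h1 := hL e he c.1 (List.fst_mem_of_mem_zipIdx (List.mem_of_mem_filter hc))
    have h2 := hbits c.1
    have h3 := RTerm.size_mulBits_le (bits c.1) (.var e.2)
    simp only [RTerm.size] at h3
    omega
  have hpos : ∀ c, (posBits c).length ≤ c.natAbs.size := fun c => by
    rw [posBits]
    split
    · simp
    · rw [Nat.size_eq_bits_len]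
  have hneg : ∀ c, (negBits c).length ≤ c.natAbs.size := fun c => by
    rw [negBits]
    split
    · rw [Nat.size_eq_bits_len]
    · simp
  constructor
  · refine (RTerm.size_sum_le (K := 4 * L + 1) fun t ht => ?_).trans
      (Nat.succ_le_succ (Nat.mul_le_mul_right _ ?_))
    · rcases List.mem_append.1 ht with ht | ht
      · exact hsize _ hpos t ht
      · obtain ⟨r, -, rfl⟩ := List.mem_map.1 ht
        simp [RTerm.size]
    · rw [List.length_append, List.length_map]
      have h1 := hlen posBits
      have h2 := List.length_filter_le (fun r : (Dat × ℕ) × ℕ => decide (enc r.1.2 = enc i)) tab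
      omega
  · refine (RTerm.size_sum_le (K := 4 * L + 1) (hsize _ hneg)).trans
      (Nat.succ_le_succ (Nat.mul_le_mul_right _ ?_))
    have h1 := hlen negBits
    omega

theorem size_trailForm_le (nodes : List ℕ) (χ : RForm) :
    (trailForm nodes EV χ).size ≤
      (nodes.length + EV.length + 2) * (20 * EV.length + 31 + χ.size) + 3 := by
  refine (RForm.size_conj_le (K := 20 * EV.length + 30 + χ.size) fun φ hφ => ?_).trans ?_
  · simp only [List.mem_append, List.mem_map, List.mem_cons, List.not_mem_nil, or_false] at hφ
    rcases hφ with (⟨v, hv, rfl⟩ | ⟨e, he, rfl⟩) | rfl | rfl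
    · exact (size_nodeForm_le v).trans (Nat.le_add_right _ _)
    · simp only [RForm.size, RTerm.size]
      omega
    · have := size_countTerm_le (EV := EV) fun _ => true
      simp only [RForm.eq, RForm.size, RTerm.size]
      omega
    · exact Nat.le_add_left _ _
  · simp only [List.length_append, List.length_map, List.length_cons, List.length_nil]
    exact le_of_eq (by ring)

end

namespace TwoPA

variable {n k d : ℕ} (P : TwoPA (Fin n) (Fin k) d)

theorem nodup_edges : (edges P.states).Nodup := nodup_distinct _

theorem length_nodes : (nodes P.states).length = n + 2 := by simp [nodes, states]

/-- The input of the program as decoded data. -/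
def input : InputData := (d, P.states, P.ψ.encode, ())

theorem lengthMatrix_input : lengthMatrix P.input =
    trailForm (nodes P.states) ((edges P.states).zipIdx (n + 3)) (P.ψ.subst fun i =>
      substTerms ((edges P.states).zipIdx (n + 3))
        (((exPrefix P.ψ.encode).zipIdx d).zipIdx (n + 3 + (edges P.states).length)) (enc i)) := by
  change trailForm _ _ (substDat _ P.ψ.encode).2.2.1 = _
  rw [substDat_form, edgeVars, boundVars]
  simp only [input, length_nodes, show 1 + (n + 2) = n + 3 by ring]

theorem length_lengthPrefix : (lengthPrefix P.input).length =
    n + 2 + (edges P.states).length + P.ψ.exDepth := by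
  simp [lengthPrefix, input, length_nodes, length_exPrefix, add_assoc]

theorem below_lengthMatrix :
    (lengthMatrix P.input).Below (1 + (lengthPrefix P.input).length) := by
  rw [lengthMatrix_input, length_lengthPrefix]
  have hEV : ∀ e ∈ (edges P.states).zipIdx (n + 3),
      e.2 < n + 3 + (edges P.states).length ∧ e.1.1 < n + 2 := fun e he =>
    ⟨(mem_edgeVars he).2, (P.of_mem_edges (mem_edgeVars he).1).1⟩
  refine below_trailForm (by omega) (fun e he => ?_) (fun v hv => ?_)
    (Formula.below_subst (fun i => below_substTerms (fun e he => ?_) (fun r hr => ?_) _) _)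
  · have := hEV e he
    omega
  · have := (P.mem_nodes v).1 hv
    omega
  · have := hEV e he
    omega
  · obtain ⟨r, i⟩ := r
    have := (List.mem_zipIdx hr).2.1
    rw [List.length_zipIdx, length_exPrefix] at this
    dsimp only
    omega

/-- The existential formula for the lengths of the words in the language. -/
noncomputable def lengthFormula : Formula 1 :=
  (lengthMatrix P.input).exClosure (lengthPrefix P.input).length 1

theorem isExistential_lengthFormula : P.lengthFormula.IsExistential :=
  RForm.exClosure_isExistential _ _ _

theorem encode_lengthFormula :
    enc (lengthFormulas P.input) = encList ([P.lengthFormula].map Formula.encode) := by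
  rw [List.map_singleton, lengthFormula, RForm.exClosure_encode P.below_lengthMatrix rfl]
  rfl

variable {P} in
theorem holds_lengthFormula (hP : P.IsOneWay) (ℓ : ℕ) :
    P.lengthFormula.Holds (fun _ => (ℓ : ℤ)) ↔ ∃ w ∈ P.language, w.length = ℓ := by
  rw [exists_mem_language_iff hP, ← exists_holds_trailForm_iff P.mem_nodes P.nodup_edges
    (fun e he => ⟨(P.of_mem_edges he).1, (P.of_mem_edges he).2.1, (P.of_mem_edges he).2.2.1⟩)
    P.ψ_existential (length_exPrefix P.ψ), lengthFormula,
    RForm.exClosure_holds P.below_lengthMatrix, lengthMatrix_input]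
  simp

/-- An edge is determined by its end points and its weight vector. -/
theorem length_edges_le : (edges P.states).length ≤ (n + 2) * (P.numWeights * (n + 2)) := by
  classical
  rw [← List.toFinset_card_of_nodup P.nodup_edges]
  have h : (edges P.states).toFinset ⊆ Finset.range (n + 2) ×ˢ
      ((P.weights.image fun v => List.ofFn v) ×ˢ Finset.range (n + 2)) := by
    intro e he
    obtain ⟨h1, -, h2, t, ht, h3⟩ := P.of_mem_edges (List.mem_toFinset.1 he)
    simp only [Finset.mem_product, Finset.mem_range, Finset.mem_image]
    exact ⟨h1, ⟨_, Finset.mem_image_of_mem _ ht, h3.symm⟩, h2⟩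
  refine (Finset.card_le_card h).trans ?_
  rw [Finset.card_product, Finset.card_product, Finset.card_range]
  gcongr
  exact Finset.card_image_le

/-- The size of the formula, if `T` bounds the number of states, the size of the acceptance
constraint, the number of edges (up to a factor) and the bit lengths of the weights. Neither the
alphabet nor the dimension occurs in the bound. -/
theorem size_lengthFormula_le {T : ℕ} (hn : n ≤ T) (hψ : P.ψ.size ≤ T)
    (hE : (edges P.states).length ≤ 9 * T)
    (hL : ∀ e ∈ edges P.states, ∀ c ∈ e.2.1, c.natAbs.size ≤ T + 1) :
    P.lengthFormula.size ≤ (10 * T + 4) *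
      (180 * T + 31 + T * (2 * (10 * T * (4 * (T + 1) + 2) + 1 + 2))) + 3 +
        2 * (11 * T + 2) := by
  rw [lengthFormula, RForm.exClosure_size P.below_lengthMatrix, length_lengthPrefix,
    lengthMatrix_input]
  have hr := P.ψ.exDepth_le_size
  refine Nat.add_le_add ((size_trailForm_le _ _).trans (Nat.add_le_add_right
    (Nat.mul_le_mul ?_ (Nat.add_le_add ?_ ((Formula.size_subst_le
      (K := 10 * T * (4 * (T + 1) + 2) + 1) P.ψ_existential fun i _ => ?_).trans ?_))) _)) ?_
  · rw [length_nodes, List.length_zipIdx]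
    omega
  · rw [List.length_zipIdx]
    omega
  · have h1 := size_substTerms_le
      (tab := ((exPrefix P.ψ.encode).zipIdx d).zipIdx (n + 3 + (edges P.states).length))
      (EV := (edges P.states).zipIdx (n + 3)) (fun e he => hL e.1 (mem_edgeVars he).1) i
    rw [List.length_zipIdx, List.length_zipIdx, List.length_zipIdx, length_exPrefix] at h1
    have h2 := Nat.mul_le_mul_right (4 * (T + 1) + 2)
      (show (edges P.states).length + P.ψ.exDepth ≤ 10 * T by omega)
    omega
  · exact Nat.mul_le_mul_right _ hψ
  · omega

end TwoPA

/-! ### Size of the encoding -/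

theorem size_le_self (i : ℕ) : i.size ≤ i := Nat.size_le.2 i.lt_two_pow_self

theorem Term.size_encode_le {n m : ℕ} (h : n ≤ m) (t : Term n) :
    t.encode.size ≤ t.size * (4 * m + 20) := by
  induction t with
  | var i =>
    have h1 := tag_size_le (c := 0) (by omega)
    have h2 : (encNat i).size ≤ _ := esize_nat_le i
    have h3 := size_le_self i
    have h4 := i.2
    simp only [Term.encode, Dat.size, Term.size]
    omega
  | zero =>
    have h1 := tag_size_le (c := 1) (by omega)
    simp only [Term.encode, Dat.size, Term.size]
    omega
  | one =>
    have h1 := tag_size_le (c := 2) (by omega)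
    simp only [Term.encode, Dat.size, Term.size]
    omega
  | add s t hs ht =>
    have h1 := tag_size_le (c := 3) (by omega)
    simp only [Term.encode, Dat.size, Term.size, add_mul]
    omega
  | dbl t ht =>
    have h1 := tag_size_le (c := 4) (by omega)
    simp only [Term.encode, Dat.size, Term.size, add_mul]
    omega

theorem Formula.size_encode_le {n m : ℕ} (φ : Formula n) (h : n + φ.size ≤ m) :
    φ.encode.size ≤ φ.size * (4 * m + 20) := by
  induction φ with
  | le s t =>
    have h1 := tag_size_le (c := 0) (by omega)
    have h2 := s.size_encode_le (m := m) (by omega)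
    have h3 := t.size_encode_le (m := m) (by omega)
    simp only [Formula.encode, Dat.size, Formula.size, add_mul]
    omega
  | ex φ ih =>
    have h1 := tag_size_le (c := 1) (by omega)
    simp only [Formula.size] at h
    have := ih (by omega)
    simp only [Formula.encode, Dat.size, Formula.size, add_mul]
    omega
  | and φ χ ih ih' =>
    have h1 := tag_size_le (c := 2) (by omega)
    simp only [Formula.size] at h
    have := ih (by omega)
    have := ih' (by omega)
    simp only [Formula.encode, Dat.size, Formula.size, add_mul]
    omega
  | or φ χ ih ih' =>
    have h1 := tag_size_le (c := 3) (by omega)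
    simp only [Formula.size] at h
    have := ih (by omega)
    have := ih' (by omega)
    simp only [Formula.encode, Dat.size, Formula.size, add_mul]
    omega
  | not φ ih =>
    have h1 := tag_size_le (c := 4) (by omega)
    simp only [Formula.size] at h
    have := ih (by omega)
    simp only [Formula.encode, Dat.size, Formula.size, add_mul]
    omega

theorem esize_int_le (c : ℤ) : esize c ≤ 4 * c.natAbs.size + 5 := by
  have h1 := esize_bool (decide (c < 0))
  have h2 := esize_nat_le c.natAbs
  have h3 : esize c = esize (decide (c < 0)) + esize c.natAbs + 1 := rfl
  omega

namespace TwoPA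

variable {n k d : ℕ} (P : TwoPA (Fin n) (Fin k) d)

theorem esize_row_le {V : ℕ} (hn : n ≤ V) (hd : d ≤ V)
    (hL : ∀ t ∈ P.Δ, ∀ i, (P.wt t i).natAbs.size ≤ V) (p : Fin n) (a : Letter (Fin k)) :
    esize (P.row p a) ≤ V * (V * (4 * V + 6) + 4) + 1 := by
  have h1 : ∀ c ∈ P.row p a, esize c ≤ V * (4 * V + 6) + 3 := by
    intro c hc
    simp only [row, List.mem_ofFn] at hc
    obtain ⟨q, rfl⟩ := hc
    split
    · rename_i h
      have h2 : esize (P.weightList (p, a, q)) ≤ _ :=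
        esize_le_of_forall (K := 4 * V + 5) fun c hc => by
          simp only [weightList, List.mem_ofFn] at hc
          obtain ⟨i, rfl⟩ := hc
          have := esize_int_le (P.wt (p, a, q) i)
          have := hL _ h i
          omega
      have h3 : (P.weightList (p, a, q)).length = d := by simp [weightList]
      have h4 := Nat.mul_le_mul_right (4 * V + 6) hd
      rw [h3, add_assoc] at h2
      norm_num at h2
      rw [esize_cons, esize_nil]
      omega
    · rw [esize_nil]
      omega
  refine (esize_le_of_forall h1).trans (Nat.succ_le_succ (Nat.mul_le_mul_right _ ?_))
  simpa [row] using hn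

theorem size_encode_le {V : ℕ} (hn : n ≤ V) (hk : k ≤ V) (hd : d ≤ V) (hψ : P.ψ.size ≤ V)
    (hL : ∀ t ∈ P.Δ, ∀ i, (P.wt t i).natAbs.size ≤ V) :
    P.encode.size ≤ 4 * V + (V * ((V + 2) * (V * (V * (4 * V + 6) + 4) + 2) + 30)) +
      V * (8 * V + 20) + 10 := by
  rw [← enc_input]
  change esize (d, P.states, P.ψ.encode, ()) ≤ _
  have hrow := P.esize_row_le hn hd hL
  generalize V * (V * (4 * V + 6) + 4) = R at *
  have h1 : ∀ s ∈ P.states, esize s ≤ (V + 2) * (R + 2) + 29 := by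
    intro s hs
    simp only [states, List.mem_ofFn] at hs
    obtain ⟨p, rfl⟩ := hs
    have h2 : esize (List.ofFn fun a : Fin k => P.row p (.sym a)) ≤ _ :=
      esize_le_of_forall (K := R + 1) fun r hr => by
        simp only [List.mem_ofFn] at hr
        obtain ⟨a, rfl⟩ := hr
        exact hrow p _
    rw [List.length_ofFn, add_assoc, one_add_one_eq_two] at h2
    have h3 := Nat.mul_le_mul_right (R + 2) hk
    have h4 := hrow p .lend
    have h5 := hrow p .rend
    have h6 := esize_bool (decide (p ∈ P.QL))
    have h7 := esize_bool (decide (p ∈ P.QI))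
    have h8 := esize_bool (decide (p ∈ P.QH))
    have h9 := esize_bool (decide (p ∈ P.QF))
    have h10 : esize () = 1 := rfl
    simp only [stateData, esize_pair]
    rw [add_mul]
    omega
  have h2 := esize_le_of_forall h1
  have h3 : P.states.length = n := by simp [states]
  have h4 := Nat.mul_le_mul_right ((V + 2) * (R + 2) + 30) hn
  rw [h3, add_assoc _ 29 1] at h2
  norm_num at h2
  have h5 := esize_nat_le d
  have h6 := size_le_self d
  have h7 : esize P.ψ.encode ≤ _ := P.ψ.size_encode_le (m := 2 * V) (by omega)
  have h8 := Nat.mul_le_mul_right (4 * (2 * V) + 20) hψ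
  have h9 : esize () = 1 := rfl
  simp only [esize_pair]
  rw [show 4 * (2 * V) = 8 * V by ring] at h7 h8
  omega

/-! ### The bounds in terms of the size of the automaton -/

theorem natAbs_le_maxEntry {t : Fin n × Letter (Fin k) × Fin n} (ht : t ∈ P.Δ) (i : Fin d) :
    (P.wt t i).natAbs ≤ P.maxEntry :=
  (Finset.le_sup (f := fun i => (P.wt t i).natAbs) (Finset.mem_univ i)).trans
    (Finset.le_sup (f := fun v : Fin d → ℤ => Finset.univ.sup fun i => (v i).natAbs)
      (Finset.mem_image_of_mem _ ht))

theorem logb_maxEntry_nonneg : 0 ≤ Real.logb 2 (P.maxEntry + 1) :=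
  Real.logb_nonneg (by norm_num) (by simp)

theorem le_size : (n : ℝ) ≤ P.size ∧ (P.ψ.size : ℝ) ≤ P.size ∧
    (P.numWeights : ℝ) * n ^ 2 ≤ P.size ∧
    (P.numWeights : ℝ) * (d * Real.logb 2 (P.maxEntry + 1)) ≤ P.size := by
  have h1 := P.logb_maxEntry_nonneg
  have h2 : (0 : ℝ) ≤ P.numWeights * (d * Real.logb 2 (P.maxEntry + 1)) := by positivity
  have h3 : (0 : ℝ) ≤ P.numWeights * (n : ℝ) ^ 2 := by positivity
  have h4 : (0 : ℝ) ≤ n := by positivity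
  have h5 : (0 : ℝ) ≤ P.ψ.size := by positivity
  rw [size, Fintype.card_fin, mul_add]
  exact ⟨by linarith, by linarith, by linarith, by linarith⟩

theorem one_le_card (P : TwoPA (Fin n) (Fin k) d) : 1 ≤ n := by
  obtain ⟨i⟩ := P.nonempty
  exact i.pos

theorem one_le_size : 1 ≤ P.size :=
  (by exact_mod_cast P.one_le_card : (1 : ℝ) ≤ n).trans P.le_size.1

/-- The bit lengths of the weights are bounded, as the size of an automaton with a transition and of
positive dimension has a summand `logb 2 (maxEntry + 1)`. -/
theorem size_natAbs_le {t : Fin n × Letter (Fin k) × Fin n} (ht : t ∈ P.Δ) (i : Fin d) :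
    ((P.wt t i).natAbs.size : ℝ) ≤ P.size + 1 := by
  have h1 : (P.wt t i).natAbs.size ≤ Nat.log 2 (P.maxEntry + 1) + 1 := by
    rw [Nat.size_le]
    have := Nat.lt_pow_succ_log_self (b := 2) (by norm_num) (P.maxEntry + 1)
    have := P.natAbs_le_maxEntry ht i
    rw [Nat.succ_eq_add_one] at *
    omega
  have h2 : (Nat.log 2 (P.maxEntry + 1) : ℝ) ≤ Real.logb 2 (P.maxEntry + 1) := by
    have := Real.natLog_le_logb (P.maxEntry + 1) 2
    push_cast at this
    exact this
  have h3 : 1 ≤ P.numWeights := Finset.card_pos.2 ⟨_, Finset.mem_image_of_mem _ ht⟩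
  have h4 : 1 ≤ d := i.pos
  have h5 : Real.logb 2 (P.maxEntry + 1) ≤
      P.numWeights * (d * Real.logb 2 (P.maxEntry + 1)) := by
    rw [← mul_assoc]
    refine le_mul_of_one_le_left P.logb_maxEntry_nonneg ?_
    exact_mod_cast Nat.mul_pos h3 h4
  have h6 : ((P.wt t i).natAbs.size : ℝ) ≤ Nat.log 2 (P.maxEntry + 1) + 1 := by
    exact_mod_cast h1
  linarith [P.le_size.2.2.2]

theorem length_edges_le_size : ((edges P.states).length : ℝ) ≤ 9 * P.size := by
  have h1 : (edges P.states).length ≤ 9 * (P.numWeights * n ^ 2) := by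
    refine P.length_edges_le.trans ?_
    have h2 : n + 2 ≤ 3 * n := by have := P.one_le_card; omega
    calc (n + 2) * (P.numWeights * (n + 2)) ≤ (3 * n) * (P.numWeights * (3 * n)) := by gcongr
      _ = _ := by ring
  have h2 : ((edges P.states).length : ℝ) ≤ 9 * (P.numWeights * (n : ℝ) ^ 2) := by
    exact_mod_cast h1
  linarith [P.le_size.2.2.1]

/-- The rounded size of an automaton bounds the quantities on which the formula depends. -/
theorem exists_nat_bound : ∃ T : ℕ, 1 ≤ T ∧ (T : ℝ) ≤ 2 * P.size ∧ n ≤ T ∧ P.ψ.size ≤ T ∧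
    (edges P.states).length ≤ 9 * T ∧ ∀ t ∈ P.Δ, ∀ i, (P.wt t i).natAbs.size ≤ T + 1 := by
  have h0 : P.size ≤ ⌈P.size⌉₊ := Nat.le_ceil _
  have h1 := P.one_le_size
  obtain ⟨h2, h3, -, -⟩ := P.le_size
  refine ⟨⌈P.size⌉₊, by exact_mod_cast h1.trans h0, ?_, by exact_mod_cast h2.trans h0,
    by exact_mod_cast h3.trans h0, ?_, fun t ht i => ?_⟩
  · linarith [Nat.ceil_lt_add_one (zero_le_one.trans h1)]
  · have h4 : ((edges P.states).length : ℝ) ≤ 9 * (⌈P.size⌉₊ : ℝ) := by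
      linarith [P.length_edges_le_size]
    exact_mod_cast h4
  · have h4 : ((P.wt t i).natAbs.size : ℝ) ≤ (⌈P.size⌉₊ : ℝ) + 1 := by
      linarith [P.size_natAbs_le ht i]
    exact_mod_cast h4

/-- The size of the formula is at most a polynomial in the size of the automaton. -/
theorem exists_size_lengthFormula_le : ∃ c : ℕ, ∀ (n k d : ℕ) (P : TwoPA (Fin n) (Fin k) d),
    (P.lengthFormula.size : ℝ) ≤ c * P.size ^ 4 := by
  -- The factor `16 = 2 ^ 4` pays for rounding the size of the automaton.
  refine ⟨16 * 20000, fun n k d P => ?_⟩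
  obtain ⟨T, h1, h2, h3, h4, h5, h6⟩ := P.exists_nat_bound
  have h7 := P.size_lengthFormula_le h3 h4 h5 fun e he c hc => by
    obtain ⟨-, -, -, t, ht, h8⟩ := P.of_mem_edges he
    rw [h8, weightList, List.mem_ofFn] at hc
    obtain ⟨i, rfl⟩ := hc
    exact h6 t ht i
  have h8 : P.lengthFormula.size ≤ 20000 * T ^ 4 := by
    refine h7.trans ?_
    -- As polynomials in `s = T - 1`, the two sides can be compared coefficient by coefficient.
    obtain ⟨s, rfl⟩ := Nat.exists_eq_add_of_le' h1
    ring_nf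
    omega
  calc (P.lengthFormula.size : ℝ) ≤ 20000 * (T : ℝ) ^ 4 := by exact_mod_cast h8
    _ ≤ 20000 * (2 * P.size) ^ 4 := by gcongr
    _ = _ := by push_cast; ring

/-- The size of the input is at most a polynomial in the size of the automaton, the number of
letters and the dimension. -/
theorem exists_size_encode_le : ∃ c : ℕ, ∀ (n k d : ℕ) (P : TwoPA (Fin n) (Fin k) d),
    (P.encode.size : ℝ) ≤ c * (P.size + k + d) ^ 5 := by
  -- The factor `3 ^ 5` pays for rounding the size of the automaton.
  refine ⟨3 ^ 5 * 1000, fun n k d P => ?_⟩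
  obtain ⟨T, h1, h2, h3, h4, -, h6⟩ := P.exists_nat_bound
  have h7 := P.size_encode_le (V := T + 1 + k + d) (by omega) (by omega) (by omega) (by omega)
    fun t ht i => (h6 t ht i).trans (by omega)
  have h8 : P.encode.size ≤ 1000 * (T + 1 + k + d) ^ 5 := by
    refine h7.trans ?_
    obtain ⟨s, hs⟩ : ∃ s, T + 1 + k + d = s + 1 := ⟨T + k + d, by ring⟩
    rw [hs]
    ring_nf
    omega
  have h9 : ((T + 1 + k + d : ℕ) : ℝ) ≤ 3 * (P.size + k + d) := by
    push_cast
    linarith [P.one_le_size, k.cast_nonneg (α := ℝ), d.cast_nonneg (α := ℝ)]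
  calc (P.encode.size : ℝ) ≤ 1000 * ((T + 1 + k + d : ℕ) : ℝ) ^ 5 := by exact_mod_cast h8
    _ ≤ 1000 * (3 * (P.size + k + d)) ^ 5 := by gcongr
    _ = _ := by push_cast; ring

/-- A program computes the formula for the lengths of words in polynomial time. -/
theorem exists_computesIn_lengthFormula : ∃ (p : Prog) (a m : ℕ),
    ∀ (n k d : ℕ) (P : TwoPA (Fin n) (Fin k) d),
      p.ComputesIn P.encode (encList ([P.lengthFormula].map Formula.encode))
        (a * (P.size + k + d) ^ m) := by
  obtain ⟨p, T, hT, hf, hp⟩ := polyTime_lengthFormulas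
  obtain ⟨b, hb⟩ := hT.add hf
  obtain ⟨c, hc⟩ := exists_size_encode_le
  refine ⟨p, b * c ^ b, 5 * b, fun n k d P => ?_⟩
  obtain ⟨t, ht, h⟩ := hp P.input
  rw [encode_lengthFormula] at h
  have h1 : enc P.input = P.encode := P.enc_input
  rw [h1] at h
  refine ⟨t, h, ?_⟩
  have h2 := hb P.input
  have h3 : esize P.input = P.encode.size := congrArg Dat.size h1
  have h4 : esize (lengthFormulas P.input) =
      (encList ([P.lengthFormula].map Formula.encode)).size :=
    congrArg Dat.size P.encode_lengthFormula
  dsimp only at h2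
  rw [h3, h4] at h2
  calc ((t + (encList ([P.lengthFormula].map Formula.encode)).size : ℕ) : ℝ)
      ≤ b * (P.encode.size : ℝ) ^ b := by exact_mod_cast (Nat.add_le_add_right ht _).trans h2
    _ ≤ b * (c * (P.size + k + d) ^ 5) ^ b := by gcongr; exact hc n k d P
    _ = _ := by push_cast; rw [mul_pow, ← pow_mul, mul_assoc]

end TwoPA

/-- A common constant can replace a factor and an exponent. -/
theorem nat_mul_pow_le_mul_pow {x : ℝ} (hx : 1 ≤ x) {a m C : ℕ} (ha : a ≤ C) (hm : m ≤ C) :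
    a * x ^ m ≤ C * x ^ C := by
  have : (a : ℝ) ≤ C := by exact_mod_cast ha
  gcongr

end Parikh

theorem mainTheorem11 :
    ∃ (prog : Parikh.Prog) (C : ℕ),
      ∀ (n k d : ℕ) (P : Parikh.TwoPA (Fin n) (Fin k) d), P.IsOneWay →
        ∃ φs : List (Parikh.Formula 1),
          φs ≠ [] ∧
          (∀ φ ∈ φs, φ.IsExistential) ∧
          (∀ ℓ : ℕ, (Parikh.Formula.disj φs).Holds (fun _ => (ℓ : ℤ)) ↔
            ∃ w ∈ P.language, w.length = ℓ) ∧
          Real.logb 2 φs.length ≤ C * (P.size + Real.logb 2 n) ^ C ∧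
          (∀ φ ∈ φs, (φ.size : ℝ) ≤ C * (P.size + Real.logb 2 n) ^ C) ∧
          prog.ComputesIn P.encode (Parikh.encList (φs.map Parikh.Formula.encode))
            ((2 : ℝ) ^ ((C : ℝ) * (P.numWeights : ℝ) ^ 2 * Real.logb 2 (P.numWeights * n)) *
              (C * (P.size + k + d) ^ C)) := by
  obtain ⟨c, hc⟩ := Parikh.TwoPA.exists_size_lengthFormula_le
  obtain ⟨p, a, m, hp⟩ := Parikh.TwoPA.exists_computesIn_lengthFormula
  refine ⟨p, c + a + m + 4, fun n k d P hP => ⟨[P.lengthFormula], by simp, ?_, fun ℓ => ?_, ?_, ?_,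
    ?_⟩⟩
  · simpa using P.isExistential_lengthFormula
  · exact Parikh.TwoPA.holds_lengthFormula hP ℓ
  all_goals
    have h1 := P.one_le_size
    have h2 : 0 ≤ Real.logb 2 n :=
      Real.logb_nonneg (by norm_num) (by exact_mod_cast P.one_le_card)
  · rw [List.length_singleton, Nat.cast_one, Real.logb_one]
    positivity
  · simp only [List.mem_singleton, forall_eq]
    calc (P.lengthFormula.size : ℝ) ≤ c * P.size ^ 4 := hc n k d P
      _ ≤ c * (P.size + Real.logb 2 n) ^ 4 := by
        gcongr
        linarith
      _ ≤ _ := Parikh.nat_mul_pow_le_mul_pow (by linarith) (by omega) (by omega)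
  · obtain ⟨t, h3, h4⟩ := hp n k d P
    refine ⟨t, h3, h4.trans ?_⟩
    have h5 : 1 ≤ P.size + k + d := by
      linarith [k.cast_nonneg (α := ℝ), d.cast_nonneg (α := ℝ)]
    -- If there are no weight vectors, then the logarithm is `0`.
    have h6 : 0 ≤ Real.logb 2 (P.numWeights * n) := by
      rw [← Nat.cast_mul]
      rcases Nat.eq_zero_or_pos (P.numWeights * n) with h | h
      · simp [h]
      · exact Real.logb_nonneg (by norm_num) (by exact_mod_cast h)
    exact (Parikh.nat_mul_pow_le_mul_pow h5 (by omega) (by omega)).trans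
      (le_mul_of_one_le_left (by positivity)
        (Real.one_le_rpow (by norm_num) (by positivity)))
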